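/- **Setting.** Let $\mathcal V=\{1,\dots,N\}$, $x_0\in\mathbb R^n$, and let all random variables live on one probability space. For $k\ge 0$ and $i,j\in\mathcal V$ let $H_i(k)\in\mathbb R^{n_i\times n}$ be random matrices, $\mathcal A(k)=[w_{ij}(k)]\in\mathbb R^{N\times N}$ random weighted adjacency matrices with zero diagonal (entries may be negative; $(j,i)$ is an edge of the digraph $\mathcal G(k)$ iff $w_{ij}(k)\ne 0$, and $\mathcal N_i(k)=\{j: w_{ij}(k)\neq 0\}$), $v_i(k)\in\mathbb R^{n_i}$ the measurement noises and $\xi_{ji}(k)\in\mathbb R^n$ the communication noises. Node $i$ observes $y_i(k)=H_i(k)x_0+v_i(k)$, receives $\mu_{ji}(k)=x_j(k)+f_{ji}(x_j(k)-x_i(k))\,\xi_{ji}(k)$ from $j\in\mathcal N_i(k)$, where $f_{ji}:\mathbb R^n\to\mathbb R$ is measurable, and, from a deterministic $x_i(0)\in\mathbb R^n$ and with deterministic gains $a(k),b(k),\lambda(k)$, updates $$x_i(k+1)=x_i(k)+a(k)H_i^T(k)\big(y_i(k)-H_i(k)x_i(k)\big)+b(k)\sum_{j\in\mathcal N_i(k)}w_{ij}(k)\big(\mu_{ji}(k)-x_i(k)\big)-\lambda(k)x_i(k).$$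 Let $\mathcal F(k)=\sigma(\mathcal A(s),H_i(s),v_i(s),\xi_{ji}(s): i,j\in\mathcal V,\ 0\le s\le k)$, let $\mathcal F(-1)$ be trivial, and let $v(k)$, $\xi(k)$ be the stacked noises. A matrix $W=[W_{ij}]$ is called balanced if $\sum_jW_{ij}=\sum_jW_{ji}$ for all $i$. **Assumptions.** - ($\Gamma_1$) For every $k\ge 0$, $\mathbb E[\mathcal A(k)\mid\mathcal F(k-1)]$ is a.s. entrywise nonnegative and balanced. - (A1) There are constants $\sigma,c$ with $|f_{ji}(x)|\le\sigma\|x\|+c$ for all $x\in\mathbb R^n$ and $i,j\in\mathcal V$. - (A2) $\{v(k),\mathcal F(k)\}$ and $\{\xi(k),\mathcal F(k)\}$ are martingale difference sequences; the process $\{(v(k),\xi(k)),k\ge0\}$ is independent of the process $\{(H_1(k),\dots,H_N(k),\mathcal A(k)),k\ge0\}$; and there is a constant $\beta_v$ with $\sup_{k\ge0}\mathbb E[\|v(k)\|^2+\|\xi(k)\|^2\mid\mathcal F(k-1)]\le\beta_v$ a.s. - (A3) $\{(H_1(k),\dots,H_N(k),\mathcal A(k)),k\ge 0\}$ is a homogeneous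 Markov chain on a countable set $\mathcal S$ of distinct states $(H_{1,l},\dots,H_{N,l},\mathcal A_l)$; it is uniformly ergodic, i.e. its $t$-step transition probabilities $P^t$ satisfy $\sup_{s\in\mathcal S}\|P^t(s,\cdot)-\pi\|_{TV}\to0$ as $t\to\infty$, with unique stationary distribution $\pi=(\pi_l)_l$; and $\sup_l\|\mathcal A_l\|<\infty$, $\sup_l\|\mathbf{diag}(H_{1,l},\dots,H_{N,l})\|<\infty$ in the matrix 2-norm. - The stationary weighted adjacency matrix $\sum_l\pi_l\mathcal A_l$ is entrywise nonnegative and balanced, and its digraph contains a directed spanning tree. - (Spatio-temporal joint observability) $\lambda_{\min}\Big(\sum_{i=1}^N\sum_l\pi_lH_{i,l}^TH_{i,l}\Big)>0$. **Conditions on the gains.** In both conditions $a,b,\lambda$ are nonnegative and nonincreasing, $\sum_{k}\min\{a(k),b(k)\}=\infty$, $a(k)=\mathcal O(a(k+1))$ and $b(k)=\mathcal O(b(k+1))$. In addition: - (C1) $\sum_k(a^2(k)+b^2(k)+\lambda(k))<\infty$ and $\lambda(k)=o(\min\{a(k),b(k)\})$. - (C2) $a(k),b(k),\lambda(k)\to0$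 and $a^2(k)+b^2(k)+\lambda(k)=o(\min\{a(k),b(k)\})$. **Conclusion.** Under all the above assumptions: (I) If (C1) holds, then $\lim_{k\to\infty}x_i(k)=x_0$ a.s. for every $i\in\mathcal V$. (II) If (C2) holds, then $\mathbb E\|x_i(k)-x_0\|^2<\infty$ for all $k$ and $\lim_{k\to\infty}\mathbb E\|x_i(k)-x_0\|^2=0$, for every $i\in\mathcal V$. -/

import Mathlib

open MeasureTheory ProbabilityTheory Filter Topology Asymptotics

noncomputable section

namespace DecReg

/-- Matrices carry the product (Borel) sigma-algebra of their entries. -/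
instance matrixMeasurableSpace {α β : Type*} : MeasurableSpace (Matrix α β ℝ) :=
  inferInstanceAs (MeasurableSpace (α → β → ℝ))

/-! ### Weighted digraphs and matrices -/

section Graphs

variable {N : ℕ}

/-- `(j, i)` is an edge of the digraph with weighted adjacency matrix `W` iff `W i j ≠ 0`;
`neighbors W i` is the set of nodes `j` such that `(j, i)` is an edge. -/
def neighbors (W : Matrix (Fin N) (Fin N) ℝ) (i : Fin N) : Finset (Fin N) :=
  open scoped Classical in Finset.univ.filter fun j => W i j ≠ 0

def inDegree (W : Matrix (Fin N) (Fin N) ℝ) (i : Fin N) : ℝ := ∑ j, W i j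

def outDegree (W : Matrix (Fin N) (Fin N) ℝ) (i : Fin N) : ℝ := ∑ j, W j i

/-- The weighted digraph is balanced: in-degree and out-degree agree at every node. -/
def IsBalanced (W : Matrix (Fin N) (Fin N) ℝ) : Prop := ∀ i, inDegree W i = outDegree W i

/-- The digraph contains a directed spanning tree: there are a root `r` and a parent map such
that every node `i ≠ r` receives an edge from its parent, and following the parents from any node
leads to the root. -/
def HasSpanningTree (W : Matrix (Fin N) (Fin N) ℝ) : Prop :=
  ∃ (r : Fin N) (parent : Fin N → Fin N),
    (∀ i, i ≠ r → parent i ∈ neighbors W i) ∧ ∀ i, ∃ t : ℕ, parent^[t] i = r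

/-- The minimum eigenvalue of a real symmetric matrix. -/
def lambdaMin {d : ℕ} (A : Matrix (Fin d) (Fin d) ℝ) : ℝ := sInf (spectrum ℝ A)

end Graphs

/-! ### Homogeneous Markov chains on a countable state space -/

section Chains

variable {ι : Type*}

/-- `p` is a transition matrix: nonnegative, with rows summing to one. -/
def IsTransition (p : ι → ι → ℝ) : Prop := (∀ l l', 0 ≤ p l l') ∧ ∀ l, HasSum (p l) 1

/-- The `t`-step transition probabilities. -/
def stepProb (p : ι → ι → ℝ) : ℕ → ι → ι → ℝ
  | 0 => fun l l' => open scoped Classical in if l = l' then 1 else 0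
  | t + 1 => fun l l' => ∑' j, p l j * stepProb p t j l'

/-- `π` is a stationary distribution of the transition matrix `p`. -/
structure IsStationary (p : ι → ι → ℝ) (π : ι → ℝ) : Prop where
  nonneg : ∀ l, 0 ≤ π l
  hasSum_one : HasSum π 1
  invariant : ∀ l', HasSum (fun l => π l * p l l') (π l')

/-- Uniform ergodicity: `sup_l ‖p^t(l, ·) - π‖ → 0` as `t → ∞`, in total variation. -/
def UniformlyErgodic (p : ι → ι → ℝ) (π : ι → ℝ) : Prop :=
  ∀ ε > 0, ∃ t₀ : ℕ, ∀ t ≥ t₀, ∀ l, ∑' l', |stepProb p t l l' - π l'| ≤ ε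

/-- The process `Z` takes its values in the countable set `{S l}` (the states `S l` being pairwise
distinct) and is a homogeneous Markov chain with transition matrix `p`. -/
structure IsHomogeneousMarkovChain {Ω X : Type*} [MeasurableSpace Ω] (μ : Measure Ω)
    (Z : ℕ → Ω → X) (S : ι → X) (p : ι → ι → ℝ) : Prop where
  distinct : Function.Injective S
  mem_states : ∀ k ω, ∃ l, Z k ω = S l
  transition : IsTransition p
  markov : ∀ (k : ℕ) (s : ℕ → ι),
    μ.real {ω | ∀ j ≤ k + 1, Z j ω = S (s j)} =
      μ.real {ω | ∀ j ≤ k, Z j ω = S (s j)} * p (s k) (s (k + 1))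

end Chains

/-! ### The regression model, the algorithm and the assumptions -/

/-- A value of (regression matrices of all nodes, weighted adjacency matrix). -/
abbrev State (N n : ℕ) (m : Fin N → ℕ) : Type :=
  ((i : Fin N) → Matrix (Fin (m i)) (Fin n) ℝ) × Matrix (Fin N) (Fin N) ℝ

/-- The data of the problem: `N` nodes, parameter dimension `n`, `m i` the dimension of the
observation of node `i`. -/
structure Model (Ω : Type*) [MeasurableSpace Ω] (N n : ℕ) (m : Fin N → ℕ) where
  /-- the unknown true parameter -/
  x0 : EuclideanSpace ℝ (Fin n)
  /-- regression matrices `H_i(k)` -/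
  reg : ℕ → Ω → (i : Fin N) → Matrix (Fin (m i)) (Fin n) ℝ
  /-- weighted adjacency matrices `[w_ij(k)]` of the random digraphs -/
  adj : ℕ → Ω → Matrix (Fin N) (Fin N) ℝ
  /-- measurement noises `v_i(k)` -/
  noise : ℕ → Ω → (i : Fin N) → EuclideanSpace ℝ (Fin (m i))
  /-- communication noises; `comm k ω j i` is `ξ_ji(k)` -/
  comm : ℕ → Ω → Fin N → Fin N → EuclideanSpace ℝ (Fin n)
  /-- noise intensity functions; `intensity j i` is `f_ji` -/
  intensity : Fin N → Fin N → EuclideanSpace ℝ (Fin n) → ℝ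
  /-- initial estimates `x_i(0)` -/
  init : Fin N → EuclideanSpace ℝ (Fin n)
  /-- innovation gain -/
  a : ℕ → ℝ
  /-- consensus gain -/
  b : ℕ → ℝ
  /-- regularization gain -/
  lam : ℕ → ℝ
  measurable_reg : ∀ k, Measurable (reg k)
  measurable_adj : ∀ k, Measurable (adj k)
  measurable_noise : ∀ k, Measurable (noise k)
  measurable_comm : ∀ k, Measurable (comm k)
  measurable_intensity : ∀ j i, Measurable (intensity j i)
  adj_diag : ∀ k ω i, adj k ω i i = 0

namespace Model

variable {Ω : Type*} [MeasurableSpace Ω] {N n : ℕ} {m : Fin N → ℕ} (M : Model Ω N n m)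

/-- The observation `y_i(k) = H_i(k) x_0 + v_i(k)`. -/
def obs (k : ℕ) (ω : Ω) (i : Fin N) : EuclideanSpace ℝ (Fin (m i)) :=
  Matrix.toEuclideanLin (M.reg k ω i) M.x0 + M.noise k ω i

/-- What node `i` receives from node `j` when the estimates are `x`:
`μ_ji(k) = x_j + f_ji(x_j - x_i) ξ_ji(k)`. -/
def received (k : ℕ) (ω : Ω) (x : Fin N → EuclideanSpace ℝ (Fin n)) (j i : Fin N) :
    EuclideanSpace ℝ (Fin n) :=
  x j + M.intensity j i (x j - x i) • M.comm k ω j i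

/-- The estimates `x_i(k)` of the decentralized online regularized algorithm. -/
def estimate : ℕ → Ω → Fin N → EuclideanSpace ℝ (Fin n)
  | 0 => fun _ i => M.init i
  | k + 1 => fun ω i =>
      estimate k ω i
        + M.a k • Matrix.toEuclideanLin (M.reg k ω i).transpose
            (M.obs k ω i - Matrix.toEuclideanLin (M.reg k ω i) (estimate k ω i))
        + M.b k • ∑ j ∈ neighbors (M.adj k ω) i,
            M.adj k ω i j • (M.received k ω (estimate k ω) j i - estimate k ω i)
        - M.lam k • estimate k ω i

/-- `M.past k` is the sigma-algebra `F(k-1)` generated by the graphs, regression matrices and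
noises at the instants `s < k`; in particular `M.past 0` is trivial. -/
def past (k : ℕ) : MeasurableSpace Ω :=
  ⨆ (s : ℕ) (_ : s < k),
    (MeasurableSpace.comap (M.adj s) inferInstance ⊔
      MeasurableSpace.comap (M.reg s) inferInstance ⊔
      MeasurableSpace.comap (M.noise s) inferInstance ⊔
      MeasurableSpace.comap (M.comm s) inferInstance)

/-- The conditional generalized weighted adjacency matrix `E[A(k) | F(k-1)]`. -/
def condAdj (μ : Measure Ω) (k : ℕ) (ω : Ω) : Matrix (Fin N) (Fin N) ℝ :=
  Matrix.of fun i j => (μ[fun ω' => M.adj k ω' i j | M.past k]) ω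

/-- The class of graph sequences whose conditional digraphs are nonnegative and balanced. -/
def BalancedConditionalDigraphs (μ : Measure Ω) : Prop :=
  ∀ k, (∀ᵐ ω ∂μ, ∀ i j, 0 ≤ M.condAdj μ k ω i j) ∧ ∀ᵐ ω ∂μ, IsBalanced (M.condAdj μ k ω)

/-- (A1): linear growth of the noise intensity functions. -/
def A1 : Prop :=
  ∃ σ c : ℝ, ∀ j i x, |M.intensity j i x| ≤ σ * ‖x‖ + c

/-- `‖v(k)‖² + ‖ξ(k)‖²`, where `v(k)` and `ξ(k)` stack the noises of all nodes and channels. -/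
def noiseEnergy (k : ℕ) (ω : Ω) : ℝ :=
  ∑ i, ‖M.noise k ω i‖ ^ 2 + ∑ i, ∑ j, ‖M.comm k ω j i‖ ^ 2

/-- (A2): the noises are martingale differences, independent of the regression matrices and
graphs, with uniformly bounded conditional second moments. -/
structure A2 (μ : Measure Ω) : Prop where
  integrable_noise : ∀ k i, Integrable (fun ω => M.noise k ω i) μ
  condExp_noise : ∀ k i, μ[fun ω => M.noise k ω i | M.past k] =ᵐ[μ] 0
  integrable_comm : ∀ k j i, Integrable (fun ω => M.comm k ω j i) μ
  condExp_comm : ∀ k j i, μ[fun ω => M.comm k ω j i | M.past k] =ᵐ[μ] 0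
  indep : IndepFun (fun ω (k : ℕ) => (M.noise k ω, M.comm k ω))
    (fun ω (k : ℕ) => (M.reg k ω, M.adj k ω)) μ
  integrable_energy : ∀ k, Integrable (M.noiseEnergy k) μ
  bounded_energy : ∃ β : ℝ, ∀ k, ∀ᵐ ω ∂μ, (μ[M.noiseEnergy k | M.past k]) ω ≤ β

open scoped Matrix.Norms.L2Operator in
/-- (A3): the pair (regression matrices, adjacency matrix) is a homogeneous and uniformly ergodic
Markov chain with states `S l`, transition matrix `p` and unique stationary distribution `π`, and
the states are bounded in the matrix 2-norm. The regression matrices of all nodes are arranged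
block diagonally in the bound. -/
structure A3 (μ : Measure Ω) {ι : Type*} (S : ι → State N n m) (p : ι → ι → ℝ) (π : ι → ℝ) :
    Prop where
  chain : IsHomogeneousMarkovChain μ (fun k ω => (M.reg k ω, M.adj k ω)) S p
  stationary : IsStationary p π
  unique : ∀ π', IsStationary p π' → π' = π
  ergodic : UniformlyErgodic p π
  bounded_adj : BddAbove (Set.range fun l => ‖(S l).2‖)
  bounded_reg : BddAbove (Set.range fun l => ‖Matrix.blockDiagonal' (S l).1‖)

/-- Condition (C1) on the gains. -/
structure C1 : Prop where
  nonneg : ∀ k, 0 ≤ M.a k ∧ 0 ≤ M.b k ∧ 0 ≤ M.lam k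
  antitone_a : Antitone M.a
  antitone_b : Antitone M.b
  antitone_lam : Antitone M.lam
  sum_min : Tendsto (fun K => ∑ k ∈ Finset.range K, min (M.a k) (M.b k)) atTop atTop
  summable : Summable fun k => M.a k ^ 2 + M.b k ^ 2 + M.lam k
  bigO_a : M.a =O[atTop] fun k => M.a (k + 1)
  bigO_b : M.b =O[atTop] fun k => M.b (k + 1)
  littleO : M.lam =o[atTop] fun k => min (M.a k) (M.b k)

/-- Condition (C2) on the gains. -/
structure C2 : Prop where
  nonneg : ∀ k, 0 ≤ M.a k ∧ 0 ≤ M.b k ∧ 0 ≤ M.lam k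
  antitone_a : Antitone M.a
  antitone_b : Antitone M.b
  antitone_lam : Antitone M.lam
  tendsto_a : Tendsto M.a atTop (𝓝 0)
  tendsto_b : Tendsto M.b atTop (𝓝 0)
  tendsto_lam : Tendsto M.lam atTop (𝓝 0)
  sum_min : Tendsto (fun K => ∑ k ∈ Finset.range K, min (M.a k) (M.b k)) atTop atTop
  bigO_a : M.a =O[atTop] fun k => M.a (k + 1)
  bigO_b : M.b =O[atTop] fun k => M.b (k + 1)
  littleO : (fun k => M.a k ^ 2 + M.b k ^ 2 + M.lam k) =o[atTop] fun k => min (M.a k) (M.b k)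

end Model

section Stationary

variable {ι : Type*} {N n : ℕ} {m : Fin N → ℕ}

/-- The stationary weighted adjacency matrix `∑_l π_l A_l`. -/
def stationaryAdj (S : ι → State N n m) (π : ι → ℝ) : Matrix (Fin N) (Fin N) ℝ :=
  ∑' l, π l • (S l).2

/-- Spatio-temporal joint observability: `λ_min (∑_i ∑_l π_l H_{i,l}ᵀ H_{i,l}) > 0`. -/
def JointlyObservable (S : ι → State N n m) (π : ι → ℝ) : Prop :=
  0 < lambdaMin (∑ i, ∑' l, π l • (((S l).1 i).transpose * (S l).1 i))

end Stationary

end DecReg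

end

namespace DecReg

/-! ### Conditional expectations, independence and weighted second moments. -/

section ConditionalExpectation

variable {Ω : Type*} {mΩ : MeasurableSpace Ω} {μ : Measure Ω}

/-! Let V be the total squared error over all nodes, u its mean, and d = min(a, b). The error obeys
e(k+1) = e(k) - drift + diffusion. The noises are independent of the chain of regression matrices
and graphs, so they stay centred, with bounded conditional energy, even when the past noises and the
entire chain are given. Hence the cross term has mean zero and the diffusion costs only second order
in the gains. On every past event, `exists_one_step` bounds the mean of V(k+1) by that of V(k) - 2aR
- 2bL + Cγ(1 + V). Here R is the observation form, L the Laplacian form, and γ (`gainSq`) collects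
a², b², λ² and |λ|; the factor 1 + V reflects the linear growth of the noise intensities.

R is nonnegative pointwise. L has nonnegative mean on past events because the digraph, conditioned
on the past, is nonnegative and balanced. So in the mean aR + bL ≥ d(R + L), and only R + L has to
be bounded below. A single instant need not suffice, since one graph may be disconnected and one
observation degenerate. The remedy is to freeze the error t steps earlier. By uniform ergodicity the
chain has by then almost forgotten the past (`abs_integral_mul_sub_stationary_le`), so the mean of R
+ L at the frozen error is close to the form of the stationary matrices. That form is positive
definite: if it vanishes, the spanning tree forces consensus and joint observability forces the
common value to be 0 (`exists_dissipation`). Over t steps the error moves by only o(1)(1 + u) in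
mean square (`exists_window_displacement`), so unfreezing is harmless.

This gives u(k+1) ≤ (1 - θd + p + q)u + p + q for some θ > 0, with p summable and q = o(d), and
`tendsto_zero_of_recursion` yields u → 0. Both gain conditions fit this scheme: under (C1) γ goes
into p, under (C2) it goes into q. This proves (II). For (I), discarding R and L leaves V an almost
supermartingale with summable perturbations. It converges almost surely, and u → 0 identifies the
limit as 0 (`ae_tendsto_zero_of_almost_supermartingale`). -/

theorem sup_eq_generateFrom_inter (m₁ m₂ : MeasurableSpace Ω) :
    m₁ ⊔ m₂ = MeasurableSpace.generateFrom
      {s | ∃ a b, MeasurableSet[m₁] a ∧ MeasurableSet[m₂] b ∧ s = a ∩ b} := by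
  refine le_antisymm (sup_le ?_ ?_) (MeasurableSpace.generateFrom_le ?_)
  · intro a ha
    exact MeasurableSpace.measurableSet_generateFrom
      ⟨a, Set.univ, ha, MeasurableSet.univ, by simp⟩
  · intro b hb
    exact MeasurableSpace.measurableSet_generateFrom
      ⟨Set.univ, b, MeasurableSet.univ, hb, by simp⟩
  · rintro _ ⟨a, b, ha, hb, rfl⟩
    have h1 : m₁ ≤ m₁ ⊔ m₂ := le_sup_left
    have h2 : m₂ ≤ m₁ ⊔ m₂ := le_sup_right
    exact MeasurableSet.inter (h1 a ha) (h2 b hb)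

theorem isPiSystem_inter (m₁ m₂ : MeasurableSpace Ω) :
    IsPiSystem {s | ∃ a b, MeasurableSet[m₁] a ∧ MeasurableSet[m₂] b ∧ s = a ∩ b} := by
  rintro _ ⟨a, b, ha, hb, rfl⟩ _ ⟨a', b', ha', hb', rfl⟩ _
  exact ⟨a ∩ a', b ∩ b', MeasurableSet.inter ha ha', MeasurableSet.inter hb hb',
    Set.inter_inter_inter_comm a b a' b'⟩

/-- The restriction of `f` to `a` is independent of `m₂`, so its conditional expectation given `m₂`
is the constant equal to its mean; integrating that constant over `b` gives the product. -/
theorem setIntegral_inter_of_indep {E : Type*} [NormedAddCommGroup E] [NormedSpace ℝ E]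
    [CompleteSpace E] [IsProbabilityMeasure μ] {m₂ m₃ : MeasurableSpace Ω}
    (h₂ : m₂ ≤ mΩ) (h₃ : m₃ ≤ mΩ) (hind : Indep m₃ m₂ μ) {f : Ω → E}
    (hfm : StronglyMeasurable[m₃] f) (hf : Integrable f μ) {a b : Set Ω}
    (ha : MeasurableSet[m₃] a) (hb : MeasurableSet[m₂] b) :
    ∫ x in a ∩ b, f x ∂μ = μ.real b • ∫ x in a, f x ∂μ := by
  have h := condExp_indep_eq h₃ h₂ (hfm.indicator ha) hind
  have h' := setIntegral_condExp h₂ (hf.indicator (h₃ a ha)) hb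
  rw [setIntegral_congr_ae (h₂ b hb) (h.mono fun _ hx _ => hx), setIntegral_const,
    integral_indicator (h₃ a ha), setIntegral_indicator (h₃ a ha), Set.inter_comm b a] at h'
  exact h'.symm

/-- Adjoining an independent sigma-algebra does not change the conditional expectation. -/
theorem condExp_sup_of_indep {E : Type*} [NormedAddCommGroup E] [NormedSpace ℝ E]
    [CompleteSpace E] [IsProbabilityMeasure μ] {m₁ m₂ m₃ : MeasurableSpace Ω} (h₁₃ : m₁ ≤ m₃)
    (h₂ : m₂ ≤ mΩ) (h₃ : m₃ ≤ mΩ) (hind : Indep m₃ m₂ μ) {f : Ω → E}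
    (hfm : StronglyMeasurable[m₃] f) (hf : Integrable f μ) :
    μ[f | m₁ ⊔ m₂] =ᵐ[μ] μ[f | m₁] := by
  have h₁ : m₁ ≤ mΩ := h₁₃.trans h₃
  have hs : m₁ ⊔ m₂ ≤ mΩ := sup_le h₁ h₂
  have hle : m₁ ≤ m₁ ⊔ m₂ := le_sup_left
  refine (ae_eq_condExp_of_forall_setIntegral_eq hs hf
    (fun s _ _ => integrable_condExp.integrableOn) ?_
    (stronglyMeasurable_condExp.mono hle).aestronglyMeasurable).symm
  -- Both sides are countably additive in `s`, so intersections `a ∩ b` suffice. There independence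
  -- factors out the measure of `b` on each side, and what remains is the defining property of `μ[f
  -- | m₁]` on `a`.
  have key : ∀ s, MeasurableSet[m₁ ⊔ m₂] s →
      ∫ x in s, (μ[f | m₁]) x ∂μ = ∫ x in s, f x ∂μ := by
    refine MeasurableSpace.induction_on_inter (m := m₁ ⊔ m₂)
      (sup_eq_generateFrom_inter m₁ m₂) (isPiSystem_inter m₁ m₂) (by simp) ?_ ?_ ?_
    · rintro _ ⟨a, b, ha, hb, rfl⟩
      rw [setIntegral_inter_of_indep h₂ h₃ hind (stronglyMeasurable_condExp.mono h₁₃)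
        integrable_condExp (h₁₃ a ha) hb,
        setIntegral_inter_of_indep h₂ h₃ hind hfm hf (h₁₃ a ha) hb, setIntegral_condExp h₁ hf ha]
    · intro t ht h
      have ht' := hs t ht
      have e1 := integral_add_compl ht' (integrable_condExp (μ := μ) (m := m₁) (f := f))
      have e2 := integral_add_compl ht' hf
      rw [integral_condExp h₁, ← e2, h] at e1
      exact add_left_cancel e1
    · intro g hd hg h
      rw [integral_iUnion (fun i => hs _ (hg i)) hd integrable_condExp.integrableOn,
        integral_iUnion (fun i => hs _ (hg i)) hd hf.integrableOn]
      simp_rw [h]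
  exact fun s hs' _ => key s hs'

/-- If `E[X | m] ≤ β` and `g ≥ 0` is `m`-measurable and integrable, then `E[g X] ≤ β E[g]`. -/
theorem integrable_mul_of_condExp_le [IsProbabilityMeasure μ] {m : MeasurableSpace Ω}
    (hm : m ≤ mΩ) {X g : Ω → ℝ} {β : ℝ} (hX0 : ∀ ω, 0 ≤ X ω) (hXm : Measurable[mΩ] X)
    (hX : Integrable X μ) (hβ : ∀ᵐ ω ∂μ, (μ[X | m]) ω ≤ β) (hg0 : ∀ ω, 0 ≤ g ω)
    (hgm : Measurable[m] g) (hg : Integrable g μ) :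
    Integrable (fun ω => g ω * X ω) μ ∧ ∫ ω, g ω * X ω ∂μ ≤ β * ∫ ω, g ω ∂μ := by
  have hβ0 : 0 ≤ β := by
    have h0 : 0 ≤ᵐ[μ] μ[X | m] := condExp_nonneg (Eventually.of_forall hX0)
    obtain ⟨ω, h1, h2⟩ := (hβ.and h0).exists
    exact le_trans h2 h1
  -- Integrability of `g * X` is part of the claim, so the pull-out property is not yet available.
  -- Instead the bound on `μ[X | m]` is read as a domination of measures on `m`, and the nonnegative
  -- `g` is integrated against both.
  set ν := μ.withDensity (fun ω => ENNReal.ofReal (X ω)) with hν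
  have hgm' : Measurable[mΩ] g := hgm.mono hm le_rfl
  have hle : ν.trim hm ≤ ENNReal.ofReal β • μ.trim hm := by
    refine Measure.le_iff.2 fun s hs => ?_
    rw [trim_measurableSet_eq hm hs, Measure.smul_apply, trim_measurableSet_eq hm hs, hν,
      withDensity_apply _ (hm s hs),
      ← ofReal_integral_eq_lintegral_ofReal hX.integrableOn (Eventually.of_forall hX0),
      smul_eq_mul, ← ofReal_measureReal (μ := μ) (s := s), ← ENNReal.ofReal_mul hβ0]
    refine ENNReal.ofReal_le_ofReal ?_
    rw [← setIntegral_condExp hm hX hs]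
    calc ∫ x in s, (μ[X | m]) x ∂μ ≤ ∫ _ in s, β ∂μ :=
          setIntegral_mono_ae integrable_condExp.integrableOn (integrable_const _).integrableOn hβ
      _ = β * μ.real s := by simp [mul_comm]
  have hlint : ∫⁻ ω, ENNReal.ofReal (g ω * X ω) ∂μ
      ≤ ENNReal.ofReal (β * ∫ ω, g ω ∂μ) := by
    have hgo : Measurable[m] fun ω => ENNReal.ofReal (g ω) := hgm.ennreal_ofReal
    calc ∫⁻ ω, ENNReal.ofReal (g ω * X ω) ∂μ
        = ∫⁻ ω, ENNReal.ofReal (g ω) ∂ν := by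
          rw [hν, lintegral_withDensity_eq_lintegral_mul _ hXm.ennreal_ofReal
            hgm'.ennreal_ofReal]
          refine lintegral_congr fun ω => ?_
          rw [Pi.mul_apply, ENNReal.ofReal_mul (hg0 ω), mul_comm]
      _ = ∫⁻ ω, ENNReal.ofReal (g ω) ∂(ν.trim hm) := (lintegral_trim hm hgo).symm
      _ ≤ ∫⁻ ω, ENNReal.ofReal (g ω) ∂(ENNReal.ofReal β • μ.trim hm) :=
          lintegral_mono' hle le_rfl
      _ = ENNReal.ofReal β * ∫⁻ ω, ENNReal.ofReal (g ω) ∂μ := by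
          rw [lintegral_smul_measure, lintegral_trim hm hgo, smul_eq_mul]
      _ = ENNReal.ofReal (β * ∫ ω, g ω ∂μ) := by
          rw [← ofReal_integral_eq_lintegral_ofReal hg (Eventually.of_forall hg0),
            ENNReal.ofReal_mul hβ0]
  have hnn : ∀ ω, 0 ≤ g ω * X ω := fun ω => mul_nonneg (hg0 ω) (hX0 ω)
  have hint : Integrable (fun ω => g ω * X ω) μ := by
    refine ⟨(hgm'.mul hXm).aestronglyMeasurable, ?_⟩
    rw [hasFiniteIntegral_iff_ofReal (Eventually.of_forall hnn)]
    exact hlint.trans_lt ENNReal.ofReal_lt_top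
  refine ⟨hint, ?_⟩
  rw [← ofReal_integral_eq_lintegral_ofReal hint (Eventually.of_forall hnn)] at hlint
  exact (ENNReal.ofReal_le_ofReal_iff
    (mul_nonneg hβ0 (integral_nonneg hg0))).1 hlint

/-- Pull-out property for the inner product as a continuous bilinear map. Besides `X` only the
product has to be integrable, so `g` may be unbounded. -/
theorem integral_inner_eq_zero_of_condExp_eq_zero {E : Type*} [NormedAddCommGroup E]
    [InnerProductSpace ℝ E] [CompleteSpace E] [IsProbabilityMeasure μ] {m : MeasurableSpace Ω}
    (hm : m ≤ mΩ) {g X : Ω → E} (hg : StronglyMeasurable[m] g) (hX : Integrable X μ)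
    (h0 : μ[X | m] =ᵐ[μ] 0) (hgX : Integrable (fun ω => inner ℝ (g ω) (X ω)) μ) :
    ∫ ω, inner ℝ (g ω) (X ω) ∂μ = 0 := by
  have h := condExp_bilin_of_stronglyMeasurable_left (μ := μ) (m := m) (innerSL ℝ (E := E))
    hg hgX hX
  rw [← integral_condExp hm]
  refine (integral_congr_ae (h.trans ?_)).trans (integral_zero Ω ℝ)
  filter_upwards [h0] with ω hω
  simp [hω]

end ConditionalExpectation

/-! ### Deterministic stochastic-approximation recursions. -/

section Recursions

/-- Each step multiplies `w + K` by at most `1 + p k`, so it stays below some `B` because `p` is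
summable. Then `w` minus the partial sums of `p * B` decreases, hence `w` converges. A positive
limit would force a total decrease proportional to the divergent sum of `d`. -/
theorem tendsto_zero_of_recursion_aux {w d p : ℕ → ℝ} {c K : ℝ} (hc : 0 < c) (hK : 0 ≤ K)
    (hw : ∀ k, 0 ≤ w k) (hd : ∀ k, 0 ≤ d k)
    (hsum : Tendsto (fun n => ∑ k ∈ Finset.range n, d k) atTop atTop)
    (hp : ∀ k, 0 ≤ p k) (hps : Summable p)
    (hrec : ∀ k, w (k + 1) ≤ (1 - c * d k) * w k + p k * (w k + K)) :
    Tendsto w atTop (𝓝 0) := by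
  obtain ⟨B, hB⟩ : ∃ B, ∀ k, w k + K ≤ B := by
    refine ⟨(w 0 + K) * Real.exp (∑' k, p k), fun k => ?_⟩
    have h : w k + K ≤ (w 0 + K) * Real.exp (∑ j ∈ Finset.range k, p j) := by
      induction k with
      | zero => simp
      | succ k ih =>
        have h1 : w (k + 1) + K ≤ (w k + K) * (1 + p k) := by
          have := mul_nonneg (mul_nonneg hc.le (hd k)) (hw k)
          nlinarith [hrec k]
        have h2 : 1 + p k ≤ Real.exp (p k) := by linarith [Real.add_one_le_exp (p k)]
        rw [Finset.sum_range_succ, Real.exp_add, ← mul_assoc]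
        refine h1.trans (mul_le_mul ih h2 (by linarith [hp k]) ?_)
        exact mul_nonneg (add_nonneg (hw 0) hK) (Real.exp_pos _).le
    refine h.trans (mul_le_mul_of_nonneg_left (Real.exp_le_exp.2 ?_) (add_nonneg (hw 0) hK))
    exact hps.sum_le_tsum _ fun i _ => hp i
  have hB0 : 0 ≤ B := (add_nonneg (hw 0) hK).trans (hB 0)
  have hstep : ∀ k, w (k + 1) ≤ w k - c * d k * w k + p k * B := fun k => by
    have := mul_le_mul_of_nonneg_left (hB k) (hp k)
    linarith [hrec k]
  set s : ℕ → ℝ := fun k => ∑ j ∈ Finset.range k, p j * B with hs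
  have hsconv : Tendsto s atTop (𝓝 (∑' j, p j * B)) := (hps.mul_right B).hasSum.tendsto_sum_nat
  have hanti : Antitone fun k => w k - s k := by
    refine antitone_nat_of_succ_le fun k => ?_
    have := mul_nonneg (mul_nonneg hc.le (hd k)) (hw k)
    simp only [hs, Finset.sum_range_succ]
    linarith [hstep k]
  have hsle : ∀ k, s k ≤ ∑' j, p j * B := fun k =>
    (hps.mul_right B).sum_le_tsum _ fun i _ => mul_nonneg (hp i) hB0
  have hbdd : BddBelow (Set.range fun k => w k - s k) :=
    ⟨-∑' j, p j * B, by rintro _ ⟨k, rfl⟩; simp only; linarith [hw k, hsle k]⟩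
  have hconv := (tendsto_atTop_ciInf hanti hbdd).add hsconv
  simp only [sub_add_cancel] at hconv
  set L := (⨅ k, (w k - s k)) + ∑' j, p j * B
  have hL0 : 0 ≤ L := ge_of_tendsto' hconv hw
  rcases hL0.eq_or_lt with h | hL
  · rwa [← h] at hconv
  exfalso
  obtain ⟨k₀, hk₀⟩ := eventually_atTop.1 (hconv.eventually (lt_mem_nhds (half_lt_self hL)))
  -- From `k₀` on, `w` exceeds half of its limit, so every step loses at least `c * (L / 2) * d`, up
  -- to the summable correction carried by `s`.
  have hlow : ∀ n, c * (L / 2) * ((∑ k ∈ Finset.range (k₀ + n), d k)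
      - ∑ k ∈ Finset.range k₀, d k) ≤ (w k₀ - s k₀) - (w (k₀ + n) - s (k₀ + n)) := by
    intro n
    induction n with
    | zero => simp
    | succ n ih =>
      have h1 := hstep (k₀ + n)
      have h2 := mul_le_mul_of_nonneg_left (hk₀ (k₀ + n) (by omega)).le
        (mul_nonneg hc.le (hd (k₀ + n)))
      rw [← add_assoc, Finset.sum_range_succ]
      have h3 : s (k₀ + n + 1) = s (k₀ + n) + p (k₀ + n) * B := by
        simp only [hs, Finset.sum_range_succ]
      rw [h3]
      linarith
  obtain ⟨n, hn⟩ := ((hsum.comp (tendsto_add_atTop_nat k₀)).eventually_gt_atTop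
    ((w k₀ - s k₀ + ∑' j, p j * B) / (c * (L / 2)) + ∑ k ∈ Finset.range k₀, d k)).exists
  have h1 := hlow n
  simp only [Function.comp_apply, add_comm n k₀] at hn
  have hcL : 0 < c * (L / 2) := by positivity
  rw [← lt_sub_iff_add_lt, div_lt_iff₀ hcL] at hn
  linarith [hw (k₀ + n), hsle (k₀ + n)]

/-- A stochastic-approximation recursion with diverging gains `d` and perturbations which are
either summable or negligible with respect to the gains. -/
theorem tendsto_zero_of_recursion {u d p q : ℕ → ℝ} {θ : ℝ} (hθ : 0 < θ)
    (hu : ∀ k, 0 ≤ u k) (hd : ∀ k, 0 ≤ d k) (hd0 : Tendsto d atTop (𝓝 0))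
    (hsum : Tendsto (fun n => ∑ k ∈ Finset.range n, d k) atTop atTop)
    (hp : ∀ k, 0 ≤ p k) (hps : Summable p) (hq : q =o[atTop] d)
    (hrec : ∀ᶠ k in atTop, u (k + 1) ≤ (1 - θ * d k + p k + q k) * u k + p k + q k) :
    Tendsto u atTop (𝓝 0) := by
  -- The free term `q` need not be summable, so it is removed by truncation: above the level `κ`,
  -- half of the contraction dominates everything that `q` contributes.
  have main : ∀ κ > 0, Tendsto (fun k => max (u k - κ) 0) atTop (𝓝 0) := by
    intro κ hκ
    set c := θ / 2 with hc
    have hc0 : 0 < c := by positivity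
    -- The bound `c` controls the term `q * u`, and `κ * c` controls the free term `q`; together
    -- they use up `c` of the rate `θ = 2 * c`.
    set η := min c (κ * c) with hη
    have hη0 : 0 < η := by positivity
    have hqe := hq.def hη0
    have hde : ∀ᶠ k in atTop, c * d k ≤ 1 := by
      have : Tendsto (fun k => c * d k) atTop (𝓝 0) := by simpa using hd0.const_mul c
      exact (this.eventually (gt_mem_nhds one_pos)).mono fun _ h => h.le
    obtain ⟨k₀, hk₀⟩ := eventually_atTop.1 (hqe.and (hde.and hrec))
    rw [← tendsto_add_atTop_iff_nat k₀]
    refine tendsto_zero_of_recursion_aux (d := fun k => d (k + k₀)) (p := fun k => p (k + k₀))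
      (K := κ + 1) hc0 (by positivity) (fun k => le_max_right _ _) (fun k => hd _) ?_
      (fun k => hp _) ((summable_nat_add_iff k₀).2 hps) ?_
    · have h1 : ∀ n, ∑ k ∈ Finset.range n, d (k + k₀)
          = (∑ k ∈ Finset.range (n + k₀), d k) + -∑ k ∈ Finset.range k₀, d k := by
        intro n
        rw [add_comm n k₀, Finset.sum_range_add]
        simp [add_comm]
      simp_rw [h1]
      exact tendsto_atTop_add_const_right _ _ (hsum.comp (tendsto_add_atTop_nat k₀))
    · intro k
      obtain ⟨h1, h2, h3⟩ := hk₀ (k + k₀) (by omega)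
      rw [Real.norm_eq_abs, Real.norm_eq_abs, abs_of_nonneg (hd _)] at h1
      have h1' := (le_abs_self _).trans h1
      have hq1 : q (k + k₀) ≤ c * d (k + k₀) :=
        h1'.trans (mul_le_mul_of_nonneg_right (min_le_left _ _) (hd _))
      have hq2 : q (k + k₀) ≤ κ * c * d (k + k₀) :=
        h1'.trans (mul_le_mul_of_nonneg_right (min_le_right _ _) (hd _))
      have hu' := hu (k + k₀)
      have hp' := hp (k + k₀)
      have hle := le_max_left (u (k + k₀) - κ) 0
      have hge := le_max_right (u (k + k₀) - κ) 0
      have e : k + 1 + k₀ = k + k₀ + 1 := by ring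
      have hmul := mul_le_mul_of_nonneg_right hq1 hu'
      have hmul2 := mul_le_mul_of_nonneg_left hle (sub_nonneg.2 h2)
      have hmul3 := mul_le_mul_of_nonneg_left hle hp'
      rw [e]
      refine max_le ?_ (add_nonneg (mul_nonneg (sub_nonneg.2 h2) hge)
        (mul_nonneg hp' (by linarith)))
      have hθc : θ = 2 * c := by rw [hc]; ring
      rw [hθc] at h3
      nlinarith
  rw [Metric.tendsto_atTop]
  intro ε hε
  obtain ⟨k₀, hk₀⟩ := eventually_atTop.1
    ((main (ε / 2) (by positivity)).eventually (gt_mem_nhds (half_pos hε)))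
  refine ⟨k₀, fun k hk => ?_⟩
  rw [Real.dist_eq, sub_zero, abs_of_nonneg (hu k)]
  linarith [le_max_left (u k - ε / 2) 0, hk₀ k hk]

end Recursions

/-! ### Almost supermartingales that vanish in mean. -/

section AlmostSure

variable {Ω : Type*} {mΩ : MeasurableSpace Ω} {μ : Measure Ω}

/-- A nonnegative almost supermartingale which tends to zero in mean tends to zero almost
surely. -/
theorem ae_tendsto_zero_of_almost_supermartingale [IsProbabilityMeasure μ]
    {ℱ : Filtration ℕ mΩ} {V : ℕ → Ω → ℝ} {g : ℕ → ℝ} (hV0 : ∀ k ω, 0 ≤ V k ω)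
    (hVm : ∀ k, StronglyMeasurable[ℱ k] (V k)) (hVi : ∀ k, Integrable (V k) μ)
    (hg : ∀ k, 0 ≤ g k) (hgs : Summable g)
    (hstep : ∀ k (s : Set Ω), MeasurableSet[ℱ k] s →
      ∫ ω in s, V (k + 1) ω ∂μ ≤ ∫ ω in s, V k ω ∂μ + g k * ∫ ω in s, (1 + V k ω) ∂μ)
    (hlim : Tendsto (fun k => ∫ ω, V k ω ∂μ) atTop (𝓝 0)) :
    ∀ᵐ ω ∂μ, Tendsto (fun k => V k ω) atTop (𝓝 0) := by
  -- The perturbation is proportional to `1 + V`, so the mean of `1 + V` over a past event grows by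
  -- at most the factor `1 + g k`. Dividing by the convergent product `P` therefore turns `1 + V`
  -- into a true supermartingale.
  set P : ℕ → ℝ := fun k => ∏ j ∈ Finset.range k, (1 + g j) with hP
  have hPpos : ∀ k, 0 < P k := fun k => Finset.prod_pos fun i _ => by linarith [hg i]
  have hPmono : Monotone P := monotone_nat_of_le_succ fun k => by
    simp only [hP, Finset.prod_range_succ]
    exact le_mul_of_one_le_right (hPpos k).le (by linarith [hg k])
  obtain ⟨Pl, hPl⟩ : ∃ l, Tendsto P atTop (𝓝 l) := by
    refine ⟨_, tendsto_atTop_ciSup hPmono ⟨Real.exp (∑' k, g k), ?_⟩⟩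
    rintro _ ⟨k, rfl⟩
    calc P k ≤ ∏ j ∈ Finset.range k, Real.exp (g j) :=
          Finset.prod_le_prod (fun i _ => by linarith [hg i])
            fun i _ => by linarith [Real.add_one_le_exp (g i)]
      _ = Real.exp (∑ j ∈ Finset.range k, g j) := (Real.exp_sum _ _).symm
      _ ≤ _ := Real.exp_le_exp.2 (hgs.sum_le_tsum _ fun i _ => hg i)
  set W : ℕ → Ω → ℝ := fun k ω => (P k)⁻¹ * (1 + V k ω) with hW
  have hW0 : ∀ k ω, 0 ≤ W k ω := fun k ω =>
    mul_nonneg (inv_nonneg.2 (hPpos k).le) (by linarith [hV0 k ω])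
  have hVi' : ∀ k, Integrable (fun ω => 1 + V k ω) μ := fun k => (integrable_const 1).add (hVi k)
  have hWi : ∀ k, Integrable (W k) μ := fun k => (hVi' k).const_mul _
  have hsup : Supermartingale W ℱ μ := by
    refine supermartingale_of_setIntegral_succ_le (fun k => ?_) hWi fun k s hs => ?_
    · exact (stronglyMeasurable_const.add (hVm k)).const_mul _
    · have h := hstep k s hs
      simp only [hW]
      rw [integral_const_mul, integral_const_mul]
      have h2 : ∫ ω in s, (1 + V (k + 1) ω) ∂μ ≤ (1 + g k) * ∫ ω in s, (1 + V k ω) ∂μ := by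
        have e1 : ∀ j, ∫ ω in s, (1 + V j ω) ∂μ = ∫ ω in s, (1 : ℝ) ∂μ + ∫ ω in s, V j ω ∂μ :=
          fun j => integral_add (integrable_const 1).integrableOn (hVi j).integrableOn
        rw [add_mul, one_mul, e1 (k + 1)]
        nth_rewrite 1 [e1 k]
        linarith
      have hPs : P (k + 1) = P k * (1 + g k) := by simp only [hP, Finset.prod_range_succ]
      have hg1 : 0 < 1 + g k := by linarith [hg k]
      calc (P (k + 1))⁻¹ * ∫ ω in s, (1 + V (k + 1) ω) ∂μ
          ≤ (P (k + 1))⁻¹ * ((1 + g k) * ∫ ω in s, (1 + V k ω) ∂μ) :=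
            mul_le_mul_of_nonneg_left h2 (inv_nonneg.2 (hPpos _).le)
        _ = _ := by rw [hPs]; field_simp
  have hbd : ∀ k, eLpNorm (fun ω => (-W k) ω) 1 μ ≤ (Real.toNNReal (∫ ω, W 0 ω ∂μ) : NNReal) := by
    intro k
    have h1 : ∫ ω, W k ω ∂μ ≤ ∫ ω, W 0 ω ∂μ := by
      simpa using hsup.setIntegral_le (Nat.zero_le k) MeasurableSet.univ
    rw [eLpNorm_one_eq_lintegral_enorm]
    calc ∫⁻ ω, ‖(-W k) ω‖ₑ ∂μ = ∫⁻ ω, ENNReal.ofReal (W k ω) ∂μ := by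
          refine lintegral_congr fun ω => ?_
          rw [Pi.neg_apply, enorm_neg, Real.enorm_of_nonneg (hW0 k ω)]
      _ = ENNReal.ofReal (∫ ω, W k ω ∂μ) :=
          (ofReal_integral_eq_lintegral_ofReal (hWi k) (Eventually.of_forall (hW0 k))).symm
      _ ≤ ENNReal.ofReal (∫ ω, W 0 ω ∂μ) := ENNReal.ofReal_le_ofReal h1
  have hconv := hsup.neg.exists_ae_tendsto_of_bdd hbd
  -- Martingale convergence gives an almost sure limit but not its value. Convergence in mean gives
  -- a subsequence tending to zero almost surely, and this fixes the value.
  have hmeas : TendstoInMeasure μ V atTop (fun _ => (0 : ℝ)) := by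
    refine tendstoInMeasure_of_tendsto_eLpNorm one_ne_zero
      (fun k => (hVi k).aestronglyMeasurable) aestronglyMeasurable_const ?_
    have h1 : ∀ k, eLpNorm (V k - fun _ => (0 : ℝ)) 1 μ = ENNReal.ofReal (∫ ω, V k ω ∂μ) := by
      intro k
      rw [eLpNorm_one_eq_lintegral_enorm,
        ofReal_integral_eq_lintegral_ofReal (hVi k) (Eventually.of_forall (hV0 k))]
      refine lintegral_congr fun ω => ?_
      rw [Pi.sub_apply, sub_zero, Real.enorm_of_nonneg (hV0 k ω)]
    simp_rw [h1]
    simpa using ENNReal.tendsto_ofReal hlim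
  obtain ⟨ns, hns, hsub⟩ := hmeas.exists_seq_tendsto_ae
  filter_upwards [hconv, hsub] with ω ⟨c, hc⟩ hω
  have h1 : Tendsto (fun k => V k ω) atTop (𝓝 (Pl * -c - 1)) := by
    have h2 := (hPl.mul hc.neg).sub_const 1
    refine h2.congr fun k => ?_
    simp only [hW, Pi.neg_apply, neg_neg]
    have := (hPpos k).ne'
    field_simp
    ring
  rwa [tendsto_nhds_unique (h1.comp hns.tendsto_atTop) hω] at h1

end AlmostSure

end DecReg

namespace DecReg

/-! ### Positive definiteness of the stationary drift. -/

section Dissipation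

variable {N n : ℕ}

/-- For a balanced digraph the quadratic form of the Laplacian is the weighted sum of the squared
edge differences. -/
theorem IsBalanced.sum_inner_sub {E : Type*} [NormedAddCommGroup E] [InnerProductSpace ℝ E]
    {W : Matrix (Fin N) (Fin N) ℝ} (hW : IsBalanced W) (d : Fin N → E) :
    ∑ i, ∑ j, W i j * inner ℝ (d i) (d i - d j) = (∑ i, ∑ j, W i j * ‖d i - d j‖ ^ 2) / 2 := by
  -- Balance enters here: after exchanging the sums, the out-degree of each node is replaced by its
  -- in-degree.
  have h1 : ∑ i, ∑ j, W i j * ‖d j‖ ^ 2 = ∑ i, ∑ j, W i j * ‖d i‖ ^ 2 := by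
    rw [Finset.sum_comm]
    refine Finset.sum_congr rfl fun i _ => ?_
    rw [← Finset.sum_mul, ← Finset.sum_mul]
    exact congrArg (· * ‖d i‖ ^ 2) (hW i).symm
  have h2 : ∑ i, ∑ j, W i j * ‖d i - d j‖ ^ 2
      = ∑ i, ∑ j, 2 * (W i j * inner ℝ (d i) (d i - d j))
        + (∑ i, ∑ j, W i j * ‖d j‖ ^ 2 - ∑ i, ∑ j, W i j * ‖d i‖ ^ 2) := by
    simp only [← Finset.sum_sub_distrib, ← Finset.sum_add_distrib]
    refine Finset.sum_congr rfl fun i _ => Finset.sum_congr rfl fun j _ => ?_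
    rw [norm_sub_sq_real, inner_sub_right, real_inner_self_eq_norm_sq]
    ring
  rw [h2, h1, sub_self, add_zero]
  simp only [← Finset.mul_sum]
  ring

theorem IsBalanced.sum_inner_sub_nonneg {E : Type*} [NormedAddCommGroup E]
    [InnerProductSpace ℝ E] {W : Matrix (Fin N) (Fin N) ℝ} (hW : IsBalanced W)
    (h0 : ∀ i j, 0 ≤ W i j) (d : Fin N → E) :
    0 ≤ ∑ i, ∑ j, W i j * inner ℝ (d i) (d i - d j) := by
  rw [hW.sum_inner_sub]
  exact div_nonneg (Finset.sum_nonneg fun i _ => Finset.sum_nonneg fun j _ =>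
    mul_nonneg (h0 i j) (sq_nonneg _)) zero_le_two

/-- If the Laplacian form of a balanced digraph with a spanning tree vanishes, all nodes agree. -/
theorem HasSpanningTree.eq_of_sum_inner_eq_zero {E : Type*} [NormedAddCommGroup E]
    [InnerProductSpace ℝ E] {W : Matrix (Fin N) (Fin N) ℝ} (hT : HasSpanningTree W)
    (hW : IsBalanced W) (h0 : ∀ i j, 0 ≤ W i j) {d : Fin N → E}
    (hd : ∑ i, ∑ j, W i j * inner ℝ (d i) (d i - d j) = 0) : ∃ x, ∀ i, d i = x := by
  obtain ⟨r, parent, hpar, hroot⟩ := hT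
  have hnn : ∀ i j, 0 ≤ W i j * ‖d i - d j‖ ^ 2 := fun i j => mul_nonneg (h0 i j) (sq_nonneg _)
  rw [hW.sum_inner_sub, div_eq_zero_iff, or_iff_left two_ne_zero,
    Finset.sum_eq_zero_iff_of_nonneg fun i _ => Finset.sum_nonneg fun j _ => hnn i j] at hd
  have hedge : ∀ i j, W i j ≠ 0 → d i = d j := by
    intro i j hij
    have h := (Finset.sum_eq_zero_iff_of_nonneg fun j _ => hnn i j).1 (hd i (Finset.mem_univ _)) j
      (Finset.mem_univ _)
    simpa [hij, sub_eq_zero] using h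
  have hp : ∀ i, i ≠ r → d i = d (parent i) := fun i hi => by
    have h := hpar i hi
    simp only [neighbors, Finset.mem_filter, Finset.mem_univ, true_and] at h
    exact hedge i _ h
  -- Edges with nonzero weight join equal values, so the value at the root travels down the tree;
  -- the induction is on the number of parent steps to the root.
  have hiter : ∀ t i, parent^[t] i = r → d i = d r := by
    intro t
    induction t with
    | zero => intro i hi; rw [← hi]; rfl
    | succ t ih =>
      intro i hi
      by_cases hir : i = r
      · rw [hir]
      · rw [hp i hir]
        exact ih _ (by rwa [Function.iterate_succ_apply] at hi)
  exact ⟨d r, fun i => let ⟨t, ht⟩ := hroot i; hiter t i ht⟩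

/-- Quadratic forms are written entrywise because the averaging over the chain is done one matrix
entry at a time. -/
theorem quadForm_eq_dotProduct (B : Matrix (Fin n) (Fin n) ℝ) (x : Fin n → ℝ) :
    ∑ a, ∑ b, B a b * (x a * x b) = x ⬝ᵥ B.mulVec x := by
  simp only [dotProduct, Matrix.mulVec, Finset.mul_sum]
  exact Finset.sum_congr rfl fun a _ => Finset.sum_congr rfl fun b _ => by ring

theorem posDef_of_lambdaMin_pos {B : Matrix (Fin n) (Fin n) ℝ} (hB : B.IsHermitian)
    (h : 0 < lambdaMin B) : B.PosDef := by
  rw [hB.posDef_iff_eigenvalues_pos]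
  intro i
  -- Finiteness makes the spectrum bounded below, which is what allows the infimum in `lambdaMin` to
  -- be compared with each eigenvalue.
  have hfin : (spectrum ℝ B).Finite := Matrix.finite_real_spectrum
  exact h.trans_le (csInf_le hfin.bddBelow (hB.eigenvalues_mem_spectrum_real i))

/-- Joint observability and connectivity make the stationary drift uniformly dissipative. -/
theorem exists_dissipation {W : Matrix (Fin N) (Fin N) ℝ} (h0 : ∀ i j, 0 ≤ W i j)
    (hW : IsBalanced W) (hT : HasSpanningTree W) {G : Fin N → Matrix (Fin n) (Fin n) ℝ}
    (hherm : ∀ i, (G i).IsHermitian)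
    (hG : ∀ i (x : Fin n → ℝ), 0 ≤ ∑ a, ∑ b, G i a b * (x a * x b))
    (hobs : 0 < lambdaMin (∑ i, G i)) :
    ∃ θ > 0, ∀ d : Fin N → EuclideanSpace ℝ (Fin n), θ * ∑ i, ‖d i‖ ^ 2 ≤
      ∑ i, ∑ a, ∑ b, G i a b * (d i a * d i b)
        + ∑ i, ∑ j, W i j * inner ℝ (d i) (d i - d j) := by
  set F : (Fin N → EuclideanSpace ℝ (Fin n)) → ℝ := fun d =>
    ∑ i, ∑ a, ∑ b, G i a b * (d i a * d i b)
        + ∑ i, ∑ j, W i j * inner ℝ (d i) (d i - d j) with hF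
  have hcont : Continuous F := by fun_prop
  have hA : ∀ d : Fin N → EuclideanSpace ℝ (Fin n),
      0 ≤ ∑ i, ∑ a, ∑ b, G i a b * (d i a * d i b) :=
    fun d => Finset.sum_nonneg fun i _ => hG i _
  -- Both parts of `F` are nonnegative, so if `F` vanishes both do. The Laplacian part then forces a
  -- common value `x`, and the remaining part is the quadratic form of the summed Gram matrices at
  -- `x`.
  have hpos : ∀ d, d ≠ 0 → 0 < F d := by
    intro d hd
    have hB := hW.sum_inner_sub_nonneg h0 d
    refine lt_of_le_of_ne (add_nonneg (hA d) hB) fun hzero => hd ?_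
    obtain ⟨x, hx⟩ := hT.eq_of_sum_inner_eq_zero hW h0 (d := d) (by
      have := hA d; simp only [hF] at hzero; linarith)
    have hA0 : ∑ i, ∑ a, ∑ b, G i a b * (d i a * d i b) = 0 := by
      have := hA d; simp only [hF] at hzero; linarith
    have hsum : ∑ a, ∑ b, (∑ i, G i) a b * (x a * x b) = 0 := by
      rw [← hA0, Finset.sum_comm]
      simp_rw [hx, Matrix.sum_apply, Finset.sum_mul]
      rw [Finset.sum_comm]
      rw [Finset.sum_comm (s := (Finset.univ : Finset (Fin N)))]
      exact Finset.sum_congr rfl fun a _ => Finset.sum_comm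
    have hPD := posDef_of_lambdaMin_pos
      (isSelfAdjoint_sum _ fun i _ => hherm i : IsSelfAdjoint (∑ i, G i)) hobs
    have hx0 : x = 0 := by
      by_contra hne
      have hne' : x.ofLp ≠ 0 := fun h => hne (by ext a; exact congrFun h a)
      have := hPD.dotProduct_mulVec_pos hne'
      rw [star_trivial, ← quadForm_eq_dotProduct, hsum] at this
      exact lt_irrefl _ this
    funext i
    rw [hx i, hx0]; rfl
  have hhom : ∀ (r : ℝ) d, F (r • d) = r ^ 2 * F d := by
    intro r d
    simp only [hF, mul_add, Finset.mul_sum, Pi.smul_apply, PiLp.smul_apply, smul_eq_mul,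
      ← smul_sub, inner_smul_left, inner_smul_right, RCLike.conj_to_real]
    congr 1
    · exact Finset.sum_congr rfl fun i _ => Finset.sum_congr rfl fun a _ =>
        Finset.sum_congr rfl fun b _ => by ring
    · exact Finset.sum_congr rfl fun i _ => Finset.sum_congr rfl fun a _ => by ring
  -- The product carries the sup norm, which costs a factor `N`; `N + 1` keeps the later denominator
  -- positive when there are no nodes.
  have hle : ∀ d : Fin N → EuclideanSpace ℝ (Fin n), ∑ i, ‖d i‖ ^ 2 ≤ (N + 1) * ‖d‖ ^ 2 := by
    intro d
    calc ∑ i, ‖d i‖ ^ 2 ≤ ∑ _i : Fin N, ‖d‖ ^ 2 := Finset.sum_le_sum fun i _ =>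
          pow_le_pow_left₀ (norm_nonneg _) (norm_le_pi_norm d i) 2
      _ = N * ‖d‖ ^ 2 := by simp
      _ ≤ _ := by nlinarith [sq_nonneg ‖d‖]
  obtain ⟨c, hc, hcF⟩ : ∃ c > 0, ∀ d, c * ‖d‖ ^ 2 ≤ F d := by
    -- By homogeneity the constant is the minimum of `F` on the compact unit sphere. The sphere is
    -- empty exactly when the space is trivial.
    rcases (Metric.sphere (0 : Fin N → EuclideanSpace ℝ (Fin n)) 1).eq_empty_or_nonempty with
      he | hne
    · refine ⟨1, one_pos, fun d => ?_⟩
      have hd : d = 0 := by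
        by_contra hd
        have : (‖d‖⁻¹ • d) ∈ Metric.sphere (0 : Fin N → EuclideanSpace ℝ (Fin n)) 1 := by
          rw [mem_sphere_zero_iff_norm, norm_smul, norm_inv, norm_norm,
            inv_mul_cancel₀ (norm_ne_zero_iff.2 hd)]
        rw [he] at this
        exact this
      subst hd
      simp [hF]
    · obtain ⟨e, he, hmin⟩ := (isCompact_sphere _ _).exists_isMinOn hne hcont.continuousOn
      refine ⟨F e, hpos e fun h => by simp [h] at he, fun d => ?_⟩
      rcases eq_or_ne d 0 with rfl | hd
      · simp [hF]
      · have hd' : ‖d‖ ≠ 0 := norm_ne_zero_iff.2 hd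
        have hm : (‖d‖⁻¹ • d) ∈ Metric.sphere (0 : Fin N → EuclideanSpace ℝ (Fin n)) 1 := by
          rw [mem_sphere_zero_iff_norm, norm_smul, norm_inv, norm_norm, inv_mul_cancel₀ hd']
        have h := hmin hm
        simp only [Set.mem_ofPred_eq] at h
        rw [hhom, inv_pow, ← div_eq_inv_mul, le_div_iff₀ (by positivity)] at h
        exact h
  refine ⟨c / (N + 1), by positivity, fun d => ?_⟩
  refine le_trans ?_ (hcF d)
  rw [div_mul_eq_mul_div, div_le_iff₀ (by positivity)]
  have := mul_le_mul_of_nonneg_left (hle d) hc.le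
  linarith

end Dissipation

end DecReg

namespace DecReg

/-! ### Step probabilities of the chain. -/

section StepProbabilities

variable {ι : Type*} {p : ι → ι → ℝ}

theorem stepProb_nonneg (hp : IsTransition p) (t : ℕ) (l l' : ι) : 0 ≤ stepProb p t l l' := by
  induction t generalizing l with
  | zero => simp only [stepProb]; split_ifs <;> simp
  | succ t ih => exact tsum_nonneg fun j => mul_nonneg (hp.1 l j) (ih j)

theorem tsum_ofReal_transition (hp : IsTransition p) (l : ι) :
    ∑' j, ENNReal.ofReal (p l j) = 1 := by
  rw [← ENNReal.ofReal_tsum_of_nonneg (hp.1 l) (hp.2 l).summable, (hp.2 l).tsum_eq,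
    ENNReal.ofReal_one]

/-- Proved together by induction: the real series defining the next step is known to be summable
only once the current probabilities are at most one. Passing to extended nonnegative reals makes the
exchange of sums free. -/
theorem stepProb_le_one_and_tsum (hp : IsTransition p) (t : ℕ) :
    (∀ l l', stepProb p t l l' ≤ 1) ∧ (∀ l, ∑' l', ENNReal.ofReal (stepProb p t l l') = 1) ∧
      ∀ l l', ENNReal.ofReal (stepProb p (t + 1) l l') =
        ∑' j, ENNReal.ofReal (p l j) * ENNReal.ofReal (stepProb p t j l') := by
  have hsucc : ∀ t, (∀ l l', stepProb p t l l' ≤ 1) →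
      ∀ l l', ENNReal.ofReal (stepProb p (t + 1) l l') =
        ∑' j, ENNReal.ofReal (p l j) * ENNReal.ofReal (stepProb p t j l') := by
    intro t h l l'
    have hs : Summable fun j => p l j * stepProb p t j l' :=
      (hp.2 l).summable.of_nonneg_of_le
        (fun j => mul_nonneg (hp.1 l j) (stepProb_nonneg hp t j l'))
        fun j => mul_le_of_le_one_right (hp.1 l j) (h j l')
    simp only [stepProb]
    rw [ENNReal.ofReal_tsum_of_nonneg
      (fun j => mul_nonneg (hp.1 l j) (stepProb_nonneg hp t j l')) hs]
    exact tsum_congr fun j => ENNReal.ofReal_mul (hp.1 l j)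
  induction t with
  | zero =>
    have h1 : ∀ l l', stepProb p 0 l l' ≤ 1 := by
      intro l l'; simp only [stepProb]; split_ifs <;> simp
    refine ⟨h1, fun l => ?_, hsucc 0 h1⟩
    rw [tsum_eq_single l fun l' h => by simp [stepProb, h.symm]]
    simp [stepProb]
  | succ t ih =>
    obtain ⟨-, h2, h3⟩ := ih
    have hsum : ∀ l, ∑' l', ENNReal.ofReal (stepProb p (t + 1) l l') = 1 := by
      intro l
      simp_rw [h3]
      rw [ENNReal.tsum_comm]
      simp_rw [ENNReal.tsum_mul_left, h2, mul_one]
      exact tsum_ofReal_transition hp l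
    have hle : ∀ l l', stepProb p (t + 1) l l' ≤ 1 := fun l l' => by
      rw [← ENNReal.ofReal_le_one, ← hsum l]
      exact ENNReal.le_tsum l'
    exact ⟨hle, hsum, hsucc _ hle⟩

theorem summable_stepProb (hp : IsTransition p) (t : ℕ) (l : ι) :
    Summable fun l' => stepProb p t l l' := by
  have h := (stepProb_le_one_and_tsum hp t).2.1 l
  have h2 := ENNReal.summable_toReal (h.trans_ne ENNReal.one_ne_top)
  simpa only [ENNReal.toReal_ofReal (stepProb_nonneg hp t l _)] using h2

theorem summable_mul_of_bounded {w f : ι → ℝ} (hw : ∀ l, 0 ≤ w l) (hws : Summable w) {K : ℝ}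
    (hK : ∀ l, |f l| ≤ K) : Summable fun l => w l * f l := by
  refine Summable.of_norm_bounded (hws.mul_right K) fun l => ?_
  rw [Real.norm_eq_abs, abs_mul, abs_of_nonneg (hw l)]
  exact mul_le_mul_of_nonneg_left (hK l) (hw l)

/-- Duality between ℓ¹ and ℓ∞: a total variation bound controls the averages of a bounded function.
-/
theorem abs_tsum_stepProb_sub_le (hp : IsTransition p) {π : ι → ℝ} (hπ : IsStationary p π)
    {φ : ι → ℝ} {K ε : ℝ} (hK : ∀ l, |φ l| ≤ K) {h : ℕ} {l : ι}
    (hε : ∑' l', |stepProb p h l l' - π l'| ≤ ε) :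
    |∑' l', stepProb p h l l' * φ l' - ∑' l', π l' * φ l'| ≤ K * ε := by
  have hK0 : 0 ≤ K := (abs_nonneg _).trans (hK l)
  have hs := summable_stepProb hp h l
  have hs1 := summable_mul_of_bounded (stepProb_nonneg hp h l) hs hK
  have hs2 := summable_mul_of_bounded hπ.nonneg hπ.hasSum_one.summable hK
  have habs := (hs.sub hπ.hasSum_one.summable).abs
  rw [← hs1.tsum_sub hs2]
  calc |∑' l', (stepProb p h l l' * φ l' - π l' * φ l')|
      ≤ ∑' l', |stepProb p h l l' * φ l' - π l' * φ l'| := by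
        have := norm_tsum_le_tsum_norm (hs1.sub hs2).norm
        simpa only [Real.norm_eq_abs] using this
    _ ≤ ∑' l', K * |stepProb p h l l' - π l'| := by
        refine Summable.tsum_le_tsum (fun l' => ?_) (hs1.sub hs2).abs (habs.mul_left K)
        rw [← sub_mul, abs_mul, mul_comm]
        exact mul_le_mul_of_nonneg_right (hK l') (abs_nonneg _)
    _ = K * ∑' l', |stepProb p h l l' - π l'| := tsum_mul_left
    _ ≤ K * ε := mul_le_mul_of_nonneg_left hε hK0

end StepProbabilities

/-! ### The Markov property with independent side information, and mixing. -/

section MarkovProperty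

/-- The field `markov` speaks only of full trajectories. A prescribed path either ends in `l`, and
extends by `l'` to such a trajectory, or is incompatible with being in `l` at time `k`, because the
states are distinct. -/
theorem measure_path_inter {Ω X ι : Type*} {mΩ : MeasurableSpace Ω} {μ : Measure Ω} {Z : ℕ → Ω → X}
    {S : ι → X} {p : ι → ι → ℝ} [IsProbabilityMeasure μ]
    (hc : IsHomogeneousMarkovChain μ Z S p)
    (k : ℕ) (t : Fin (k + 1) → ι) (l l' : ι) :
    μ ({ω | ∀ j : Fin (k + 1), Z j ω = S (t j)} ∩ ({ω | Z k ω = S l} ∩ {ω | Z (k + 1) ω = S l'}))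
      = ENNReal.ofReal (p l l') *
        μ ({ω | ∀ j : Fin (k + 1), Z j ω = S (t j)} ∩ {ω | Z k ω = S l}) := by
  by_cases htl : t (Fin.last k) = l
  · set s : ℕ → ι := fun j => if h : j < k + 1 then t ⟨j, h⟩ else l' with hs
    have hsk : s k = l := by simp only [hs, Nat.lt_succ_self, dite_true]; exact htl
    have hsk1 : s (k + 1) = l' := by simp [hs]
    have h1 : {ω | ∀ j : Fin (k + 1), Z j ω = S (t j)} ∩ {ω | Z k ω = S l}
        = {ω | ∀ j ≤ k, Z j ω = S (s j)} := by
      ext ω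
      simp only [Set.mem_inter_iff, Set.mem_ofPred_eq]
      constructor
      · rintro ⟨h, -⟩ j hj
        simpa [hs, hj, Nat.lt_succ_of_le hj] using h ⟨j, Nat.lt_succ_of_le hj⟩
      · intro h
        refine ⟨fun j => ?_, by rw [← hsk]; exact h k le_rfl⟩
        simpa [hs, j.2, Nat.lt_succ_iff.1 j.2] using h j (Nat.lt_succ_iff.1 j.2)
    have h2 : {ω | ∀ j : Fin (k + 1), Z j ω = S (t j)} ∩
        ({ω | Z k ω = S l} ∩ {ω | Z (k + 1) ω = S l'})
        = {ω | ∀ j ≤ k + 1, Z j ω = S (s j)} := by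
      rw [← Set.inter_assoc, h1]
      ext ω
      simp only [Set.mem_inter_iff, Set.mem_ofPred_eq]
      constructor
      · rintro ⟨h, h'⟩ j hj
        rcases Nat.le_succ_iff.1 hj with hj | rfl
        · exact h j hj
        · rw [hsk1]; exact h'
      · intro h
        exact ⟨fun j hj => h j (hj.trans (Nat.le_succ k)), by rw [← hsk1]; exact h _ le_rfl⟩
    have h := hc.markov k s
    rw [hsk, hsk1] at h
    rw [h2, h1, ← ofReal_measureReal (μ := μ), h, mul_comm,
      ENNReal.ofReal_mul (hc.transition.1 l l'), ofReal_measureReal]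
  · have : {ω | ∀ j : Fin (k + 1), Z j ω = S (t j)} ∩ {ω | Z k ω = S l} = ∅ := by
      refine Set.eq_empty_of_forall_notMem fun ω hω => htl ?_
      have h1 := hω.1 (Fin.last k)
      have h2 : Z k ω = S l := hω.2
      exact hc.distinct (h1.symm.trans h2)
    rw [← Set.inter_assoc, this]
    simp

variable {Ω X ι : Type*} {mΩ : MeasurableSpace Ω} {μ : Measure Ω} [MeasurableSpace X]

/-- The sigma-algebra generated by the process `Z` strictly before the instant `k`. -/
@[reducible] def processBefore (Z : ℕ → Ω → X) (k : ℕ) : MeasurableSpace Ω :=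
  ⨆ (s : ℕ) (_ : s < k), MeasurableSpace.comap (Z s) inferInstance

theorem processBefore_le_comap (Z : ℕ → Ω → X) (k : ℕ) :
    processBefore Z k ≤ MeasurableSpace.comap (fun ω j => Z j ω) inferInstance := by
  refine iSup₂_le fun s _ => ?_
  rw [← measurable_iff_comap_le]
  exact (measurable_pi_apply s).comp (comap_measurable fun ω j => Z j ω)

theorem processBefore_mono (Z : ℕ → Ω → X) : Monotone (processBefore Z) := fun _ _ h =>
  iSup₂_le fun s hs => le_iSup₂_of_le s (hs.trans_le h) le_rfl

theorem measurable_processBefore (Z : ℕ → Ω → X) {s k : ℕ} (h : s < k) :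
    Measurable[processBefore Z k] (Z s) := by
  rw [measurable_iff_comap_le]
  exact le_iSup₂_of_le s h le_rfl

theorem comap_process_le {Z : ℕ → Ω → X} (hZ : ∀ k, Measurable (Z k)) :
    MeasurableSpace.comap (fun ω j => Z j ω) inferInstance ≤ mΩ := by
  rw [← measurable_iff_comap_le]
  exact measurable_pi_lambda _ hZ

theorem IsHomogeneousMarkovChain.integrable_comp {Z : ℕ → Ω → X}
    {S : ι → X} {p : ι → ι → ℝ} [IsProbabilityMeasure μ]
    (hZ : ∀ k, Measurable (Z k))
    (hc : IsHomogeneousMarkovChain μ Z S p) {φ : X → ℝ} (hφ : Measurable φ) {K : ℝ}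
    (hK : ∀ l, |φ (S l)| ≤ K) (k : ℕ) : Integrable (fun ω => φ (Z k ω)) μ := by
  refine Integrable.of_bound (hφ.comp (hZ k)).aestronglyMeasurable K
    (Eventually.of_forall fun ω => ?_)
  obtain ⟨l, hl⟩ := hc.mem_states k ω
  rw [hl]
  exact hK l

variable [MeasurableSingletonClass X] [Countable ι] {Z : ℕ → Ω → X} {S : ι → X}
  {p : ι → ι → ℝ}

/-- An event determined by the chain up to time `k` is a disjoint union of path events. -/
theorem measure_inter_eq_tsum_paths (hZ : ∀ k, Measurable (Z k))
    (hc : IsHomogeneousMarkovChain μ Z S p) (k : ℕ) {b : Set Ω}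
    (hb : MeasurableSet[processBefore Z (k + 1)] b) :
    ∃ T : Set (Fin (k + 1) → ι), ∀ E : Set Ω, MeasurableSet E →
      μ (b ∩ E) = ∑' t : T, μ ({ω | ∀ j : Fin (k + 1), Z j ω = S (t.1 j)} ∩ E) := by
  choose L hL using hc.mem_states
  set Φ : Ω → (Fin (k + 1) → ι) := fun ω j => L j ω with hΦ
  have hle : processBefore Z (k + 1) ≤ MeasurableSpace.comap Φ ⊤ := by
    refine iSup₂_le fun s hs => ?_
    rintro _ ⟨B, -, rfl⟩
    refine ⟨{t | S (t ⟨s, hs⟩) ∈ B}, trivial, ?_⟩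
    ext ω
    simp [hΦ, ← hL s ω]
  obtain ⟨T, -, rfl⟩ := hle b hb
  refine ⟨T, fun E hE => ?_⟩
  -- `Φ` comes from a choice of state labels and is not known to be measurable. Its fibres are
  -- nevertheless events, since injectivity of `S` identifies them with path events.
  have hatom : ∀ t : Fin (k + 1) → ι, {ω | ∀ j : Fin (k + 1), Z j ω = S (t j)} = Φ ⁻¹' {t} := by
    intro t
    ext ω
    simp only [Set.mem_ofPred_eq, Set.mem_preimage, Set.mem_singleton_iff, hΦ, funext_iff]
    exact forall_congr' fun j => by rw [hL j ω]; exact hc.distinct.eq_iff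
  have hmeas : ∀ t : Fin (k + 1) → ι,
      MeasurableSet {ω | ∀ j : Fin (k + 1), Z j ω = S (t j)} := by
    intro t
    rw [Set.ofPred_forall]
    exact MeasurableSet.iInter fun j => hZ j (measurableSet_singleton _)
  have hU : Φ ⁻¹' T ∩ E
      = ⋃ t : T, ({ω | ∀ j : Fin (k + 1), Z j ω = S (t.1 j)} ∩ E) := by
    simp_rw [hatom]
    ext ω
    simp
  rw [hU, measure_iUnion _ fun t => (hmeas _).inter hE]
  intro t t' htt'
  refine Set.disjoint_left.2 fun ω h h' => htt' (Subtype.ext ?_)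
  have h1 := h.1
  have h2 := h'.1
  rw [hatom] at h1 h2
  exact h1.symm.trans h2

variable {A : ℕ → MeasurableSpace Ω}

/-- The one-step Markov property relative to the chain enlarged by independent information. -/
theorem measure_inter_markov [IsProbabilityMeasure μ] (hZ : ∀ k, Measurable (Z k))
    (hc : IsHomogeneousMarkovChain μ Z S p) (hA : ∀ k, A k ≤ mΩ)
    (hind : ∀ k, Indep (A k) (MeasurableSpace.comap (fun ω j => Z j ω) inferInstance) μ)
    (k : ℕ) {F : Set Ω} (hF : MeasurableSet[A (k + 1) ⊔ processBefore Z (k + 1)] F) (l l' : ι) :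
    μ (F ∩ ({ω | Z k ω = S l} ∩ {ω | Z (k + 1) ω = S l'}))
      = ENNReal.ofReal (p l l') * μ (F ∩ {ω | Z k ω = S l}) := by
  have hB : processBefore Z (k + 1) ≤ mΩ := (processBefore_le_comap Z _).trans (comap_process_le hZ)
  have hm : A (k + 1) ⊔ processBefore Z (k + 1) ≤ mΩ := sup_le (hA _) hB
  have hE : ∀ j l, MeasurableSet[MeasurableSpace.comap (fun ω j => Z j ω) inferInstance]
      {ω | Z j ω = S l} := fun j l =>
    ((measurable_pi_apply j).comp (comap_measurable fun ω j => Z j ω))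
      (measurableSet_singleton (S l))
  have hE' : ∀ j l, MeasurableSet {ω | Z j ω = S l} := fun j l => comap_process_le hZ _ (hE j l)
  -- The claim is an equality of two finite measures on the enlarged sigma-algebra, so intersections
  -- `a ∩ b` suffice. Independence splits off `a`, and `b` decomposes into paths, where the one-step
  -- rule is known.
  set ν₁ := μ.restrict ({ω | Z k ω = S l} ∩ {ω | Z (k + 1) ω = S l'}) with hν₁
  set ν₂ := ENNReal.ofReal (p l l') • μ.restrict {ω | Z k ω = S l} with hν₂
  have hgen : ∀ a b, MeasurableSet[A (k + 1)] a → MeasurableSet[processBefore Z (k + 1)] b →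
      ν₁ (a ∩ b) = ν₂ (a ∩ b) := by
    intro a b ha hb
    have hab : MeasurableSet (a ∩ b) := (hA _ a ha).inter (hB b hb)
    have hbc := processBefore_le_comap Z _ b hb
    rw [hν₁, hν₂, Measure.restrict_apply hab, Measure.smul_apply, Measure.restrict_apply hab,
      Set.inter_assoc, Set.inter_assoc,
      Indep_iff _ _ μ |>.1 (hind (k + 1)) _ _ ha
        (MeasurableSet.inter hbc (MeasurableSet.inter (hE _ _) (hE _ _))),
      Indep_iff _ _ μ |>.1 (hind (k + 1)) _ _ ha (MeasurableSet.inter hbc (hE _ _)), smul_eq_mul]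
    obtain ⟨T, hT⟩ := measure_inter_eq_tsum_paths hZ hc k hb
    rw [hT _ ((hE' _ _).inter (hE' _ _)), hT _ (hE' _ _)]
    simp_rw [measure_path_inter hc, ENNReal.tsum_mul_left]
    ring
  have : IsFiniteMeasure ν₂ := by rw [hν₂]; exact Measure.smul_finite _ ENNReal.ofReal_ne_top
  have htrim : ν₁.trim hm = ν₂.trim hm := by
    refine @ext_of_generate_finite _ (A (k + 1) ⊔ processBefore Z (k + 1)) _ _ _
      (sup_eq_generateFrom_inter (A (k + 1)) (processBefore Z (k + 1)))
      (isPiSystem_inter _ _) _ ?_ ?_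
    · rintro _ ⟨a, b, ha, hb, rfl⟩
      have hab : MeasurableSet[A (k + 1) ⊔ processBefore Z (k + 1)] (a ∩ b) := by
        rw [sup_eq_generateFrom_inter]
        exact MeasurableSpace.measurableSet_generateFrom ⟨a, b, ha, hb, rfl⟩
      rw [trim_measurableSet_eq hm hab, trim_measurableSet_eq hm hab, hgen a b ha hb]
    · rw [trim_measurableSet_eq hm MeasurableSet.univ, trim_measurableSet_eq hm MeasurableSet.univ]
      simpa using hgen Set.univ Set.univ MeasurableSet.univ MeasurableSet.univ
  have h1 : ν₁ F = ν₂ F := by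
    rw [← trim_measurableSet_eq hm hF, ← trim_measurableSet_eq hm hF, htrim]
  rwa [hν₁, hν₂, Measure.restrict_apply (hm F hF), Measure.smul_apply,
    Measure.restrict_apply (hm F hF), smul_eq_mul] at h1

theorem measure_eq_tsum_states (hZ : ∀ k, Measurable (Z k))
    (hc : IsHomogeneousMarkovChain μ Z S p) (k : ℕ) {F : Set Ω} (hF : MeasurableSet F) :
    μ F = ∑' l, μ (F ∩ {ω | Z k ω = S l}) := by
  have hU : F = ⋃ l, F ∩ {ω | Z k ω = S l} := by
    ext ω
    obtain ⟨l, hl⟩ := hc.mem_states k ω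
    simp only [Set.mem_iUnion, Set.mem_inter_iff, Set.mem_ofPred_eq]
    exact ⟨fun h => ⟨l, h, hl⟩, fun ⟨_, h, _⟩ => h⟩
  conv_lhs => rw [hU]
  refine measure_iUnion (fun l l' hll' => ?_) fun l => hF.inter (hZ k (measurableSet_singleton _))
  refine Set.disjoint_left.2 fun ω h h' => hll' (hc.distinct ?_)
  exact h.2.symm.trans h'.2

/-- The multi-step Markov property relative to the chain enlarged by independent information. -/
theorem measure_inter_markov_steps [IsProbabilityMeasure μ] (hZ : ∀ k, Measurable (Z k))
    (hc : IsHomogeneousMarkovChain μ Z S p) (hA : ∀ k, A k ≤ mΩ) (hAmono : Monotone A)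
    (hind : ∀ k, Indep (A k) (MeasurableSpace.comap (fun ω j => Z j ω) inferInstance) μ)
    (h k : ℕ) {F : Set Ω} (hF : MeasurableSet[A (k + 1) ⊔ processBefore Z (k + 1)] F) (l l' : ι) :
    μ (F ∩ ({ω | Z k ω = S l} ∩ {ω | Z (k + h) ω = S l'}))
      = ENNReal.ofReal (stepProb p h l l') * μ (F ∩ {ω | Z k ω = S l}) := by
  have hm : ∀ k, A k ⊔ processBefore Z k ≤ mΩ := fun k =>
    sup_le (hA _) ((processBefore_le_comap Z _).trans (comap_process_le hZ))
  have hE' : ∀ j l, MeasurableSet {ω | Z j ω = S l} := fun j l =>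
    hZ j (measurableSet_singleton _)
  induction h generalizing k F l with
  | zero =>
    by_cases hl : l = l'
    · subst hl
      simp [stepProb]
    · have : {ω | Z k ω = S l} ∩ {ω | Z (k + 0) ω = S l'} = ∅ := by
        refine Set.eq_empty_of_forall_notMem fun ω hω => hl (hc.distinct ?_)
        exact (hω.1 : Z k ω = S l).symm.trans hω.2
      rw [this]
      simp [stepProb, hl]
  | succ h ih =>
    have hle : A (k + 1) ⊔ processBefore Z (k + 1) ≤ A (k + 2) ⊔ processBefore Z (k + 2) :=
      sup_le_sup (hAmono (Nat.le_succ _)) (processBefore_mono Z (Nat.le_succ _))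
    -- The position at time `k` becomes part of the past at time `k + 1`. The induction hypothesis
    -- thus applies to this smaller event, and summing over the state at time `k + 1` gives the
    -- Chapman–Kolmogorov recursion.
    have hG : MeasurableSet[A (k + 1 + 1) ⊔ processBefore Z (k + 1 + 1)]
        (F ∩ {ω | Z k ω = S l}) := by
      refine MeasurableSet.inter (hle F hF) ?_
      have h2 : processBefore Z (k + 2) ≤ A (k + 2) ⊔ processBefore Z (k + 2) := le_sup_right
      exact h2 _ (measurable_processBefore Z (by omega : k < k + 2) (measurableSet_singleton _))
    rw [measure_eq_tsum_states hZ hc (k + 1) ((hm _ F hF).inter ((hE' _ _).inter (hE' _ _)))]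
    have h1 : ∀ j, μ (F ∩ ({ω | Z k ω = S l} ∩ {ω | Z (k + (h + 1)) ω = S l'}) ∩
        {ω | Z (k + 1) ω = S j})
        = ENNReal.ofReal (stepProb p h j l') *
          (ENNReal.ofReal (p l j) * μ (F ∩ {ω | Z k ω = S l})) := by
      intro j
      have := ih (k + 1) hG j
      rw [Set.inter_assoc F _ {ω | Z (k + 1) ω = S j}, measure_inter_markov hZ hc hA hind k hF]
        at this
      rw [← this]
      congr 1
      have e : k + (h + 1) = k + 1 + h := by ring
      rw [e]
      ext ω
      simp only [Set.mem_inter_iff]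
      tauto
    simp_rw [h1]
    rw [(stepProb_le_one_and_tsum hc.transition h).2.2, ← ENNReal.tsum_mul_right]
    exact tsum_congr fun j => by ring

theorem hasSum_setIntegral_states (hZ : ∀ k, Measurable (Z k))
    (hc : IsHomogeneousMarkovChain μ Z S p) (k : ℕ) {F : Set Ω} (hF : MeasurableSet F)
    {f : Ω → ℝ} (hf : IntegrableOn f F μ) :
    HasSum (fun l => ∫ ω in F ∩ {ω | Z k ω = S l}, f ω ∂μ) (∫ ω in F, f ω ∂μ) := by
  have hU : F = ⋃ l, F ∩ {ω | Z k ω = S l} := by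
    ext ω
    obtain ⟨l, hl⟩ := hc.mem_states k ω
    simp only [Set.mem_iUnion, Set.mem_inter_iff, Set.mem_ofPred_eq]
    exact ⟨fun h => ⟨l, h, hl⟩, fun ⟨_, h, _⟩ => h⟩
  have := hasSum_integral_iUnion (μ := μ) (f := f) (s := fun l => F ∩ {ω | Z k ω = S l})
    (fun l => hF.inter (hZ k (measurableSet_singleton _))) (fun l l' hll' =>
      Set.disjoint_left.2 fun ω h h' => hll' (hc.distinct (h.2.symm.trans h'.2)))
    (by rwa [← hU])
  rwa [← hU] at this

theorem abs_setIntegral_sub_stationary_le [IsProbabilityMeasure μ] (hZ : ∀ k, Measurable (Z k))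
    (hc : IsHomogeneousMarkovChain μ Z S p) (hA : ∀ k, A k ≤ mΩ) (hAmono : Monotone A)
    (hind : ∀ k, Indep (A k) (MeasurableSpace.comap (fun ω j => Z j ω) inferInstance) μ)
    {π : ι → ℝ} (hπ : IsStationary p π) {φ : X → ℝ} (hφ : Measurable φ) {K ε : ℝ}
    (hK : ∀ l, |φ (S l)| ≤ K) {h : ℕ} (hε : ∀ l, ∑' l', |stepProb p h l l' - π l'| ≤ ε)
    (k : ℕ) {F : Set Ω} (hF : MeasurableSet[A (k + 1) ⊔ processBefore Z (k + 1)] F) :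
    |∫ ω in F, (φ (Z (k + h) ω) - ∑' l, π l * φ (S l)) ∂μ| ≤ K * ε * μ.real F := by
  set c := ∑' l, π l * φ (S l) with hcdef
  have hFm : MeasurableSet F :=
    sup_le (hA _) ((processBefore_le_comap Z _).trans (comap_process_le hZ)) F hF
  have hE' : ∀ j l, MeasurableSet {ω | Z j ω = S l} := fun j l =>
    hZ j (measurableSet_singleton _)
  have hint := hc.integrable_comp hZ hφ hK (k + h)
  -- On the event of being in state `l` at time `k`, the past in `F` no longer matters, and the mean
  -- of `φ` after `h` steps is its average under `stepProb p h l`.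
  have hatom : ∀ l, ∫ ω in F ∩ {ω | Z k ω = S l}, (φ (Z (k + h) ω) - c) ∂μ
      = μ.real (F ∩ {ω | Z k ω = S l}) * (∑' l', stepProb p h l l' * φ (S l') - c) := by
    intro l
    have h1 := hasSum_setIntegral_states hZ hc (k + h) (hFm.inter (hE' k l)) hint.integrableOn
    have h2 : ∀ l', ∫ ω in F ∩ {ω | Z k ω = S l} ∩ {ω | Z (k + h) ω = S l'}, φ (Z (k + h) ω) ∂μ
        = μ.real (F ∩ {ω | Z k ω = S l}) * (stepProb p h l l' * φ (S l')) := by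
      intro l'
      rw [setIntegral_congr_fun (g := fun _ => φ (S l')) ((hFm.inter (hE' k l)).inter (hE' _ l'))
        (fun ω hω => congrArg φ hω.2), setIntegral_const, smul_eq_mul, Set.inter_assoc,
        measureReal_def, measure_inter_markov_steps hZ hc hA hAmono hind h k hF, ENNReal.toReal_mul,
        ENNReal.toReal_ofReal (stepProb_nonneg hc.transition h l l'), ← measureReal_def]
      ring
    simp_rw [h2] at h1
    rw [integral_sub hint.integrableOn (integrable_const c).integrableOn, ← h1.tsum_eq,
      tsum_mul_left, setIntegral_const, smul_eq_mul]
    ring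
  have hsum := hasSum_setIntegral_states hZ hc k hFm
    (f := fun ω => φ (Z (k + h) ω) - c) (hint.sub (integrable_const c)).integrableOn
  simp_rw [hatom] at hsum
  have hsum1 := hasSum_setIntegral_states hZ hc k hFm (f := fun _ => (1 : ℝ))
    (integrable_const 1).integrableOn
  simp only [setIntegral_const, smul_eq_mul, mul_one] at hsum1
  rw [← hsum.tsum_eq, mul_comm (K * ε), ← hsum1.tsum_eq, ← tsum_mul_right]
  have hb : ∀ l, |μ.real (F ∩ {ω | Z k ω = S l}) * (∑' l', stepProb p h l l' * φ (S l') - c)|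
      ≤ μ.real (F ∩ {ω | Z k ω = S l}) * (K * ε) := by
    intro l
    rw [abs_mul, abs_of_nonneg measureReal_nonneg]
    exact mul_le_mul_of_nonneg_left
      (abs_tsum_stepProb_sub_le hc.transition hπ hK (hε l)) measureReal_nonneg
  rw [← Real.norm_eq_abs]
  exact tsum_of_norm_bounded (hsum1.summable.mul_right (K * ε)).hasSum
    fun l => (Real.norm_eq_abs _).trans_le (hb l)

/-- Averages of a bounded function of a uniformly ergodic chain against past-measurable weights
are close to its stationary average. -/
theorem abs_integral_mul_sub_stationary_le [IsProbabilityMeasure μ] (hZ : ∀ k, Measurable (Z k))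
    (hc : IsHomogeneousMarkovChain μ Z S p) (hA : ∀ k, A k ≤ mΩ) (hAmono : Monotone A)
    (hind : ∀ k, Indep (A k) (MeasurableSpace.comap (fun ω j => Z j ω) inferInstance) μ)
    {π : ι → ℝ} (hπ : IsStationary p π) {φ : X → ℝ} (hφ : Measurable φ) {K ε : ℝ}
    (hK : ∀ l, |φ (S l)| ≤ K) {h : ℕ} (hε : ∀ l, ∑' l', |stepProb p h l l' - π l'| ≤ ε)
    (k : ℕ) {g : Ω → ℝ} (hgm : Measurable[A (k + 1) ⊔ processBefore Z (k + 1)] g)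
    (hg : Integrable g μ) :
    |∫ ω, g ω * φ (Z (k + h) ω) ∂μ - (∑' l, π l * φ (S l)) * ∫ ω, g ω ∂μ|
      ≤ K * ε * ∫ ω, |g ω| ∂μ := by
  have hst := hc.mem_states
  set c := ∑' l, π l * φ (S l) with hcdef
  set m := A (k + 1) ⊔ processBefore Z (k + 1) with hmdef
  have hm : m ≤ mΩ := sup_le (hA _) ((processBefore_le_comap Z _).trans (comap_process_le hZ))
  have hint := hc.integrable_comp hZ hφ hK (k + h)
  set Y : Ω → ℝ := fun ω => φ (Z (k + h) ω) - c with hY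
  have hYi : Integrable Y μ := hint.sub (integrable_const c)
  -- Bounds proportional to the measure of every event of `m` become an almost sure bound on the
  -- `m`-measurable conditional expectation. The weight `g` is then pulled out.
  have hbound : ∀ᵐ ω ∂μ, |(μ[Y | m]) ω| ≤ K * ε := by
    have hset : ∀ s, MeasurableSet[m] s → |∫ ω in s, (μ[Y | m]) ω ∂μ| ≤ K * ε * μ.real s := by
      intro s hs
      rw [setIntegral_condExp hm hYi hs]
      exact abs_setIntegral_sub_stationary_le hZ hc hA hAmono hind hπ hφ hK hε k hs
    have hsm : StronglyMeasurable[m] (μ[Y | m]) := stronglyMeasurable_condExp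
    have hti : Integrable (μ[Y | m]) (μ.trim hm) := integrable_condExp.trim hm hsm
    have hconst : ∀ s, MeasurableSet[m] s →
        ∀ r : ℝ, ∫ _ in s, r ∂(μ.trim hm) = r * μ.real s := by
      intro s hs r
      rw [← setIntegral_trim hm stronglyMeasurable_const hs, setIntegral_const, smul_eq_mul,
        mul_comm]
    refine ae_of_ae_trim hm ?_
    have h1 : μ[Y | m] ≤ᵐ[μ.trim hm] fun _ => K * ε := by
      refine ae_le_of_forall_setIntegral_le hti (integrable_const _) fun s hs _ => ?_
      rw [← setIntegral_trim hm hsm hs, hconst s hs]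
      exact (le_abs_self _).trans (hset s hs)
    have h2 : (fun _ => -(K * ε)) ≤ᵐ[μ.trim hm] μ[Y | m] := by
      refine ae_le_of_forall_setIntegral_le (integrable_const _) hti fun s hs _ => ?_
      rw [← setIntegral_trim hm hsm hs, hconst s hs, neg_mul]
      exact (abs_le.1 (hset s hs)).1
    filter_upwards [h1, h2] with ω h1 h2
    exact abs_le.2 ⟨h2, h1⟩
  have hgY : Integrable (fun ω => g ω * Y ω) μ := by
    refine hg.mul_bdd (c := K + |c|) hYi.aestronglyMeasurable (Eventually.of_forall fun ω => ?_)
    obtain ⟨l, hl⟩ := hst (k + h) ω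
    simp only [hY, hl, Real.norm_eq_abs]
    exact (abs_sub _ _).trans (add_le_add (hK l) le_rfl)
  have hpull : μ[fun ω => g ω * Y ω | m] =ᵐ[μ] fun ω => g ω * (μ[Y | m]) ω :=
    condExp_mul_of_stronglyMeasurable_left (f := g) (g := Y) hgm.stronglyMeasurable hgY hYi
  have heq : ∫ ω, g ω * φ (Z (k + h) ω) ∂μ - c * ∫ ω, g ω ∂μ = ∫ ω, g ω * (μ[Y | m]) ω ∂μ := by
    rw [← integral_congr_ae hpull, integral_condExp hm, ← integral_const_mul, ← integral_sub]
    · exact integral_congr_ae (Eventually.of_forall fun ω => by simp only [hY]; ring)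
    · refine (hgY.add (hg.const_mul c)).congr (Eventually.of_forall fun ω => ?_)
      simp only [hY, Pi.add_apply]; ring
    · exact hg.const_mul c
  rw [heq, ← integral_const_mul]
  refine (abs_integral_le_integral_abs).trans (integral_mono_ae ?_ (hg.abs.const_mul _) ?_)
  · exact (integrable_condExp.congr hpull).abs
  · filter_upwards [hbound] with ω hω
    rw [abs_mul, mul_comm]
    exact mul_le_mul_of_nonneg_right hω (abs_nonneg _)

end MarkovProperty

end DecReg

noncomputable section

namespace DecReg

/-! ### Matrices acting on Euclidean spaces: entries, norms, measurability. -/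

section Matrices

variable {p q : ℕ}

theorem toEuclideanLin_apply_apply (A : Matrix (Fin p) (Fin q) ℝ) (x : EuclideanSpace ℝ (Fin q))
    (r : Fin p) : Matrix.toEuclideanLin A x r = ∑ c, A r c * x c := rfl

theorem inner_toEuclideanLin_transpose (A : Matrix (Fin p) (Fin q) ℝ)
    (x : EuclideanSpace ℝ (Fin q)) (y : EuclideanSpace ℝ (Fin p)) :
    inner ℝ x (Matrix.toEuclideanLin A.transpose y) = inner ℝ (Matrix.toEuclideanLin A x) y := by
  simp only [PiLp.inner_apply, toEuclideanLin_apply_apply, RCLike.inner_apply,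
    RCLike.conj_to_real, Matrix.transpose_apply, Finset.mul_sum, Finset.sum_mul]
  rw [Finset.sum_comm]
  exact Finset.sum_congr rfl fun a _ => Finset.sum_congr rfl fun b _ => by ring

/-- Separates the entries of the Gram matrix, which depend on the chain, from the coordinate
products, which depend on the error; mixing applies to each such product. -/
theorem norm_sq_toEuclideanLin (A : Matrix (Fin p) (Fin q) ℝ) (x : EuclideanSpace ℝ (Fin q)) :
    ‖Matrix.toEuclideanLin A x‖ ^ 2
      = ∑ a, ∑ b, (A.transpose * A) a b * (x a * x b) := by
  rw [EuclideanSpace.real_norm_sq_eq]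
  simp_rw [toEuclideanLin_apply_apply, sq, Finset.sum_mul_sum, Matrix.mul_apply,
    Matrix.transpose_apply, Finset.sum_mul]
  rw [Finset.sum_comm]
  refine Finset.sum_congr rfl fun a _ => ?_
  rw [Finset.sum_comm]
  exact Finset.sum_congr rfl fun b _ => Finset.sum_congr rfl fun r _ => by ring

theorem norm_le_sum_abs (x : EuclideanSpace ℝ (Fin p)) : ‖x‖ ≤ ∑ r, |x r| := by
  have h : x = ∑ r, EuclideanSpace.single r (x r) := by
    ext s
    simp [Finset.sum_apply, Pi.single_apply]
  conv_lhs => rw [h]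
  refine (norm_sum_le _ _).trans (Finset.sum_le_sum fun r _ => ?_)
  simp

theorem abs_apply_le_norm (x : EuclideanSpace ℝ (Fin p)) (r : Fin p) : |x r| ≤ ‖x‖ := by
  simpa using PiLp.norm_apply_le x r

theorem norm_toEuclideanLin_le {A : Matrix (Fin p) (Fin q) ℝ} {K : ℝ} (hK : ∀ r c, |A r c| ≤ K)
    (x : EuclideanSpace ℝ (Fin q)) : ‖Matrix.toEuclideanLin A x‖ ≤ p * q * K * ‖x‖ := by
  refine (norm_le_sum_abs _).trans ?_
  calc ∑ r, |Matrix.toEuclideanLin A x r| ≤ ∑ _r : Fin p, ∑ _c : Fin q, K * ‖x‖ := by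
        refine Finset.sum_le_sum fun r _ => ?_
        rw [toEuclideanLin_apply_apply]
        refine (Finset.abs_sum_le_sum_abs _ _).trans (Finset.sum_le_sum fun c _ => ?_)
        rw [abs_mul]
        exact mul_le_mul (hK r c) (abs_apply_le_norm x c) (abs_nonneg _)
          ((abs_nonneg _).trans (hK r c))
    _ = _ := by simp; ring

open scoped Matrix.Norms.L2Operator in
-- An entry is a coordinate of the image of a unit basis vector. This converts the assumed 2-norm
-- bounds into bounds on entries.
theorem abs_entry_le_l2_opNorm {α β : Type*} [Fintype α] [Fintype β] [DecidableEq β]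
    (A : Matrix α β ℝ) (r : α) (c : β) : |A r c| ≤ ‖A‖ := by
  have h := Matrix.l2_opNorm_mulVec A (EuclideanSpace.single c (1 : ℝ))
  have h2 := PiLp.norm_apply_le
    ((EuclideanSpace.equiv α ℝ).symm (A.mulVec (EuclideanSpace.single c (1 : ℝ)).ofLp)) r
  have h3 : ((EuclideanSpace.equiv α ℝ).symm (A.mulVec (EuclideanSpace.single c (1 : ℝ)).ofLp)) r
      = A r c := by simp
  rw [h3, Real.norm_eq_abs] at h2
  refine h2.trans (h.trans ?_)
  simp

theorem measurable_matrix_entry {α β : Type*} (r : α) (c : β) :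
    Measurable fun A : Matrix α β ℝ => A r c :=
  (measurable_pi_apply c).comp (measurable_pi_apply (X := fun _ : α => β → ℝ) r)

theorem measurable_matrix_of {α β Ω : Type*} [MeasurableSpace Ω] {A : Ω → Matrix α β ℝ}
    (h : ∀ r c, Measurable fun ω => A ω r c) : Measurable A :=
  measurable_pi_lambda (X := fun _ : α => β → ℝ) A fun r => measurable_pi_lambda _ fun c => h r c

theorem measurable_toEuclideanLin {Ω : Type*} [MeasurableSpace Ω]
    {A : Ω → Matrix (Fin p) (Fin q) ℝ} {x : Ω → EuclideanSpace ℝ (Fin q)} (hA : Measurable A)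
    (hx : Measurable x) : Measurable fun ω => Matrix.toEuclideanLin (A ω) (x ω) := by
  have hentry : ∀ r c, Measurable fun ω => A ω r c := fun r c =>
    (measurable_matrix_entry r c).comp hA
  have hcoord : ∀ c, Measurable fun ω => x ω c := fun c =>
    (measurable_pi_apply c).comp ((WithLp.measurable_ofLp 2 (Fin q → ℝ)).comp hx)
  have h : Measurable fun ω r => ∑ c, A ω r c * x ω c := by fun_prop
  exact (WithLp.measurable_toLp 2 (Fin p → ℝ)).comp h

/-- Makes the visits of the chain to individual states into events. -/
instance matrixMeasurableSingletonClass {α β : Type*} [Countable α] [Countable β] :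
    MeasurableSingletonClass (Matrix α β ℝ) :=
  inferInstanceAs (MeasurableSingletonClass (α → β → ℝ))

end Matrices

/-! ### Error dynamics and the information available at each instant. -/

namespace Model

variable {Ω : Type*} [MeasurableSpace Ω] {N n : ℕ} {m : Fin N → ℕ} (M : Model Ω N n m)

/-- The regression matrices and the adjacency matrix at the instant `k`. -/
def state (k : ℕ) (ω : Ω) : State N n m := (M.reg k ω, M.adj k ω)

/-- All noises at the instant `k`. -/
def noises (k : ℕ) (ω : Ω) :
    ((i : Fin N) → EuclideanSpace ℝ (Fin (m i))) × (Fin N → Fin N → EuclideanSpace ℝ (Fin n)) :=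
  (M.noise k ω, M.comm k ω)

/-- The estimation errors of all nodes. -/
def err (k : ℕ) (ω : Ω) (i : Fin N) : EuclideanSpace ℝ (Fin n) := M.estimate k ω i - M.x0

/-- The total squared estimation error. -/
def sqErr (k : ℕ) (ω : Ω) : ℝ := ∑ i, ‖M.err k ω i‖ ^ 2

/-- The noise-free decrement of the error of node `i`. -/
def driftAt (k : ℕ) (z : State N n m) (d : Fin N → EuclideanSpace ℝ (Fin n)) (i : Fin N) :
    EuclideanSpace ℝ (Fin n) :=
  M.lam k • d i + M.lam k • M.x0
    + M.a k • Matrix.toEuclideanLin (z.1 i).transpose (Matrix.toEuclideanLin (z.1 i) (d i))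
    + M.b k • ∑ j, z.2 i j • (d i - d j)

/-- The noise term in the error of node `i`. -/
def diffusionAt (k : ℕ) (z : State N n m) (d : Fin N → EuclideanSpace ℝ (Fin n))
    (v : ((i : Fin N) → EuclideanSpace ℝ (Fin (m i))) ×
      (Fin N → Fin N → EuclideanSpace ℝ (Fin n))) (i : Fin N) : EuclideanSpace ℝ (Fin n) :=
  M.a k • Matrix.toEuclideanLin (z.1 i).transpose (v.1 i)
    + M.b k • ∑ j, (z.2 i j * M.intensity j i (d j - d i)) • v.2 j i

def drift (k : ℕ) (ω : Ω) (i : Fin N) : EuclideanSpace ℝ (Fin n) :=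
  M.driftAt k (M.state k ω) (M.err k ω) i

def diffusion (k : ℕ) (ω : Ω) (i : Fin N) : EuclideanSpace ℝ (Fin n) :=
  M.diffusionAt k (M.state k ω) (M.err k ω) (M.noises k ω) i

/-- The sum over neighbours extends to all nodes because the remaining weights are zero. The
parameter cancels in the innovation and in the differences of estimates, and survives only as the
bias `lam k • x0` of the regularization. -/
theorem err_succ (k : ℕ) (ω : Ω) (i : Fin N) :
    M.err (k + 1) ω i = M.err k ω i - M.drift k ω i + M.diffusion k ω i := by
  have hsum : ∑ j ∈ neighbors (M.adj k ω) i,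
      M.adj k ω i j • (M.received k ω (M.estimate k ω) j i - M.estimate k ω i)
      = ∑ j, M.adj k ω i j • (M.received k ω (M.estimate k ω) j i - M.estimate k ω i) := by
    refine Finset.sum_subset (Finset.subset_univ _) fun j _ hj => ?_
    have : M.adj k ω i j = 0 := by simpa [neighbors] using hj
    rw [this, zero_smul]
  have hterm : ∀ j, M.adj k ω i j • (M.received k ω (M.estimate k ω) j i - M.estimate k ω i)
      = (M.adj k ω i j * M.intensity j i (M.err k ω j - M.err k ω i)) • M.comm k ω j i
        - M.adj k ω i j • (M.err k ω i - M.err k ω j) := by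
    intro j
    simp only [received, err, sub_sub_sub_cancel_right, mul_smul]
    rw [← smul_sub]
    congr 1
    abel
  have hobs : M.obs k ω i - Matrix.toEuclideanLin (M.reg k ω i) (M.estimate k ω i)
      = M.noise k ω i - Matrix.toEuclideanLin (M.reg k ω i) (M.err k ω i) := by
    simp only [obs, err, map_sub]
    abel
  have hest : M.estimate k ω i = M.err k ω i + M.x0 := by simp [err]
  have h0 : M.err (k + 1) ω i = M.estimate (k + 1) ω i - M.x0 := rfl
  have h1 : M.estimate (k + 1) ω i = M.estimate k ω i
      + M.a k • Matrix.toEuclideanLin (M.reg k ω i).transpose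
          (M.obs k ω i - Matrix.toEuclideanLin (M.reg k ω i) (M.estimate k ω i))
      + M.b k • ∑ j ∈ neighbors (M.adj k ω) i,
          M.adj k ω i j • (M.received k ω (M.estimate k ω) j i - M.estimate k ω i)
      - M.lam k • M.estimate k ω i := rfl
  rw [h0, h1, hsum, hobs]
  simp_rw [hterm]
  rw [Finset.sum_sub_distrib, hest, map_sub]
  simp only [drift, diffusion, driftAt, diffusionAt, state, noises, smul_sub, smul_add]
  abel

/-! ### Measurability -/

theorem measurable_state (k : ℕ) : Measurable (M.state k) :=
  (M.measurable_reg k).prodMk (M.measurable_adj k)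

theorem measurable_noises (k : ℕ) : Measurable (M.noises k) :=
  (M.measurable_noise k).prodMk (M.measurable_comm k)

theorem measurable_driftAt (k : ℕ) (i : Fin N) :
    Measurable fun y : State N n m × (Fin N → EuclideanSpace ℝ (Fin n)) =>
      M.driftAt k y.1 y.2 i := by
  have hd : ∀ j, Measurable fun y : State N n m × (Fin N → EuclideanSpace ℝ (Fin n)) => y.2 j :=
    fun j => (measurable_pi_apply j).comp measurable_snd
  have hH : Measurable fun y : State N n m × (Fin N → EuclideanSpace ℝ (Fin n)) => y.1.1 i :=
    (measurable_pi_apply i).comp (measurable_fst.comp measurable_fst)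
  have hHt : Measurable fun y : State N n m × (Fin N → EuclideanSpace ℝ (Fin n)) =>
      (y.1.1 i).transpose :=
    measurable_matrix_of fun r c => (measurable_matrix_entry c r).comp hH
  have hw : ∀ j, Measurable fun y : State N n m × (Fin N → EuclideanSpace ℝ (Fin n)) =>
      y.1.2 i j := fun j =>
    (measurable_matrix_entry i j).comp (measurable_snd.comp measurable_fst)
  have hHH := measurable_toEuclideanLin hHt (measurable_toEuclideanLin hH (hd i))
  unfold driftAt
  fun_prop

theorem measurable_intensityAt (i j : Fin N) :
    Measurable fun d : Fin N → EuclideanSpace ℝ (Fin n) => M.intensity j i (d j - d i) :=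
  (M.measurable_intensity j i).comp ((measurable_pi_apply j).sub (measurable_pi_apply i))

theorem measurable_diffusionAt (k : ℕ) (i : Fin N) :
    Measurable fun y : (State N n m × (Fin N → EuclideanSpace ℝ (Fin n))) ×
      (((i : Fin N) → EuclideanSpace ℝ (Fin (m i))) ×
        (Fin N → Fin N → EuclideanSpace ℝ (Fin n))) => M.diffusionAt k y.1.1 y.1.2 y.2 i := by
  have hHv := measurable_toEuclideanLin
    (A := fun y : (State N n m × (Fin N → EuclideanSpace ℝ (Fin n))) ×
      (((i : Fin N) → EuclideanSpace ℝ (Fin (m i))) ×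
        (Fin N → Fin N → EuclideanSpace ℝ (Fin n))) => (y.1.1.1 i).transpose)
    (x := fun y => y.2.1 i)
    (measurable_matrix_of fun r c => (measurable_matrix_entry c r).comp
      ((measurable_pi_apply i).comp (measurable_fst.comp (measurable_fst.comp measurable_fst))))
    ((measurable_pi_apply i).comp (measurable_fst.comp measurable_snd))
  have hw : ∀ j, Measurable fun y : (State N n m × (Fin N → EuclideanSpace ℝ (Fin n))) ×
      (((i : Fin N) → EuclideanSpace ℝ (Fin (m i))) ×
        (Fin N → Fin N → EuclideanSpace ℝ (Fin n))) => y.1.1.2 i j := fun j =>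
    (measurable_matrix_entry i j).comp (measurable_snd.comp (measurable_fst.comp measurable_fst))
  have hf : ∀ j, Measurable fun y : (State N n m × (Fin N → EuclideanSpace ℝ (Fin n))) ×
      (((i : Fin N) → EuclideanSpace ℝ (Fin (m i))) ×
        (Fin N → Fin N → EuclideanSpace ℝ (Fin n))) =>
        M.intensity j i (y.1.2 j - y.1.2 i) := fun j =>
    (M.measurable_intensityAt i j).comp (measurable_snd.comp measurable_fst)
  have hξ : ∀ j, Measurable fun y : (State N n m × (Fin N → EuclideanSpace ℝ (Fin n))) ×
      (((i : Fin N) → EuclideanSpace ℝ (Fin (m i))) ×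
        (Fin N → Fin N → EuclideanSpace ℝ (Fin n))) => y.2.2 j i := fun j =>
    (measurable_pi_apply i).comp
      ((measurable_pi_apply j).comp (measurable_snd.comp measurable_snd))
  unfold diffusionAt
  fun_prop

theorem measurable_step (k : ℕ) :
    Measurable fun y : (State N n m × (Fin N → EuclideanSpace ℝ (Fin n))) ×
      (((i : Fin N) → EuclideanSpace ℝ (Fin (m i))) ×
        (Fin N → Fin N → EuclideanSpace ℝ (Fin n))) =>
      fun i => y.1.2 i - M.driftAt k y.1.1 y.1.2 i + M.diffusionAt k y.1.1 y.1.2 y.2 i := by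
  refine measurable_pi_lambda _ fun i => ?_
  have h1 : Measurable fun y : (State N n m × (Fin N → EuclideanSpace ℝ (Fin n))) ×
      (((i : Fin N) → EuclideanSpace ℝ (Fin (m i))) ×
        (Fin N → Fin N → EuclideanSpace ℝ (Fin n))) => M.driftAt k y.1.1 y.1.2 i :=
    (M.measurable_driftAt k i).comp measurable_fst
  have h2 := M.measurable_diffusionAt k i
  fun_prop

theorem past_mono : Monotone M.past := fun _ _ h =>
  iSup₂_le fun s hs => le_iSup₂_of_le s (hs.trans_le h) le_rfl

theorem measurable_past {s k : ℕ} (h : s < k) :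
    Measurable[M.past k] (M.state s) ∧ Measurable[M.past k] (M.noises s) := by
  have hle := le_iSup₂_of_le (f := fun (s : ℕ) (_ : s < k) =>
    (MeasurableSpace.comap (M.adj s) inferInstance ⊔
      MeasurableSpace.comap (M.reg s) inferInstance ⊔
      MeasurableSpace.comap (M.noise s) inferInstance ⊔
      MeasurableSpace.comap (M.comm s) inferInstance)) s h le_rfl
  rw [sup_le_iff, sup_le_iff, sup_le_iff] at hle
  obtain ⟨⟨⟨h1, h2⟩, h3⟩, h4⟩ := hle
  exact ⟨(measurable_iff_comap_le.2 h2).prodMk (measurable_iff_comap_le.2 h1),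
    (measurable_iff_comap_le.2 h3).prodMk (measurable_iff_comap_le.2 h4)⟩

theorem past_le (k : ℕ) : M.past k ≤ ‹MeasurableSpace Ω› := by
  refine iSup₂_le fun s _ => ?_
  rw [sup_le_iff, sup_le_iff, sup_le_iff]
  exact ⟨⟨⟨(M.measurable_adj s).comap_le, (M.measurable_reg s).comap_le⟩,
    (M.measurable_noise s).comap_le⟩, (M.measurable_comm s).comap_le⟩

/-- Separates the past into noise and chain, the form in which their independence can be used. -/
theorem past_le_sup (k : ℕ) :
    M.past k ≤ processBefore M.noises k ⊔ processBefore M.state k := by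
  refine iSup₂_le fun s hs => ?_
  have h1 : Measurable[processBefore M.noises k ⊔ processBefore M.state k] (M.noises s) :=
    (measurable_processBefore M.noises hs).mono le_sup_left le_rfl
  have h2 : Measurable[processBefore M.noises k ⊔ processBefore M.state k] (M.state s) :=
    (measurable_processBefore M.state hs).mono le_sup_right le_rfl
  rw [sup_le_iff, sup_le_iff, sup_le_iff]
  exact ⟨⟨⟨(measurable_snd.comp h2).comap_le, (measurable_fst.comp h2).comap_le⟩,
    (measurable_fst.comp h1).comap_le⟩, (measurable_snd.comp h1).comap_le⟩

theorem noisesBefore_le_past (k : ℕ) : processBefore M.noises k ≤ M.past k :=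
  iSup₂_le fun _ hs => (M.measurable_past hs).2.comap_le

/-- The noises before `k` together with the whole process of graphs and regression matrices. -/
@[reducible] def enlarged (k : ℕ) : MeasurableSpace Ω :=
  processBefore M.noises k ⊔ MeasurableSpace.comap (fun ω j => M.state j ω) inferInstance

theorem past_le_enlarged (k : ℕ) : M.past k ≤ M.enlarged k :=
  (M.past_le_sup k).trans (sup_le_sup_left (processBefore_le_comap M.state k) _)

theorem enlarged_le (k : ℕ) : M.enlarged k ≤ ‹MeasurableSpace Ω› :=
  sup_le ((M.noisesBefore_le_past k).trans (M.past_le k)) (comap_process_le M.measurable_state)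

theorem measurable_state_enlarged (k j : ℕ) : Measurable[M.enlarged k] (M.state j) := by
  have h : Measurable[MeasurableSpace.comap (fun ω j => M.state j ω) inferInstance] (M.state j) :=
    (measurable_pi_apply j).comp (comap_measurable fun ω j => M.state j ω)
  exact h.mono le_sup_right le_rfl

theorem measurable_err (k : ℕ) : Measurable[M.past k] (M.err k) := by
  induction k with
  | zero =>
    have h : M.err 0 = fun _ i => M.init i - M.x0 := rfl
    rw [h]
    exact measurable_const
  | succ k ih =>
    have h1 : Measurable[M.past (k + 1)] (M.err k) := ih.mono (M.past_mono k.le_succ) le_rfl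
    obtain ⟨h2, h3⟩ := M.measurable_past k.lt_succ_self
    have h4 := (M.measurable_step k).comp ((h2.prodMk h1).prodMk h3)
    have h5 : M.err (k + 1) = fun ω i => M.err k ω i - M.drift k ω i + M.diffusion k ω i :=
      funext fun ω => funext fun i => M.err_succ k ω i
    rw [h5]
    exact h4

theorem measurable_err_enlarged (k : ℕ) : Measurable[M.enlarged k] (M.err k) :=
  (M.measurable_err k).mono (M.past_le_enlarged k) le_rfl

theorem measurable_drift_enlarged (k : ℕ) (i : Fin N) :
    Measurable[M.enlarged k] fun ω => M.drift k ω i := by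
  have h := (M.measurable_driftAt k i).comp
    ((M.measurable_state_enlarged k k).prodMk (M.measurable_err_enlarged k))
  exact h

theorem measurable_err_apply (k : ℕ) (i : Fin N) : Measurable[M.past k] fun ω => M.err k ω i :=
  (measurable_pi_apply i).comp (M.measurable_err k)

theorem measurable_err' (k : ℕ) : Measurable (M.err k) :=
  (M.measurable_err k).mono (M.past_le k) le_rfl

theorem measurable_sqErr (k : ℕ) : Measurable[M.past k] (M.sqErr k) := by
  have h : Measurable fun d : Fin N → EuclideanSpace ℝ (Fin n) => ∑ i, ‖d i‖ ^ 2 := by fun_prop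
  exact h.comp (M.measurable_err k)

theorem measurable_noiseEnergy (k : ℕ) : Measurable (M.noiseEnergy k) := by
  have h : Measurable fun v : ((i : Fin N) → EuclideanSpace ℝ (Fin (m i))) ×
      (Fin N → Fin N → EuclideanSpace ℝ (Fin n)) =>
      ∑ i, ‖v.1 i‖ ^ 2 + ∑ i, ∑ j, ‖v.2 j i‖ ^ 2 := by fun_prop
  have h1 := h.comp (M.measurable_noises k)
  have h2 : M.noiseEnergy k = (fun v : ((i : Fin N) → EuclideanSpace ℝ (Fin (m i))) ×
      (Fin N → Fin N → EuclideanSpace ℝ (Fin n)) =>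
      ∑ i, ‖v.1 i‖ ^ 2 + ∑ i, ∑ j, ‖v.2 j i‖ ^ 2) ∘ M.noises k := by
    funext ω
    simp only [noiseEnergy, Function.comp_apply, noises]
  rw [h2]
  exact h1

/-! ### Noises given the past and the whole process of graphs and regression matrices -/

section Noise

variable {M} {μ : Measure Ω}

theorem A2.indep_comap (h : M.A2 μ) :
    Indep (MeasurableSpace.comap (fun ω k => M.noises k ω) inferInstance)
      (MeasurableSpace.comap (fun ω k => M.state k ω) inferInstance) μ := h.indep

variable [IsProbabilityMeasure μ]

/-- For functions of the noises, conditioning on the enlarged sigma-algebra amounts to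
conditioning on the past noises. -/
theorem A2.condExp_enlarged (h : M.A2 μ) {E : Type*} [NormedAddCommGroup E] [NormedSpace ℝ E]
    [CompleteSpace E] [MeasurableSpace E] [BorelSpace E] [SecondCountableTopology E] (k : ℕ)
    {f : ((i : Fin N) → EuclideanSpace ℝ (Fin (m i))) ×
      (Fin N → Fin N → EuclideanSpace ℝ (Fin n)) → E} (hf : Measurable f)
    (hint : Integrable (fun ω => f (M.noises k ω)) μ) :
    μ[fun ω => f (M.noises k ω) | M.enlarged k] =ᵐ[μ]
      μ[μ[fun ω => f (M.noises k ω) | M.past k] | processBefore M.noises k] := by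
  have hm : Measurable[MeasurableSpace.comap (fun ω k => M.noises k ω) inferInstance]
      fun ω => f (M.noises k ω) :=
    hf.comp ((measurable_pi_apply k).comp (comap_measurable fun ω k => M.noises k ω))
  refine (condExp_sup_of_indep (processBefore_le_comap M.noises k)
    (comap_process_le M.measurable_state) (comap_process_le M.measurable_noises) h.indep_comap
    hm.stronglyMeasurable hint).trans ?_
  exact (condExp_condExp_of_le (M.noisesBefore_le_past k) (M.past_le k)).symm

/-- Needed because the noise at time `k` is multiplied by the matrices of the same instant, which
the past does not determine. Given the enlarged sigma-algebra these matrices are known and the noise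
is still centred. -/
theorem A2.condExp_noise_enlarged (h : M.A2 μ) (k : ℕ) (i : Fin N) :
    μ[fun ω => M.noise k ω i | M.enlarged k] =ᵐ[μ] 0 := by
  have hf : Measurable fun v : ((i : Fin N) → EuclideanSpace ℝ (Fin (m i))) ×
      (Fin N → Fin N → EuclideanSpace ℝ (Fin n)) => v.1 i :=
    (measurable_pi_apply i).comp measurable_fst
  have h1 := h.condExp_enlarged k hf (h.integrable_noise k i)
  have h2 := condExp_congr_ae (m := processBefore M.noises k) (h.condExp_noise k i)
  rw [condExp_zero] at h2
  exact h1.trans h2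

theorem A2.condExp_comm_enlarged (h : M.A2 μ) (k : ℕ) (j i : Fin N) :
    μ[fun ω => M.comm k ω j i | M.enlarged k] =ᵐ[μ] 0 := by
  have hf : Measurable fun v : ((i : Fin N) → EuclideanSpace ℝ (Fin (m i))) ×
      (Fin N → Fin N → EuclideanSpace ℝ (Fin n)) => v.2 j i := by fun_prop
  have h1 := h.condExp_enlarged k hf (h.integrable_comm k j i)
  have h2 := condExp_congr_ae (m := processBefore M.noises k) (h.condExp_comm k j i)
  rw [condExp_zero] at h2
  exact h1.trans h2

theorem A2.condExp_energy_enlarged (h : M.A2 μ) :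
    ∃ β : ℝ, ∀ k, ∀ᵐ ω ∂μ, (μ[M.noiseEnergy k | M.enlarged k]) ω ≤ β := by
  obtain ⟨β, hβ⟩ := h.bounded_energy
  refine ⟨β, fun k => ?_⟩
  have hf : Measurable fun v : ((i : Fin N) → EuclideanSpace ℝ (Fin (m i))) ×
      (Fin N → Fin N → EuclideanSpace ℝ (Fin n)) =>
      ∑ i, ‖v.1 i‖ ^ 2 + ∑ i, ∑ j, ‖v.2 j i‖ ^ 2 := by fun_prop
  have h1 := h.condExp_enlarged k hf (h.integrable_energy k)
  have h2 : μ[μ[M.noiseEnergy k | M.past k] | processBefore M.noises k] ≤ᵐ[μ]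
      μ[fun _ => β | processBefore M.noises k] :=
    condExp_mono integrable_condExp (integrable_const β) (hβ k)
  rw [condExp_const ((M.noisesBefore_le_past k).trans (M.past_le k))] at h2
  filter_upwards [h1, h2] with ω e1 e2
  exact e1.trans_le e2

end Noise

end Model

end DecReg

end

noncomputable section

namespace DecReg

/-! ### Uniform bounds for the quadratic forms of a state. -/

section Bounds

variable {N n : ℕ} {m : Fin N → ℕ}

/-- Uniform bounds for the matrices of a state. -/
structure StateBound (κ : ℝ) (z : State N n m) : Prop where
  reg : ∀ i x, ‖Matrix.toEuclideanLin (z.1 i) x‖ ≤ κ * ‖x‖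
  reg_transpose : ∀ i y, ‖Matrix.toEuclideanLin (z.1 i).transpose y‖ ≤ κ * ‖y‖
  adj : ∀ i j, |z.2 i j| ≤ κ
  gram : ∀ i a b, |((z.1 i).transpose * z.1 i) a b| ≤ κ

theorem exists_stateBound {K₁ K₂ : ℝ} (hK₁ : 0 ≤ K₁) (hK₂ : 0 ≤ K₂) :
    ∃ κ, 0 ≤ κ ∧ ∀ z : State N n m, (∀ i r c, |z.1 i r c| ≤ K₁) → (∀ i j, |z.2 i j| ≤ K₂) →
      StateBound κ z := by
  set s : ℝ := ∑ i, (m i : ℝ) with hs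
  have hms : ∀ i, (m i : ℝ) ≤ s := fun i =>
    Finset.single_le_sum (f := fun i => (m i : ℝ)) (fun i _ => Nat.cast_nonneg _)
      (Finset.mem_univ i)
  have hs0 : 0 ≤ s := Finset.sum_nonneg fun i _ => Nat.cast_nonneg _
  -- The three summands serve the regression matrices and their transposes, the Gram matrices, and
  -- the weights; `s` replaces the varying observation dimensions by their sum.
  refine ⟨s * n * K₁ + s * K₁ ^ 2 + K₂, by positivity, fun z h1 h2 => ?_⟩
  have e1 : 0 ≤ s * n * K₁ := by positivity
  have e2 : 0 ≤ s * K₁ ^ 2 := by positivity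
  have hmn : ∀ i, (m i : ℝ) * n * K₁ ≤ s * n * K₁ := fun i => by
    have := hms i; gcongr
  refine ⟨fun i x => ?_, fun i y => ?_, fun i j => ?_, fun i a b => ?_⟩
  · refine (norm_toEuclideanLin_le (h1 i) x).trans ?_
    exact mul_le_mul_of_nonneg_right (by linarith [hmn i]) (norm_nonneg _)
  · refine (norm_toEuclideanLin_le (K := K₁) (fun r c => h1 i c r) y).trans ?_
    refine mul_le_mul_of_nonneg_right ?_ (norm_nonneg _)
    rw [mul_comm (n : ℝ)]
    linarith [hmn i]
  · linarith [h2 i j]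
  · rw [Matrix.mul_apply]
    refine (Finset.abs_sum_le_sum_abs _ _).trans ?_
    calc ∑ r, |(z.1 i).transpose a r * z.1 i r b| ≤ ∑ _r : Fin (m i), K₁ ^ 2 := by
          refine Finset.sum_le_sum fun r _ => ?_
          rw [abs_mul, sq]
          exact mul_le_mul (h1 i r a) (h1 i r b) (abs_nonneg _) hK₁
      _ = m i * K₁ ^ 2 := by simp
      _ ≤ s * K₁ ^ 2 := mul_le_mul_of_nonneg_right (hms i) (sq_nonneg _)
      _ ≤ _ := by linarith

/-- The quadratic form of the regression matrices. -/
def regAt (z : State N n m) (d : Fin N → EuclideanSpace ℝ (Fin n)) : ℝ :=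
  ∑ i, ‖Matrix.toEuclideanLin (z.1 i) (d i)‖ ^ 2

/-- The quadratic form of the Laplacian. -/
def lapAt (z : State N n m) (d : Fin N → EuclideanSpace ℝ (Fin n)) : ℝ :=
  ∑ i, ∑ j, z.2 i j * inner ℝ (d i) (d i - d j)

theorem regAt_nonneg (z : State N n m) (d : Fin N → EuclideanSpace ℝ (Fin n)) : 0 ≤ regAt z d :=
  Finset.sum_nonneg fun _ _ => sq_nonneg _

theorem norm_le_sqrt_sum_sq {ι E : Type*} [Fintype ι] [NormedAddCommGroup E] (d : ι → E) (i : ι) :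
    ‖d i‖ ≤ √(∑ j, ‖d j‖ ^ 2) :=
  Real.le_sqrt_of_sq_le
    (Finset.single_le_sum (f := fun j => ‖d j‖ ^ 2) (fun _ _ => sq_nonneg _) (Finset.mem_univ i))

theorem sum_sq_nonneg {ι E : Type*} [Fintype ι] [NormedAddCommGroup E] (d : ι → E) :
    0 ≤ ∑ j, ‖d j‖ ^ 2 := Finset.sum_nonneg fun _ _ => sq_nonneg _

variable {κ : ℝ} {z : State N n m}

theorem StateBound.regAt_le (hz : StateBound κ z) (d : Fin N → EuclideanSpace ℝ (Fin n)) :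
    regAt z d ≤ κ ^ 2 * ∑ i, ‖d i‖ ^ 2 := by
  rw [regAt, Finset.mul_sum]
  refine Finset.sum_le_sum fun i _ => ?_
  rw [← mul_pow]
  exact pow_le_pow_left₀ (norm_nonneg _) (hz.reg i _) 2

/-- Stated with two arguments because expanding the Laplacian form of a perturbed vector produces
mixed terms. -/
theorem StateBound.abs_sum_adj_inner_le (hκ : 0 ≤ κ) (hz : StateBound κ z)
    (d e : Fin N → EuclideanSpace ℝ (Fin n)) :
    |∑ i, ∑ j, z.2 i j * inner ℝ (d i) (e i - e j)|
      ≤ 2 * N ^ 2 * κ * (√(∑ i, ‖d i‖ ^ 2) * √(∑ i, ‖e i‖ ^ 2)) := by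
  set r := √(∑ i, ‖d i‖ ^ 2)
  set s := √(∑ i, ‖e i‖ ^ 2)
  have hr : ∀ i, ‖d i‖ ≤ r := norm_le_sqrt_sum_sq d
  have hs : ∀ i, ‖e i‖ ≤ s := norm_le_sqrt_sum_sq e
  have hr0 : 0 ≤ r := Real.sqrt_nonneg _
  calc |∑ i, ∑ j, z.2 i j * inner ℝ (d i) (e i - e j)|
      ≤ ∑ _i : Fin N, ∑ _j : Fin N, κ * (r * (s + s)) := by
        refine (Finset.abs_sum_le_sum_abs _ _).trans (Finset.sum_le_sum fun i _ => ?_)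
        refine (Finset.abs_sum_le_sum_abs _ _).trans (Finset.sum_le_sum fun j _ => ?_)
        rw [abs_mul]
        refine mul_le_mul (hz.adj i j) ?_ (abs_nonneg _) hκ
        refine (abs_real_inner_le_norm _ _).trans (mul_le_mul (hr i) ?_ (norm_nonneg _) hr0)
        exact (norm_sub_le _ _).trans (add_le_add (hs i) (hs j))
    _ = _ := by simp; ring

theorem StateBound.abs_lapAt_le (hκ : 0 ≤ κ) (hz : StateBound κ z)
    (d : Fin N → EuclideanSpace ℝ (Fin n)) :
    |lapAt z d| ≤ 2 * N ^ 2 * κ * ∑ i, ‖d i‖ ^ 2 := by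
  have h := hz.abs_sum_adj_inner_le hκ d d
  rwa [Real.mul_self_sqrt (sum_sq_nonneg d)] at h

theorem StateBound.abs_sum_reg_inner_le (hκ : 0 ≤ κ) (hz : StateBound κ z)
    (d e : Fin N → EuclideanSpace ℝ (Fin n)) :
    |∑ i, inner ℝ (Matrix.toEuclideanLin (z.1 i) (d i)) (Matrix.toEuclideanLin (z.1 i) (e i))|
      ≤ N * κ ^ 2 * (√(∑ i, ‖d i‖ ^ 2) * √(∑ i, ‖e i‖ ^ 2)) := by
  set r := √(∑ i, ‖d i‖ ^ 2)
  set s := √(∑ i, ‖e i‖ ^ 2)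
  have hr : ∀ i, ‖d i‖ ≤ r := norm_le_sqrt_sum_sq d
  have hs : ∀ i, ‖e i‖ ≤ s := norm_le_sqrt_sum_sq e
  have hr0 : 0 ≤ r := Real.sqrt_nonneg _
  calc |∑ i, inner ℝ (Matrix.toEuclideanLin (z.1 i) (d i)) (Matrix.toEuclideanLin (z.1 i) (e i))|
      ≤ ∑ _i : Fin N, (κ * r) * (κ * s) := by
        refine (Finset.abs_sum_le_sum_abs _ _).trans (Finset.sum_le_sum fun i _ => ?_)
        refine (abs_real_inner_le_norm _ _).trans ?_
        exact mul_le_mul ((hz.reg i _).trans (mul_le_mul_of_nonneg_left (hr i) hκ))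
          ((hz.reg i _).trans (mul_le_mul_of_nonneg_left (hs i) hκ)) (norm_nonneg _)
          (mul_nonneg hκ hr0)
    _ = _ := by simp; ring

/-- Perturbing the argument changes the drift form by a small multiple of the unperturbed energy
and a large multiple of the energy of the perturbation. -/
theorem exists_quad_perturbation (hκ : 0 ≤ κ) {ε : ℝ} (hε : 0 < ε) :
    ∃ C, 0 ≤ C ∧ ∀ z : State N n m, StateBound κ z →
      ∀ d e : Fin N → EuclideanSpace ℝ (Fin n),
        regAt z d + lapAt z d - ε * ∑ i, ‖d i‖ ^ 2 - C * ∑ i, ‖e i - d i‖ ^ 2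
          ≤ regAt z e + lapAt z e := by
  -- `K` bounds the mixed terms: the regression cross term, which occurs twice, and two Laplacian
  -- ones. Young's inequality splits `K * r * s` with weight `ε` on the unperturbed part. The extra
  -- `2 * N ^ 2 * κ` pays for the Laplacian form of the perturbation, which may be negative.
  set K : ℝ := 2 * (N * κ ^ 2) + 2 * (2 * N ^ 2 * κ) with hK
  have hK0 : 0 ≤ K := by positivity
  refine ⟨K ^ 2 / (4 * ε) + 2 * N ^ 2 * κ, by positivity, fun z hz d e => ?_⟩
  obtain ⟨g, rfl⟩ : ∃ g, e = d + g := ⟨e - d, by abel⟩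
  simp only [Pi.add_apply, add_sub_cancel_left]
  have hreg : regAt z (d + g) = regAt z d + regAt z g
      + 2 * ∑ i, inner ℝ (Matrix.toEuclideanLin (z.1 i) (d i))
          (Matrix.toEuclideanLin (z.1 i) (g i)) := by
    simp only [regAt, Pi.add_apply, map_add, Finset.mul_sum, ← Finset.sum_add_distrib]
    refine Finset.sum_congr rfl fun i _ => ?_
    rw [norm_add_sq_real]; ring
  have hlap : lapAt z (d + g) = lapAt z d + lapAt z g
      + ∑ i, ∑ j, z.2 i j * inner ℝ (d i) (g i - g j)
      + ∑ i, ∑ j, z.2 i j * inner ℝ (g i) (d i - d j) := by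
    simp only [lapAt, Pi.add_apply, ← Finset.sum_add_distrib]
    refine Finset.sum_congr rfl fun i _ => Finset.sum_congr rfl fun j _ => ?_
    simp only [inner_add_left, inner_sub_right, inner_add_right]
    ring
  have h1 := (abs_le.1 (hz.abs_sum_reg_inner_le hκ d g)).1
  have h2 := (abs_le.1 (hz.abs_sum_adj_inner_le hκ d g)).1
  have h3 := (abs_le.1 (hz.abs_sum_adj_inner_le hκ g d)).1
  have h4 := (abs_le.1 (hz.abs_lapAt_le hκ g)).1
  have h5 := regAt_nonneg z g
  rw [mul_comm √(∑ i, ‖g i‖ ^ 2)] at h3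
  rw [hreg, hlap]
  have hd := Real.sq_sqrt (sum_sq_nonneg d)
  have hg := Real.sq_sqrt (sum_sq_nonneg g)
  set r := √(∑ i, ‖d i‖ ^ 2)
  set s := √(∑ i, ‖g i‖ ^ 2)
  have hy : K * (r * s) ≤ ε * r ^ 2 + K ^ 2 / (4 * ε) * s ^ 2 := by
    have : ε * r ^ 2 + K ^ 2 / (4 * ε) * s ^ 2 - K * (r * s)
        = ε * (r - K / (2 * ε) * s) ^ 2 := by field_simp; ring
    linarith [mul_nonneg hε.le (sq_nonneg (r - K / (2 * ε) * s))]
  rw [← hd, ← hg]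
  rw [← hg] at h4
  rw [hK] at hy
  linarith

theorem measurable_regAt :
    Measurable fun y : State N n m × (Fin N → EuclideanSpace ℝ (Fin n)) => regAt y.1 y.2 := by
  have h : ∀ i, Measurable fun y : State N n m × (Fin N → EuclideanSpace ℝ (Fin n)) =>
      Matrix.toEuclideanLin (y.1.1 i) (y.2 i) := fun i => measurable_toEuclideanLin
    ((measurable_pi_apply i).comp (measurable_fst.comp measurable_fst))
    ((measurable_pi_apply i).comp measurable_snd)
  unfold regAt
  fun_prop

theorem measurable_lapAt :
    Measurable fun y : State N n m × (Fin N → EuclideanSpace ℝ (Fin n)) => lapAt y.1 y.2 := by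
  have h : ∀ i j, Measurable fun y : State N n m × (Fin N → EuclideanSpace ℝ (Fin n)) =>
      y.1.2 i j := fun i j =>
    (measurable_matrix_entry i j).comp (measurable_snd.comp measurable_fst)
  have h2 : ∀ i j, Measurable fun y : State N n m × (Fin N → EuclideanSpace ℝ (Fin n)) =>
      (inner ℝ (y.2 i) (y.2 i - y.2 j) : ℝ) := fun i j => by fun_prop
  unfold lapAt
  fun_prop

end Bounds

/-! ### Bounds on the drift and the noise term. -/

namespace Model

variable {Ω : Type*} [MeasurableSpace Ω] {N n : ℕ} {m : Fin N → ℕ} (M : Model Ω N n m)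

open scoped Matrix.Norms.L2Operator in
theorem A3.exists_stateBound {M : Model Ω N n m} {μ : Measure Ω} {ι : Type*}
    {S : ι → State N n m} {p : ι → ι → ℝ} {π : ι → ℝ} (h : M.A3 μ S p π) :
    ∃ κ, 0 ≤ κ ∧ ∀ l, StateBound κ (S l) := by
  obtain ⟨K₁, hK₁⟩ := h.bounded_reg
  obtain ⟨K₂, hK₂⟩ := h.bounded_adj
  obtain ⟨κ, hκ, hb⟩ := DecReg.exists_stateBound (N := N) (n := n) (m := m)
    (abs_nonneg K₁) (abs_nonneg K₂)
  refine ⟨κ, hκ, fun l => hb _ (fun i r c => ?_) fun i j => ?_⟩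
  · have h1 : ‖Matrix.blockDiagonal' (S l).1‖ ≤ K₁ := hK₁ ⟨l, rfl⟩
    have h2 := abs_entry_le_l2_opNorm (Matrix.blockDiagonal' (S l).1) ⟨i, r⟩ ⟨i, c⟩
    rw [Matrix.blockDiagonal'_apply_eq] at h2
    exact h2.trans (h1.trans (le_abs_self _))
  · have h1 : ‖(S l).2‖ ≤ K₂ := hK₂ ⟨l, rfl⟩
    exact (abs_entry_le_l2_opNorm _ i j).trans (h1.trans (le_abs_self _))

/-- The size of the second-order terms in one step of the algorithm. -/
def gainSq (k : ℕ) : ℝ := M.a k ^ 2 + M.b k ^ 2 + M.lam k ^ 2 + |M.lam k|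

theorem gainSq_nonneg (k : ℕ) : 0 ≤ M.gainSq k := by unfold gainSq; positivity

variable {M}

/-- The drift is linear in the gains and affine in the error; the inhomogeneous part comes from the
regularization bias. -/
theorem exists_drift_bound {κ : ℝ} (hκ : 0 ≤ κ) :
    ∃ C, 0 ≤ C ∧ ∀ k z, StateBound κ z → ∀ (d : Fin N → EuclideanSpace ℝ (Fin n)) i,
      ‖M.driftAt k z d i‖ ^ 2 ≤ C * M.gainSq k * (1 + ∑ i, ‖d i‖ ^ 2) := by
  set C : ℝ := 1 + ‖M.x0‖ + κ ^ 2 + 2 * N * κ with hC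
  have hC0 : 0 ≤ C := by positivity
  refine ⟨6 * C ^ 2, by positivity, fun k z hz d i => ?_⟩
  set r := √(∑ i, ‖d i‖ ^ 2) with hr
  have hdr : ∀ i, ‖d i‖ ≤ r := norm_le_sqrt_sum_sq d
  have hr0 : 0 ≤ r := Real.sqrt_nonneg _
  have hrsq : r ^ 2 = ∑ i, ‖d i‖ ^ 2 := Real.sq_sqrt (sum_sq_nonneg d)
  have e1 : ‖M.lam k • d i‖ ≤ |M.lam k| * r := by
    rw [norm_smul, Real.norm_eq_abs]
    exact mul_le_mul_of_nonneg_left (hdr i) (abs_nonneg _)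
  have e2 : ‖M.lam k • M.x0‖ = |M.lam k| * ‖M.x0‖ := by rw [norm_smul, Real.norm_eq_abs]
  have e3 : ‖M.a k • Matrix.toEuclideanLin (z.1 i).transpose
      (Matrix.toEuclideanLin (z.1 i) (d i))‖ ≤ |M.a k| * (κ ^ 2 * r) := by
    rw [norm_smul, Real.norm_eq_abs]
    refine mul_le_mul_of_nonneg_left ?_ (abs_nonneg _)
    rw [sq, mul_assoc]
    refine (hz.reg_transpose i _).trans (mul_le_mul_of_nonneg_left ?_ hκ)
    exact (hz.reg i _).trans (mul_le_mul_of_nonneg_left (hdr i) hκ)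
  have e4 : ‖M.b k • ∑ j, z.2 i j • (d i - d j)‖ ≤ |M.b k| * (N * (κ * (r + r))) := by
    rw [norm_smul, Real.norm_eq_abs]
    refine mul_le_mul_of_nonneg_left ?_ (abs_nonneg _)
    calc _ ≤ ∑ _j : Fin N, κ * (r + r) := by
          refine (norm_sum_le _ _).trans (Finset.sum_le_sum fun j _ => ?_)
          rw [norm_smul, Real.norm_eq_abs]
          exact mul_le_mul (hz.adj i j) ((norm_sub_le _ _).trans (add_le_add (hdr i) (hdr j)))
            (norm_nonneg _) hκ
      _ = _ := by simp
  have hnorm : ‖M.driftAt k z d i‖ ≤ (|M.lam k| + |M.a k| + |M.b k|) * (C * (1 + r)) := by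
    have h := (norm_add_le (M.lam k • d i + M.lam k • M.x0 + M.a k •
      Matrix.toEuclideanLin (z.1 i).transpose (Matrix.toEuclideanLin (z.1 i) (d i)))
      (M.b k • ∑ j, z.2 i j • (d i - d j))).trans
      (add_le_add (norm_add₃_le.trans (add_le_add (add_le_add e1 e2.le) e3)) e4)
    refine h.trans ?_
    have hxr := mul_nonneg (norm_nonneg M.x0) hr0
    have hNκ : 0 ≤ (N : ℝ) * κ := by positivity
    have hκr := mul_nonneg (sq_nonneg κ) hr0
    have hNr := mul_nonneg hNκ hr0
    have hexp : C * (1 + r) = 1 + r + ‖M.x0‖ + ‖M.x0‖ * r + κ ^ 2 + κ ^ 2 * r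
        + 2 * (N * κ) + 2 * (N * κ * r) := by rw [hC]; ring
    have f1 : r + ‖M.x0‖ ≤ C * (1 + r) := by
      rw [hexp]; linarith [sq_nonneg κ]
    have f2 : κ ^ 2 * r ≤ C * (1 + r) := by
      rw [hexp]; linarith [sq_nonneg κ, norm_nonneg M.x0]
    have f3 : N * (κ * (r + r)) ≤ C * (1 + r) := by
      rw [hexp]; linarith [sq_nonneg κ, norm_nonneg M.x0]
    have g1 := mul_le_mul_of_nonneg_left f1 (abs_nonneg (M.lam k))
    have g2 := mul_le_mul_of_nonneg_left f2 (abs_nonneg (M.a k))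
    have g3 := mul_le_mul_of_nonneg_left f3 (abs_nonneg (M.b k))
    linarith
  have hsq := pow_le_pow_left₀ (norm_nonneg _) hnorm 2
  refine hsq.trans ?_
  rw [mul_pow, mul_pow]
  have f4 : (|M.lam k| + |M.a k| + |M.b k|) ^ 2 ≤ 3 * M.gainSq k := by
    have key : ∀ x y w : ℝ, 0 ≤ x → (x + y + w) ^ 2 ≤ 3 * (y ^ 2 + w ^ 2 + x ^ 2 + x) := by
      intro x y w hx
      linarith [sq_nonneg (x - y), sq_nonneg (x - w), sq_nonneg (y - w)]
    have h := key |M.lam k| |M.a k| |M.b k| (abs_nonneg _)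
    rwa [sq_abs, sq_abs, sq_abs] at h
  have f5 : (1 + r) ^ 2 ≤ 2 * (1 + ∑ i, ‖d i‖ ^ 2) := by
    rw [← hrsq]; linarith [sq_nonneg (1 - r)]
  calc _ ≤ (3 * M.gainSq k) * (C ^ 2 * (2 * (1 + ∑ i, ‖d i‖ ^ 2))) := by
        have h0 := M.gainSq_nonneg k
        exact mul_le_mul f4 (mul_le_mul_of_nonneg_left f5 (sq_nonneg C))
          (mul_nonneg (sq_nonneg _) (sq_nonneg _)) (by positivity)
    _ = _ := by ring

theorem noise_norm_le_sqrt (k : ℕ) (ω : Ω) (i : Fin N) :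
    ‖M.noise k ω i‖ ≤ √(M.noiseEnergy k ω) := by
  refine Real.le_sqrt_of_sq_le ?_
  have h1 := Finset.single_le_sum (f := fun i => ‖M.noise k ω i‖ ^ 2) (fun _ _ => sq_nonneg _)
    (Finset.mem_univ i)
  have h2 : 0 ≤ ∑ i, ∑ j, ‖M.comm k ω j i‖ ^ 2 :=
    Finset.sum_nonneg fun _ _ => Finset.sum_nonneg fun _ _ => sq_nonneg _
  unfold noiseEnergy
  linarith

theorem comm_norm_le_sqrt (k : ℕ) (ω : Ω) (j i : Fin N) :
    ‖M.comm k ω j i‖ ≤ √(M.noiseEnergy k ω) := by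
  refine Real.le_sqrt_of_sq_le ?_
  have h1 := Finset.single_le_sum (f := fun i => ∑ j, ‖M.comm k ω j i‖ ^ 2)
    (fun _ _ => Finset.sum_nonneg fun _ _ => sq_nonneg _) (Finset.mem_univ i)
  have h2 := Finset.single_le_sum (f := fun j => ‖M.comm k ω j i‖ ^ 2)
    (fun _ _ => sq_nonneg _) (Finset.mem_univ j)
  have h3 : 0 ≤ ∑ i, ‖M.noise k ω i‖ ^ 2 := Finset.sum_nonneg fun _ _ => sq_nonneg _
  unfold noiseEnergy
  linarith

theorem noiseEnergy_nonneg (k : ℕ) (ω : Ω) : 0 ≤ M.noiseEnergy k ω :=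
  add_nonneg (Finset.sum_nonneg fun _ _ => sq_nonneg _)
    (Finset.sum_nonneg fun _ _ => Finset.sum_nonneg fun _ _ => sq_nonneg _)

theorem sqErr_nonneg (k : ℕ) (ω : Ω) : 0 ≤ M.sqErr k ω := sum_sq_nonneg _

theorem abs_intensity_le {σ c : ℝ} (hA1 : ∀ j i x, |M.intensity j i x| ≤ σ * ‖x‖ + c)
    (d : Fin N → EuclideanSpace ℝ (Fin n)) (i j : Fin N) :
    |M.intensity j i (d j - d i)| ≤ (2 * |σ| + |c|) * (1 + √(∑ i, ‖d i‖ ^ 2)) := by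
  set r := √(∑ i, ‖d i‖ ^ 2)
  have hdr : ∀ i, ‖d i‖ ≤ r := norm_le_sqrt_sum_sq d
  have hr0 : 0 ≤ r := Real.sqrt_nonneg _
  have h1 : ‖d j - d i‖ ≤ r + r := (norm_sub_le _ _).trans (add_le_add (hdr j) (hdr i))
  have h2 : σ * ‖d j - d i‖ ≤ |σ| * (r + r) :=
    mul_le_mul (le_abs_self _) h1 (norm_nonneg _) (abs_nonneg _)
  have := hA1 j i (d j - d i)
  linarith [le_abs_self c, mul_nonneg (abs_nonneg c) hr0, abs_nonneg σ]

/-- The linearly growing intensities multiply the communication noise, so the energy enters through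
the product with `1 + sqErr`. -/
theorem exists_diffusion_bound {κ : ℝ} (hκ : 0 ≤ κ) (hA1 : M.A1) :
    ∃ C, 0 ≤ C ∧ ∀ k ω, StateBound κ (M.state k ω) → ∀ i,
      ‖M.diffusion k ω i‖ ^ 2 ≤ C * M.gainSq k * ((1 + M.sqErr k ω) * M.noiseEnergy k ω) := by
  obtain ⟨σ, c, hA1⟩ := hA1
  set C : ℝ := κ + N * (κ * (2 * |σ| + |c|)) with hC
  have hC0 : 0 ≤ C := by positivity
  refine ⟨4 * C ^ 2, by positivity, fun k ω hz i => ?_⟩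
  set r := √(M.sqErr k ω) with hr
  set e := √(M.noiseEnergy k ω) with he
  have hr0 : 0 ≤ r := Real.sqrt_nonneg _
  have he0 : 0 ≤ e := Real.sqrt_nonneg _
  have hrsq : r ^ 2 = M.sqErr k ω := Real.sq_sqrt (M.sqErr_nonneg k ω)
  have hesq : e ^ 2 = M.noiseEnergy k ω := Real.sq_sqrt (M.noiseEnergy_nonneg k ω)
  have e1 : ‖M.a k • Matrix.toEuclideanLin ((M.state k ω).1 i).transpose (M.noise k ω i)‖
      ≤ |M.a k| * (κ * e) := by
    rw [norm_smul, Real.norm_eq_abs]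
    gcongr
    exact (hz.reg_transpose i _).trans
      (mul_le_mul_of_nonneg_left (M.noise_norm_le_sqrt k ω i) hκ)
  have e2 : ‖M.b k • ∑ j, ((M.state k ω).2 i j * M.intensity j i (M.err k ω j - M.err k ω i)) •
      M.comm k ω j i‖ ≤ |M.b k| * (N * (κ * ((2 * |σ| + |c|) * (1 + r)) * e)) := by
    rw [norm_smul, Real.norm_eq_abs]
    refine mul_le_mul_of_nonneg_left ?_ (abs_nonneg _)
    calc _ ≤ ∑ _j : Fin N, κ * ((2 * |σ| + |c|) * (1 + r)) * e := by
          refine (norm_sum_le _ _).trans (Finset.sum_le_sum fun j _ => ?_)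
          rw [norm_smul, Real.norm_eq_abs, abs_mul]
          have h1 := hz.adj i j
          have h2 := M.abs_intensity_le hA1 (M.err k ω) i j
          have h3 := M.comm_norm_le_sqrt k ω j i
          refine mul_le_mul (mul_le_mul h1 h2 (abs_nonneg _) hκ) h3 (norm_nonneg _) ?_
          positivity
      _ = _ := by simp
  have hnorm : ‖M.diffusion k ω i‖ ≤ (|M.a k| + |M.b k|) * (C * ((1 + r) * e)) := by
    refine (norm_add_le _ _).trans ((add_le_add e1 e2).trans ?_)
    have hre : 0 ≤ r * e := mul_nonneg hr0 he0
    have hP : 0 ≤ N * (κ * (2 * |σ| + |c|)) := by positivity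
    have hexp : C * ((1 + r) * e) = κ * e + κ * (r * e)
        + N * (κ * ((2 * |σ| + |c|) * (1 + r)) * e) := by rw [hC]; ring
    have f1 : κ * e ≤ C * ((1 + r) * e) := by
      have h2 : 0 ≤ N * (κ * ((2 * |σ| + |c|) * (1 + r)) * e) := by positivity
      linarith [mul_nonneg hκ hre]
    have f2 : N * (κ * ((2 * |σ| + |c|) * (1 + r)) * e) ≤ C * ((1 + r) * e) := by
      linarith [mul_nonneg hκ hre, mul_nonneg hκ he0]
    have g1 := mul_le_mul_of_nonneg_left f1 (abs_nonneg (M.a k))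
    have g2 := mul_le_mul_of_nonneg_left f2 (abs_nonneg (M.b k))
    linarith
  have hsq := pow_le_pow_left₀ (norm_nonneg _) hnorm 2
  refine hsq.trans ?_
  rw [mul_pow, mul_pow, mul_pow, ← hesq, ← hrsq]
  have f4 : (|M.a k| + |M.b k|) ^ 2 ≤ 2 * M.gainSq k := by
    have h : (|M.a k| + |M.b k|) ^ 2 ≤ 2 * (|M.a k| ^ 2 + |M.b k| ^ 2) := by
      linarith [sq_nonneg (|M.a k| - |M.b k|)]
    rw [sq_abs, sq_abs] at h
    rw [gainSq]
    linarith [abs_nonneg (M.lam k), sq_nonneg (M.lam k)]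
  have f5 : (1 + r) ^ 2 ≤ 2 * (1 + r ^ 2) := by linarith [sq_nonneg (1 - r)]
  calc _ ≤ (2 * M.gainSq k) * (C ^ 2 * ((2 * (1 + r ^ 2)) * e ^ 2)) := by
        have := M.gainSq_nonneg k
        gcongr
    _ = _ := by ring

/-- Moving the transpose across the inner product exposes the two quadratic forms whose positivity
drives the convergence; the regularization contributes the other two terms. -/
theorem sum_inner_drift (k : ℕ) (ω : Ω) :
    ∑ i, inner ℝ (M.err k ω i) (M.drift k ω i) = M.lam k * M.sqErr k ω
      + M.lam k * ∑ i, inner ℝ (M.err k ω i) M.x0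
      + M.a k * regAt (M.state k ω) (M.err k ω) + M.b k * lapAt (M.state k ω) (M.err k ω) := by
  simp only [sqErr, regAt, lapAt, Finset.mul_sum, ← Finset.sum_add_distrib]
  refine Finset.sum_congr rfl fun i _ => ?_
  simp only [drift, driftAt, inner_add_right, inner_smul_right, inner_sum,
    inner_toEuclideanLin_transpose, real_inner_self_eq_norm_sq, Finset.mul_sum]

end Model

end DecReg

end

/-! ### Integrability and the one-step energy inequality. -/

noncomputable section

namespace DecReg

theorem integrable_inner_of_sq {Ω E : Type*} {mΩ : MeasurableSpace Ω} {μ : Measure Ω}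
    [NormedAddCommGroup E] [InnerProductSpace ℝ E] {f g : Ω → E} (hf : AEStronglyMeasurable f μ)
    (hg : AEStronglyMeasurable g μ) (hf2 : Integrable (fun ω => ‖f ω‖ ^ 2) μ)
    (hg2 : Integrable (fun ω => ‖g ω‖ ^ 2) μ) : Integrable (fun ω => inner ℝ (f ω) (g ω)) μ := by
  refine (hf2.add hg2).mono' (hf.inner hg) (Eventually.of_forall fun ω => ?_)
  refine (norm_inner_le_norm _ _).trans ?_
  simp only [Pi.add_apply]
  nlinarith [sq_nonneg (‖f ω‖ - ‖g ω‖), sq_nonneg (‖f ω‖), sq_nonneg (‖g ω‖)]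

namespace Model

variable {Ω : Type*} [MeasurableSpace Ω] {N n : ℕ} {m : Fin N → ℕ} {M : Model Ω N n m}
  {μ : Measure Ω} [IsProbabilityMeasure μ]

theorem A2.exists_energy_bound (hA2 : M.A2 μ) :
    ∃ β, 0 ≤ β ∧ ∀ k (g : Ω → ℝ), (∀ ω, 0 ≤ g ω) → Measurable[M.enlarged k] g → Integrable g μ →
      Integrable (fun ω => g ω * M.noiseEnergy k ω) μ ∧
        ∫ ω, g ω * M.noiseEnergy k ω ∂μ ≤ β * ∫ ω, g ω ∂μ := by
  obtain ⟨β, hβ⟩ := hA2.condExp_energy_enlarged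
  refine ⟨max β 0, le_max_right _ _, fun k g h0 hm hi => ?_⟩
  exact integrable_mul_of_condExp_le (M.enlarged_le k) (M.noiseEnergy_nonneg k)
    (M.measurable_noiseEnergy k) (hA2.integrable_energy k)
    ((hβ k).mono fun ω h => h.trans (le_max_left _ _)) h0 hm hi

theorem measurable_sqErr_enlarged (k : ℕ) : Measurable[M.enlarged k] (M.sqErr k) :=
  (M.measurable_sqErr k).mono (M.past_le_enlarged k) le_rfl

theorem measurable_one_add_sqErr (k : ℕ) :
    Measurable[M.enlarged k] fun ω => 1 + M.sqErr k ω :=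
  (measurable_const_add (1 : ℝ)).comp (M.measurable_sqErr_enlarged k)

theorem measurable_sqErr' (k : ℕ) : Measurable (M.sqErr k) :=
  (M.measurable_sqErr k).mono (M.past_le k) le_rfl

theorem integrable_one_add {f : Ω → ℝ} (hf : Integrable f μ) :
    Integrable (fun ω => 1 + f ω) μ := (integrable_const 1).add hf

theorem measurable_err_apply' (k : ℕ) (i : Fin N) : Measurable fun ω => M.err k ω i :=
  (M.measurable_err_apply k i).mono (M.past_le k) le_rfl

/-- The induction needs no independence of the error and the current noise: `1 + sqErr` is
determined by the enlarged sigma-algebra, so the conditional energy bound makes its product with the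
noise energy integrable. -/
theorem integrable_sqErr (hA1 : M.A1) (hA2 : M.A2 μ) {κ : ℝ} (hκ : 0 ≤ κ)
    (hB : ∀ k ω, StateBound κ (M.state k ω)) (k : ℕ) : Integrable (M.sqErr k) μ := by
  obtain ⟨β, hβ0, hβ⟩ := hA2.exists_energy_bound
  obtain ⟨C₁, hC₁, h1⟩ := M.exists_drift_bound hκ
  obtain ⟨C₂, hC₂, h2⟩ := M.exists_diffusion_bound hκ hA1
  induction k with
  | zero =>
    have h : M.sqErr 0 = fun _ => ∑ i, ‖M.init i - M.x0‖ ^ 2 := rfl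
    rw [h]
    exact integrable_const _
  | succ k ih =>
    have hE := (hβ k _ (fun ω => add_nonneg zero_le_one (M.sqErr_nonneg k ω))
      (M.measurable_one_add_sqErr k) (integrable_one_add ih)).1
    refine Integrable.mono'
      ((ih.const_mul 3).add (((integrable_one_add ih).const_mul (N * (3 * (C₁ * M.gainSq k)))).add
        (hE.const_mul (N * (3 * (C₂ * M.gainSq k))))))
      (M.measurable_sqErr' (k + 1)).aestronglyMeasurable (Eventually.of_forall fun ω => ?_)
    rw [Real.norm_of_nonneg (M.sqErr_nonneg _ _)]
    have hi : ∀ i, ‖M.err (k + 1) ω i‖ ^ 2 ≤ 3 * ‖M.err k ω i‖ ^ 2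
        + 3 * (C₁ * M.gainSq k) * (1 + M.sqErr k ω)
        + 3 * (C₂ * M.gainSq k) * ((1 + M.sqErr k ω) * M.noiseEnergy k ω) := by
      intro i
      have e1 : ‖M.drift k ω i‖ ^ 2 ≤ C₁ * M.gainSq k * (1 + M.sqErr k ω) :=
        h1 k _ (hB k ω) (M.err k ω) i
      have e2 := h2 k ω (hB k ω) i
      have e3 : ‖M.err (k + 1) ω i‖ ≤ ‖M.err k ω i‖ + ‖M.drift k ω i‖ + ‖M.diffusion k ω i‖ := by
        rw [M.err_succ]
        exact (norm_add_le _ _).trans (add_le_add (norm_sub_le _ _) le_rfl)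
      have e4 := pow_le_pow_left₀ (norm_nonneg _) e3 2
      linarith [sq_nonneg (‖M.err k ω i‖ - ‖M.drift k ω i‖),
        sq_nonneg (‖M.err k ω i‖ - ‖M.diffusion k ω i‖),
        sq_nonneg (‖M.drift k ω i‖ - ‖M.diffusion k ω i‖)]
    refine (Finset.sum_le_sum fun i _ => hi i).trans (le_of_eq ?_)
    simp only [Finset.sum_add_distrib, ← Finset.mul_sum, Pi.add_apply, Finset.sum_const,
      Finset.card_univ, Fintype.card_fin, nsmul_eq_mul]
    change 3 * M.sqErr k ω + _ + _ = _
    ring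

theorem integrable_of_abs_le_sqErr {k : ℕ} (hV : Integrable (M.sqErr k) μ) {f : Ω → ℝ}
    (hf : Measurable f) {C : ℝ} (hC : ∀ ω, |f ω| ≤ C * (1 + M.sqErr k ω)) : Integrable f μ :=
  ((integrable_one_add hV).const_mul C).mono' hf.aestronglyMeasurable (Eventually.of_forall hC)

theorem integrable_norm_sq_err {k : ℕ} (hV : Integrable (M.sqErr k) μ) (i : Fin N) :
    Integrable (fun ω => ‖M.err k ω i‖ ^ 2) μ := by
  refine integrable_of_abs_le_sqErr hV ((M.measurable_err_apply' k i).norm.pow_const 2) (C := 1)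
    fun ω => ?_
  rw [abs_of_nonneg (sq_nonneg _), one_mul]
  have h := Finset.single_le_sum (f := fun i => ‖M.err k ω i‖ ^ 2) (fun _ _ => sq_nonneg _)
    (Finset.mem_univ i)
  have h2 : M.sqErr k ω = ∑ i, ‖M.err k ω i‖ ^ 2 := rfl
  linarith

theorem noise_norm_sq_le (k : ℕ) (ω : Ω) (i : Fin N) :
    ‖M.noise k ω i‖ ^ 2 ≤ M.noiseEnergy k ω :=
  (pow_le_pow_left₀ (norm_nonneg _) (M.noise_norm_le_sqrt k ω i) 2).trans_eq
    (Real.sq_sqrt (M.noiseEnergy_nonneg k ω))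

theorem comm_norm_sq_le (k : ℕ) (ω : Ω) (j i : Fin N) :
    ‖M.comm k ω j i‖ ^ 2 ≤ M.noiseEnergy k ω :=
  (pow_le_pow_left₀ (norm_nonneg _) (M.comm_norm_le_sqrt k ω j i) 2).trans_eq
    (Real.sq_sqrt (M.noiseEnergy_nonneg k ω))

theorem measurable_noise_apply (k : ℕ) (i : Fin N) : Measurable fun ω => M.noise k ω i :=
  (measurable_pi_apply i).comp (M.measurable_noise k)

theorem measurable_comm_apply (k : ℕ) (j i : Fin N) : Measurable fun ω => M.comm k ω j i :=
  (measurable_pi_apply i).comp ((measurable_pi_apply j).comp (M.measurable_comm k))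

theorem measurable_reg_mul {k : ℕ} (i : Fin N) {g : Ω → EuclideanSpace ℝ (Fin n)}
    (hg : Measurable[M.enlarged k] g) : Measurable[M.enlarged k]
      fun ω => Matrix.toEuclideanLin ((M.state k ω).1 i) (g ω) := by
  have h1 : Measurable fun z : State N n m => z.1 i := (measurable_pi_apply i).comp measurable_fst
  exact @measurable_toEuclideanLin _ _ Ω (M.enlarged k) _ _
    (h1.comp (M.measurable_state_enlarged k k)) hg

theorem measurable_channel_gain (k : ℕ) (i j : Fin N) : Measurable[M.enlarged k]
    fun ω => (M.state k ω).2 i j * M.intensity j i (M.err k ω j - M.err k ω i) := by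
  have h1 : Measurable fun z : State N n m => z.2 i j :=
    (measurable_matrix_entry i j).comp measurable_snd
  have h2 := h1.comp (M.measurable_state_enlarged k k)
  have h3 := (M.measurable_intensityAt i j).comp (M.measurable_err_enlarged k)
  exact h2.mul h3

theorem inner_diffusion (k : ℕ) (ω : Ω) (i : Fin N) (x : EuclideanSpace ℝ (Fin n)) :
    inner ℝ x (M.diffusion k ω i)
      = M.a k * inner ℝ (Matrix.toEuclideanLin ((M.state k ω).1 i) x) (M.noise k ω i)
        + M.b k * ∑ j, inner ℝ x
          (((M.state k ω).2 i j * M.intensity j i (M.err k ω j - M.err k ω i)) •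
            M.comm k ω j i) := by
  simp only [diffusion, diffusionAt, noises, inner_add_right, inner_smul_right, inner_sum,
    inner_toEuclideanLin_transpose]

/-- The noise term is orthogonal to everything determined by the past and the chain. -/
theorem integral_inner_diffusion (hA1 : M.A1) (hA2 : M.A2 μ) {κ : ℝ} (hκ : 0 ≤ κ)
    (hB : ∀ k ω, StateBound κ (M.state k ω)) (k : ℕ) (i : Fin N)
    {g : Ω → EuclideanSpace ℝ (Fin n)} (hg : Measurable[M.enlarged k] g)
    (hg2 : Integrable (fun ω => ‖g ω‖ ^ 2) μ) :
    Integrable (fun ω => inner ℝ (g ω) (M.diffusion k ω i)) μ ∧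
      ∫ ω, inner ℝ (g ω) (M.diffusion k ω i) ∂μ = 0 := by
  have hV := integrable_sqErr hA1 hA2 hκ hB k
  obtain ⟨β, hβ0, hβ⟩ := hA2.exists_energy_bound
  have hle := M.enlarged_le k
  have hEn := hA2.integrable_energy k
  have hg' : Measurable g := hg.mono hle le_rfl
  have hn2 : Integrable (fun ω => ‖M.noise k ω i‖ ^ 2) μ :=
    hEn.mono' ((M.measurable_noise_apply k i).norm.pow_const 2).aestronglyMeasurable
      (Eventually.of_forall fun ω => by
        rw [Real.norm_of_nonneg (sq_nonneg _)]; exact M.noise_norm_sq_le k ω i)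
  have hHg := M.measurable_reg_mul i hg
  have hHg' := hHg.mono hle le_rfl
  have hHg2 : Integrable (fun ω => ‖Matrix.toEuclideanLin ((M.state k ω).1 i) (g ω)‖ ^ 2) μ := by
    refine (hg2.const_mul (κ ^ 2)).mono' (hHg'.norm.pow_const 2).aestronglyMeasurable
      (Eventually.of_forall fun ω => ?_)
    rw [Real.norm_of_nonneg (sq_nonneg _), ← mul_pow]
    exact pow_le_pow_left₀ (norm_nonneg _) ((hB k ω).reg i _) 2
  have hint1 := integrable_inner_of_sq hHg'.aestronglyMeasurable
    (M.measurable_noise_apply k i).aestronglyMeasurable hHg2 hn2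
  have hzero1 := integral_inner_eq_zero_of_condExp_eq_zero hle hHg.stronglyMeasurable
    (hA2.integrable_noise k i) (hA2.condExp_noise_enlarged k i) hint1
  have hch : ∀ j, Integrable (fun ω => inner ℝ (g ω)
      (((M.state k ω).2 i j * M.intensity j i (M.err k ω j - M.err k ω i)) • M.comm k ω j i)) μ ∧
      ∫ ω, inner ℝ (g ω) (((M.state k ω).2 i j * M.intensity j i (M.err k ω j - M.err k ω i)) •
        M.comm k ω j i) ∂μ = 0 := by
    intro j
    set w : Ω → ℝ := fun ω => (M.state k ω).2 i j * M.intensity j i (M.err k ω j - M.err k ω i)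
      with hw
    have hwm : Measurable[M.enlarged k] w := M.measurable_channel_gain k i j
    have hwm' : Measurable w := hwm.mono hle le_rfl
    obtain ⟨σ, c, hf⟩ := hA1
    -- The channel gain is at most affine in the error norm, so its square is integrable; the energy
    -- bound then makes the weighted noise square integrable.
    have hwb : ∀ ω, w ω ^ 2 ≤ 2 * (κ * (2 * |σ| + |c|)) ^ 2 * (1 + M.sqErr k ω) := by
      intro ω
      have h1 : |w ω| ≤ κ * ((2 * |σ| + |c|) * (1 + √(M.sqErr k ω))) := by
        rw [hw, abs_mul]
        exact mul_le_mul ((hB k ω).adj i j) (M.abs_intensity_le hf (M.err k ω) i j)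
          (abs_nonneg _) hκ
      have h2 := pow_le_pow_left₀ (abs_nonneg _) h1 2
      rw [sq_abs] at h2
      have h3 := Real.sq_sqrt (M.sqErr_nonneg k ω)
      have h4 : (1 + √(M.sqErr k ω)) ^ 2 ≤ 2 * (1 + M.sqErr k ω) := by
        linarith [sq_nonneg (1 - √(M.sqErr k ω))]
      calc w ω ^ 2 ≤ (κ * (2 * |σ| + |c|)) ^ 2 * (1 + √(M.sqErr k ω)) ^ 2 := by
            rw [← mul_pow, mul_assoc]; exact h2
        _ ≤ (κ * (2 * |σ| + |c|)) ^ 2 * (2 * (1 + M.sqErr k ω)) :=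
            mul_le_mul_of_nonneg_left h4 (sq_nonneg _)
        _ = _ := by ring
    have hw2 : Integrable (fun ω => w ω ^ 2) μ :=
      integrable_of_abs_le_sqErr hV (hwm'.pow_const 2) fun ω => by
        rw [abs_of_nonneg (sq_nonneg _)]; exact hwb ω
    have hξm := M.measurable_comm_apply k j i
    have hwξ2 : Integrable (fun ω => ‖w ω • M.comm k ω j i‖ ^ 2) μ := by
      refine (hβ k _ (fun ω => sq_nonneg (w ω)) (hwm.pow_const 2) hw2).1.mono'
        ((hwm'.smul hξm).norm.pow_const 2).aestronglyMeasurable (Eventually.of_forall fun ω => ?_)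
      rw [Real.norm_of_nonneg (sq_nonneg _), norm_smul, mul_pow, Real.norm_eq_abs, sq_abs]
      exact mul_le_mul_of_nonneg_left (M.comm_norm_sq_le k ω j i) (sq_nonneg _)
    have hint := integrable_inner_of_sq hg'.aestronglyMeasurable
      (hwm'.smul hξm).aestronglyMeasurable hg2 hwξ2
    -- The weight moves to the side known to the enlarged sigma-algebra, leaving the bare centred
    -- noise on the other.
    have hmove : ∀ ω, inner ℝ (g ω) (w ω • M.comm k ω j i)
        = inner ℝ (w ω • g ω) (M.comm k ω j i) := fun ω => by
      rw [inner_smul_right, real_inner_smul_left]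
    refine ⟨hint, ?_⟩
    have hint' : Integrable (fun ω => inner ℝ (w ω • g ω) (M.comm k ω j i)) μ :=
      hint.congr (Eventually.of_forall hmove)
    rw [integral_congr_ae (Eventually.of_forall hmove)]
    exact integral_inner_eq_zero_of_condExp_eq_zero hle (hwm.smul hg).stronglyMeasurable
      (hA2.integrable_comm k j i) (hA2.condExp_comm_enlarged k j i) hint'
  have hexp : (fun ω => (inner ℝ (g ω) (M.diffusion k ω i) : ℝ)) = fun ω =>
      M.a k * inner ℝ (Matrix.toEuclideanLin ((M.state k ω).1 i) (g ω)) (M.noise k ω i)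
        + M.b k * ∑ j, inner ℝ (g ω)
          (((M.state k ω).2 i j * M.intensity j i (M.err k ω j - M.err k ω i)) •
            M.comm k ω j i) := funext fun ω => M.inner_diffusion k ω i (g ω)
  rw [hexp]
  have hsum := integrable_finsetSum Finset.univ fun j _ => (hch j).1
  refine ⟨(hint1.const_mul _).add (hsum.const_mul _), ?_⟩
  rw [integral_add (hint1.const_mul _) (hsum.const_mul _), integral_const_mul,
    integral_const_mul, hzero1, integral_finsetSum _ fun j _ => (hch j).1]
  simp [(hch _).2]

theorem measurable_form {f : State N n m × (Fin N → EuclideanSpace ℝ (Fin n)) → ℝ}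
    (hf : Measurable f) (k s : ℕ) : Measurable fun ω => f (M.state k ω, M.err s ω) :=
  hf.comp ((M.measurable_state k).prodMk (M.measurable_err' s))

theorem integrable_regAt {κ : ℝ} (hB : ∀ k ω, StateBound κ (M.state k ω))
    {s : ℕ} (hV : Integrable (M.sqErr s) μ) (k : ℕ) :
    Integrable (fun ω => regAt (M.state k ω) (M.err s ω)) μ := by
  refine integrable_of_abs_le_sqErr hV (M.measurable_form measurable_regAt k s) (C := κ ^ 2)
    fun ω => ?_
  rw [abs_of_nonneg (regAt_nonneg _ _)]
  refine ((hB k ω).regAt_le _).trans (mul_le_mul_of_nonneg_left ?_ (sq_nonneg κ))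
  exact le_add_of_nonneg_left zero_le_one

theorem integrable_lapAt {κ : ℝ} (hκ : 0 ≤ κ) (hB : ∀ k ω, StateBound κ (M.state k ω))
    {s : ℕ} (hV : Integrable (M.sqErr s) μ) (k : ℕ) :
    Integrable (fun ω => lapAt (M.state k ω) (M.err s ω)) μ := by
  refine integrable_of_abs_le_sqErr hV (M.measurable_form measurable_lapAt k s)
    (C := 2 * N ^ 2 * κ) fun ω => ?_
  refine ((hB k ω).abs_lapAt_le hκ _).trans (mul_le_mul_of_nonneg_left ?_ (by positivity))
  exact le_add_of_nonneg_left zero_le_one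

/-- The basic one-step energy inequality, localized on an event of the past. -/
theorem exists_one_step (hA1 : M.A1) (hA2 : M.A2 μ) {κ : ℝ} (hκ : 0 ≤ κ)
    (hB : ∀ k ω, StateBound κ (M.state k ω)) :
    ∃ C, 0 ≤ C ∧ ∀ k (F : Set Ω), MeasurableSet[M.past k] F →
      ∫ ω in F, M.sqErr (k + 1) ω ∂μ ≤ ∫ ω in F, M.sqErr k ω ∂μ
        - 2 * M.a k * ∫ ω in F, regAt (M.state k ω) (M.err k ω) ∂μ
        - 2 * M.b k * ∫ ω in F, lapAt (M.state k ω) (M.err k ω) ∂μ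
        + C * M.gainSq k * ∫ ω in F, (1 + M.sqErr k ω) ∂μ := by
  obtain ⟨β, hβ0, hβ⟩ := hA2.exists_energy_bound
  obtain ⟨C₁, hC₁, h1⟩ := M.exists_drift_bound hκ
  obtain ⟨C₂, hC₂, h2⟩ := M.exists_diffusion_bound hκ hA1
  -- Regularization is treated as a perturbation. Twice its inner product with the error is at least
  -- `-|lam| * (3 * sqErr + N * ‖x0‖ ^ 2)`: the 3 is 2 from the quadratic term and 1 from splitting
  -- the bias term. The summand `N * C₁` pays for the squared drift.
  set C₀ : ℝ := 3 + N * ‖M.x0‖ ^ 2 + N * C₁ with hC₀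
  refine ⟨C₀ + N * C₂ * β, by positivity, fun k F hF => ?_⟩
  have hV := integrable_sqErr hA1 hA2 hκ hB k
  have hFm : MeasurableSet F := M.past_le k F hF
  have hFe : MeasurableSet[M.enlarged k] F := M.past_le_enlarged k F hF
  have hγ := M.gainSq_nonneg k
  have hpoint : ∀ ω, M.sqErr (k + 1) ω ≤ M.sqErr k ω
      - 2 * M.a k * regAt (M.state k ω) (M.err k ω) - 2 * M.b k * lapAt (M.state k ω) (M.err k ω)
      + C₀ * M.gainSq k * (1 + M.sqErr k ω)
      + N * C₂ * M.gainSq k * ((1 + M.sqErr k ω) * M.noiseEnergy k ω)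
      + 2 * ∑ i, inner ℝ (M.err k ω i - M.drift k ω i) (M.diffusion k ω i) := by
    intro ω
    have hi : ∀ i, ‖M.err (k + 1) ω i‖ ^ 2 ≤ ‖M.err k ω i‖ ^ 2
        - 2 * inner ℝ (M.err k ω i) (M.drift k ω i)
        + C₁ * M.gainSq k * (1 + M.sqErr k ω)
        + C₂ * M.gainSq k * ((1 + M.sqErr k ω) * M.noiseEnergy k ω)
        + 2 * inner ℝ (M.err k ω i - M.drift k ω i) (M.diffusion k ω i) := by
      intro i
      have e1 : ‖M.drift k ω i‖ ^ 2 ≤ C₁ * M.gainSq k * (1 + M.sqErr k ω) :=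
        h1 k _ (hB k ω) (M.err k ω) i
      have e2 := h2 k ω (hB k ω) i
      rw [M.err_succ, norm_add_sq_real, norm_sub_sq_real]
      linarith
    have hs : M.sqErr (k + 1) ω ≤ M.sqErr k ω
        - 2 * ∑ i, inner ℝ (M.err k ω i) (M.drift k ω i)
        + N * (C₁ * M.gainSq k * (1 + M.sqErr k ω))
        + N * (C₂ * M.gainSq k * ((1 + M.sqErr k ω) * M.noiseEnergy k ω))
        + 2 * ∑ i, inner ℝ (M.err k ω i - M.drift k ω i) (M.diffusion k ω i) := by
      refine (Finset.sum_le_sum fun i _ => hi i).trans (le_of_eq ?_)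
      simp only [Finset.sum_add_distrib, Finset.sum_sub_distrib, ← Finset.mul_sum,
        Finset.sum_const, Finset.card_univ, Fintype.card_fin, nsmul_eq_mul]
      change M.sqErr k ω - _ + _ + _ + _ = _
      ring
    rw [M.sum_inner_drift] at hs
    have hx : |M.lam k * ∑ i, inner ℝ (M.err k ω i) M.x0|
        ≤ |M.lam k| * ((M.sqErr k ω + N * ‖M.x0‖ ^ 2) / 2) := by
      rw [abs_mul]
      refine mul_le_mul_of_nonneg_left ?_ (abs_nonneg _)
      calc |∑ i, inner ℝ (M.err k ω i) M.x0|
          ≤ ∑ i, (‖M.err k ω i‖ ^ 2 + ‖M.x0‖ ^ 2) / 2 := by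
            refine (Finset.abs_sum_le_sum_abs _ _).trans (Finset.sum_le_sum fun i _ => ?_)
            refine (abs_real_inner_le_norm _ _).trans ?_
            linarith [sq_nonneg (‖M.err k ω i‖ - ‖M.x0‖)]
        _ = _ := by
            rw [← Finset.sum_div, Finset.sum_add_distrib]
            simp [sqErr]
    have hV0 := M.sqErr_nonneg k ω
    have hlamV : |M.lam k * M.sqErr k ω| = |M.lam k| * M.sqErr k ω := by
      rw [abs_mul, abs_of_nonneg hV0]
    have hl1 : |M.lam k| ≤ M.gainSq k := by
      unfold gainSq; linarith [sq_nonneg (M.a k), sq_nonneg (M.b k), sq_nonneg (M.lam k)]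
    have hx0 : 0 ≤ N * ‖M.x0‖ ^ 2 := by positivity
    have hmul : |M.lam k| * (3 * M.sqErr k ω + N * ‖M.x0‖ ^ 2)
        ≤ (3 + N * ‖M.x0‖ ^ 2) * M.gainSq k * (1 + M.sqErr k ω) := by
      calc |M.lam k| * (3 * M.sqErr k ω + N * ‖M.x0‖ ^ 2)
          ≤ M.gainSq k * (3 * M.sqErr k ω + N * ‖M.x0‖ ^ 2) :=
            mul_le_mul_of_nonneg_right hl1 (by positivity)
        _ ≤ M.gainSq k * ((3 + N * ‖M.x0‖ ^ 2) * (1 + M.sqErr k ω)) := by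
            refine mul_le_mul_of_nonneg_left ?_ hγ
            linarith [mul_nonneg hx0 hV0]
        _ = _ := by ring
    have e1 := (abs_le.1 hx).1
    have e2 := neg_abs_le (M.lam k * M.sqErr k ω)
    rw [hlamV] at e2
    rw [hC₀]
    linarith
  set u : Fin N → Ω → EuclideanSpace ℝ (Fin n) := fun i ω => M.err k ω i - M.drift k ω i with hu
  have hum : ∀ i, Measurable[M.enlarged k] (u i) := fun i =>
    ((M.measurable_err_apply k i).mono (M.past_le_enlarged k) le_rfl).sub
      (M.measurable_drift_enlarged k i)
  have hu2 : ∀ i, Integrable (fun ω => ‖F.indicator (u i) ω‖ ^ 2) μ := by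
    intro i
    have hm : Measurable (F.indicator (u i)) := ((hum i).mono (M.enlarged_le k) le_rfl).indicator hFm
    refine integrable_of_abs_le_sqErr hV (hm.norm.pow_const 2)
      (C := 2 + 2 * (C₁ * M.gainSq k)) fun ω => ?_
    rw [abs_of_nonneg (sq_nonneg _)]
    have e0 : ‖F.indicator (u i) ω‖ ≤ ‖M.err k ω i‖ + ‖M.drift k ω i‖ :=
      (norm_indicator_le_norm_self _ _).trans (norm_sub_le _ _)
    have e1 : ‖M.drift k ω i‖ ^ 2 ≤ C₁ * M.gainSq k * (1 + M.sqErr k ω) :=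
      h1 k _ (hB k ω) (M.err k ω) i
    have e2 := pow_le_pow_left₀ (norm_nonneg _) e0 2
    have e3 : ‖M.err k ω i‖ ^ 2 ≤ M.sqErr k ω :=
      Finset.single_le_sum (f := fun i => ‖M.err k ω i‖ ^ 2) (fun _ _ => sq_nonneg _)
        (Finset.mem_univ i)
    linarith [sq_nonneg (‖M.err k ω i‖ - ‖M.drift k ω i‖)]
  -- Localization on `F` is absorbed into the known factor: an event of the past also belongs to the
  -- enlarged sigma-algebra, so orthogonality to the noise is preserved.
  have hind : ∀ i ω, inner ℝ (F.indicator (u i) ω) (M.diffusion k ω i)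
      = F.indicator (fun ω => inner ℝ (u i ω) (M.diffusion k ω i)) ω := by
    intro i ω
    by_cases h : ω ∈ F <;> simp [h]
  have hcross : ∀ i, IntegrableOn (fun ω => inner ℝ (u i ω) (M.diffusion k ω i)) F μ ∧
      ∫ ω in F, inner ℝ (u i ω) (M.diffusion k ω i) ∂μ = 0 := by
    intro i
    have h := integral_inner_diffusion hA1 hA2 hκ hB k i ((hum i).indicator hFe) (hu2 i)
    simp_rw [hind] at h
    rwa [integral_indicator hFm, integrable_indicator_iff hFm] at h
  have hone := integrable_one_add hV
  have hEn := hβ k (F.indicator fun ω => 1 + M.sqErr k ω)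
    (Set.indicator_nonneg fun ω _ => add_nonneg zero_le_one (M.sqErr_nonneg k ω))
    ((M.measurable_one_add_sqErr k).indicator hFe) (hone.indicator hFm)
  have hEn' : ∀ ω, F.indicator (fun ω => 1 + M.sqErr k ω) ω * M.noiseEnergy k ω
      = F.indicator (fun ω => (1 + M.sqErr k ω) * M.noiseEnergy k ω) ω := by
    intro ω
    by_cases h : ω ∈ F <;> simp [h]
  simp_rw [hEn'] at hEn
  rw [integral_indicator hFm, integral_indicator hFm, integrable_indicator_iff hFm] at hEn
  have i1 := hV.integrableOn (s := F)
  have i2 := (integrable_regAt hB hV k).integrableOn (s := F)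
  have i3 := (integrable_lapAt hκ hB hV k).integrableOn (s := F)
  have i4 := hone.integrableOn (s := F)
  have i6 : IntegrableOn (fun ω => ∑ i, inner ℝ (u i ω) (M.diffusion k ω i)) F μ :=
    integrable_finsetSum _ fun i _ => (hcross i).1
  have j12 := i1.sub (i2.const_mul (2 * M.a k))
  have j123 := j12.sub (i3.const_mul (2 * M.b k))
  have j1234 := j123.add (i4.const_mul (C₀ * M.gainSq k))
  have j12345 := j1234.add (hEn.1.const_mul (N * C₂ * M.gainSq k))
  have hmono := setIntegral_mono (integrable_sqErr hA1 hA2 hκ hB (k + 1)).integrableOn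
    (j12345.add (i6.const_mul 2)) hpoint
  rw [integral_add' j12345 (i6.const_mul 2), integral_add' j1234 (hEn.1.const_mul _),
    integral_add' j123 (i4.const_mul _), integral_sub' j12 (i3.const_mul _),
    integral_sub' i1 (i2.const_mul _), integral_const_mul, integral_const_mul, integral_const_mul,
    integral_const_mul, integral_const_mul,
    integral_finsetSum _ fun i _ => (hcross i).1, Finset.sum_congr rfl fun i _ => (hcross i).2,
    Finset.sum_const_zero, mul_zero, add_zero] at hmono
  have hlast := mul_le_mul_of_nonneg_left hEn.2 (show 0 ≤ N * C₂ * M.gainSq k by positivity)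
  refine hmono.trans ?_
  linarith

/-- Mean-square size of the one-step displacement. -/
theorem exists_displacement (hA1 : M.A1) (hA2 : M.A2 μ) {κ : ℝ} (hκ : 0 ≤ κ)
    (hB : ∀ k ω, StateBound κ (M.state k ω)) :
    ∃ C, 0 ≤ C ∧ ∀ k, Integrable (fun ω => ∑ i, ‖M.err (k + 1) ω i - M.err k ω i‖ ^ 2) μ ∧
      ∫ ω, ∑ i, ‖M.err (k + 1) ω i - M.err k ω i‖ ^ 2 ∂μ
        ≤ C * M.gainSq k * (1 + ∫ ω, M.sqErr k ω ∂μ) := by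
  obtain ⟨β, hβ0, hβ⟩ := hA2.exists_energy_bound
  obtain ⟨C₁, hC₁, h1⟩ := M.exists_drift_bound hκ
  obtain ⟨C₂, hC₂, h2⟩ := M.exists_diffusion_bound hκ hA1
  refine ⟨N * (2 * C₁ + 2 * C₂ * β), by positivity, fun k => ?_⟩
  have hV := integrable_sqErr hA1 hA2 hκ hB k
  have hone := integrable_one_add hV
  have hγ := M.gainSq_nonneg k
  have hEn := hβ k (fun ω => 1 + M.sqErr k ω)
    (fun ω => add_nonneg zero_le_one (M.sqErr_nonneg k ω)) (M.measurable_one_add_sqErr k) hone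
  have hpoint : ∀ ω, ∑ i, ‖M.err (k + 1) ω i - M.err k ω i‖ ^ 2
      ≤ N * (2 * C₁ * M.gainSq k) * (1 + M.sqErr k ω)
        + N * (2 * C₂ * M.gainSq k) * ((1 + M.sqErr k ω) * M.noiseEnergy k ω) := by
    intro ω
    have hi : ∀ i, ‖M.err (k + 1) ω i - M.err k ω i‖ ^ 2
        ≤ 2 * C₁ * M.gainSq k * (1 + M.sqErr k ω)
          + 2 * C₂ * M.gainSq k * ((1 + M.sqErr k ω) * M.noiseEnergy k ω) := by
      intro i
      have e1 : ‖M.drift k ω i‖ ^ 2 ≤ C₁ * M.gainSq k * (1 + M.sqErr k ω) :=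
        h1 k _ (hB k ω) (M.err k ω) i
      have e2 := h2 k ω (hB k ω) i
      have e3 : ‖M.err (k + 1) ω i - M.err k ω i‖ ≤ ‖M.diffusion k ω i‖ + ‖M.drift k ω i‖ := by
        have : M.err (k + 1) ω i - M.err k ω i = M.diffusion k ω i - M.drift k ω i := by
          rw [M.err_succ]; abel
        rw [this]
        exact norm_sub_le _ _
      have e4 := pow_le_pow_left₀ (norm_nonneg _) e3 2
      linarith [sq_nonneg (‖M.diffusion k ω i‖ - ‖M.drift k ω i‖)]
    refine (Finset.sum_le_sum fun i _ => hi i).trans (le_of_eq ?_)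
    simp only [Finset.sum_const, Finset.card_univ, Fintype.card_fin, nsmul_eq_mul]
    ring
  have hdom := (hone.const_mul (N * (2 * C₁ * M.gainSq k))).add
    (hEn.1.const_mul (N * (2 * C₂ * M.gainSq k)))
  have hm : Measurable fun ω => ∑ i, ‖M.err (k + 1) ω i - M.err k ω i‖ ^ 2 :=
    Finset.measurable_fun_sum _ fun i _ => (((M.measurable_err_apply' (k + 1) i).sub
      (M.measurable_err_apply' k i)).norm.pow_const 2)
  have hint : Integrable (fun ω => ∑ i, ‖M.err (k + 1) ω i - M.err k ω i‖ ^ 2) μ := by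
    refine hdom.mono' hm.aestronglyMeasurable (Eventually.of_forall fun ω => ?_)
    rw [Real.norm_of_nonneg (sum_sq_nonneg _)]
    exact hpoint ω
  refine ⟨hint, (integral_mono hint hdom hpoint).trans ?_⟩
  have hone' : ∫ ω, (1 + M.sqErr k ω) ∂μ = 1 + ∫ ω, M.sqErr k ω ∂μ := by
    rw [integral_add (integrable_const 1) hV]; simp
  rw [integral_add' (hone.const_mul _) (hEn.1.const_mul _), integral_const_mul,
    integral_const_mul, hone']
  have hlast := mul_le_mul_of_nonneg_left hEn.2
    (show 0 ≤ N * (2 * C₂ * M.gainSq k) by positivity)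
  rw [hone'] at hlast
  linarith

/-- The conditional Laplacian form is nonnegative. -/
theorem BalancedConditionalDigraphs.setIntegral_lapAt_nonneg
    (hG : M.BalancedConditionalDigraphs μ) {κ : ℝ}
    (hB : ∀ k ω, StateBound κ (M.state k ω)) {k : ℕ} (hV : Integrable (M.sqErr k) μ)
    {F : Set Ω} (hF : MeasurableSet[M.past k] F) :
    0 ≤ ∫ ω in F, lapAt (M.state k ω) (M.err k ω) ∂μ := by
  have hle := M.past_le k
  set w : Fin N → Fin N → Ω → ℝ := fun i j ω => M.adj k ω i j with hw
  set g : Fin N → Fin N → Ω → ℝ := fun i j ω => inner ℝ (M.err k ω i) (M.err k ω i - M.err k ω j)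
    with hg
  have hwm : ∀ i j, Measurable (w i j) := fun i j =>
    (measurable_matrix_entry i j).comp (M.measurable_adj k)
  have hwb : ∀ i j ω, |w i j ω| ≤ κ := fun i j ω => (hB k ω).adj i j
  have hwi : ∀ i j, Integrable (w i j) μ := fun i j =>
    Integrable.of_bound (hwm i j).aestronglyMeasurable κ (Eventually.of_forall (hwb i j))
  have hgm : ∀ i j, Measurable[M.past k] (g i j) := by
    intro i j
    have h : Measurable fun d : Fin N → EuclideanSpace ℝ (Fin n) =>
        (inner ℝ (d i) (d i - d j) : ℝ) := by fun_prop
    exact h.comp (M.measurable_err k)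
  have hgi : ∀ i j, Integrable (g i j) μ := by
    intro i j
    refine integrable_of_abs_le_sqErr hV ((hgm i j).mono hle le_rfl) (C := 2) fun ω => ?_
    have hr := norm_le_sqrt_sum_sq (M.err k ω)
    have hs : √(∑ i, ‖M.err k ω i‖ ^ 2) ^ 2 = M.sqErr k ω := Real.sq_sqrt (sum_sq_nonneg _)
    refine (abs_real_inner_le_norm _ _).trans ?_
    have h1 := (norm_sub_le (M.err k ω i) (M.err k ω j)).trans (add_le_add (hr i) (hr j))
    have h2 := mul_le_mul (hr i) h1 (norm_nonneg _) (Real.sqrt_nonneg _)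
    linarith
  have hwg : ∀ i j, Integrable (w i j * g i j) μ := fun i j =>
    (hgi i j).bdd_mul (hwm i j).aestronglyMeasurable (Eventually.of_forall (hwb i j))
  have hwg' : ∀ i j, IntegrableOn (fun ω => w i j ω * g i j ω) F μ := fun i j =>
    (hwg i j).integrableOn
  -- The error is known from the past, so under the integral the random weights may be replaced by
  -- their conditional means, even though the realized weights can be negative or unbalanced.
  have hce : ∀ i j, μ[w i j * g i j | M.past k] =ᵐ[μ] μ[w i j | M.past k] * g i j := fun i j =>
    condExp_mul_of_stronglyMeasurable_right (hgm i j).stronglyMeasurable (hwg i j) (hwi i j)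
  have hterm : ∀ i j, ∫ ω in F, w i j ω * g i j ω ∂μ
      = ∫ ω in F, M.condAdj μ k ω i j * g i j ω ∂μ := by
    intro i j
    have h := setIntegral_condExp hle (hwg i j) hF
    rw [setIntegral_congr_ae (hle F hF) ((hce i j).mono fun _ h _ => h)] at h
    exact h.symm
  have hci : ∀ i j, Integrable (fun ω => M.condAdj μ k ω i j * g i j ω) μ := fun i j =>
    (integrable_condExp.congr (hce i j))
  have heq : ∫ ω in F, lapAt (M.state k ω) (M.err k ω) ∂μ
      = ∫ ω in F, ∑ i, ∑ j, M.condAdj μ k ω i j * g i j ω ∂μ := by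
    have h1 : ∫ ω in F, lapAt (M.state k ω) (M.err k ω) ∂μ
        = ∑ i, ∑ j, ∫ ω in F, w i j ω * g i j ω ∂μ := by
      change ∫ ω in F, ∑ i, ∑ j, w i j ω * g i j ω ∂μ = _
      rw [integral_finsetSum _ fun i _ => integrable_finsetSum _ fun j _ => hwg' i j]
      exact Finset.sum_congr rfl fun i _ =>
        integral_finsetSum _ fun j _ => hwg' i j
    rw [h1, integral_finsetSum _ fun i _ => integrable_finsetSum _ fun j _ =>
      (hci i j).integrableOn]
    refine Finset.sum_congr rfl fun i _ => ?_
    rw [integral_finsetSum _ fun j _ => (hci i j).integrableOn]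
    exact Finset.sum_congr rfl fun j _ => hterm i j
  rw [heq]
  refine integral_nonneg_of_ae (ae_restrict_of_ae ?_)
  filter_upwards [(hG k).1, (hG k).2] with ω h0 hb
  exact hb.sum_inner_sub_nonneg h0 (M.err k ω)

end Model

end DecReg

end

noncomputable section

namespace DecReg

/-! ### Stationary averages, entry by entry. -/

section StationaryAverages

variable {ι : Type*} {N n : ℕ} {m : Fin N → ℕ} {S : ι → State N n m} {π : ι → ℝ} {κ : ℝ}

/-- Bounded entries make the matrix series summable, so its `tsum` is the genuine sum and commutes
with taking entries. -/
theorem tsum_smul_matrix_apply {α β : Type*} (hπ0 : ∀ l, 0 ≤ π l) (hπs : Summable π)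
    {B : ι → Matrix α β ℝ} (hB : ∀ l a b, |B l a b| ≤ κ) (a : α) (b : β) :
    (∑' l, π l • B l) a b = ∑' l, π l * B l a b := by
  have hs : Summable fun l => π l • B l := by
    refine Pi.summable.2 fun a => Pi.summable.2 fun b => ?_
    exact summable_mul_of_bounded hπ0 hπs fun l => hB l a b
  exact (Pi.hasSum.1 (Pi.hasSum.1 hs.hasSum a) b).tsum_eq.symm

/-- The stationary average of the Gram matrix of the regression matrix of node `i`. -/
def stationaryGram (S : ι → State N n m) (π : ι → ℝ) (i : Fin N) : Matrix (Fin n) (Fin n) ℝ :=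
  ∑' l, π l • (((S l).1 i).transpose * (S l).1 i)

theorem stationaryGram_apply (hπ0 : ∀ l, 0 ≤ π l) (hπs : Summable π)
    (hS : ∀ l, StateBound κ (S l)) (i : Fin N) (a b : Fin n) :
    stationaryGram S π i a b = ∑' l, π l * (((S l).1 i).transpose * (S l).1 i) a b :=
  tsum_smul_matrix_apply hπ0 hπs (fun l => (hS l).gram i) a b

theorem stationaryAdj_apply (hπ0 : ∀ l, 0 ≤ π l) (hπs : Summable π)
    (hS : ∀ l, StateBound κ (S l)) (i j : Fin N) :
    stationaryAdj S π i j = ∑' l, π l * (S l).2 i j :=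
  tsum_smul_matrix_apply hπ0 hπs (fun l => (hS l).adj) i j

theorem stationaryGram_isHermitian (hπ0 : ∀ l, 0 ≤ π l) (hπs : Summable π)
    (hS : ∀ l, StateBound κ (S l)) (i : Fin N) : (stationaryGram S π i).IsHermitian := by
  refine Matrix.IsHermitian.ext fun a b => ?_
  rw [star_trivial, stationaryGram_apply hπ0 hπs hS, stationaryGram_apply hπ0 hπs hS]
  refine tsum_congr fun l => ?_
  simp only [Matrix.mul_apply, Matrix.transpose_apply]
  exact congrArg _ (Finset.sum_congr rfl fun r _ => mul_comm _ _)

/-- The form is a sum of squared norms with weights `π l`. -/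
theorem stationaryGram_quadForm_nonneg (hπ0 : ∀ l, 0 ≤ π l) (hπs : Summable π)
    (hS : ∀ l, StateBound κ (S l)) (i : Fin N) (x : Fin n → ℝ) :
    0 ≤ ∑ a, ∑ b, stationaryGram S π i a b * (x a * x b) := by
  have h : HasSum (fun l => ∑ a, ∑ b, π l * (((S l).1 i).transpose * (S l).1 i) a b * (x a * x b))
      (∑ a, ∑ b, stationaryGram S π i a b * (x a * x b)) := by
    refine hasSum_sum fun a _ => hasSum_sum fun b _ => ?_
    rw [stationaryGram_apply hπ0 hπs hS]
    exact (summable_mul_of_bounded hπ0 hπs fun l => (hS l).gram i a b).hasSum.mul_right _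
  refine h.nonneg fun l => ?_
  have e := norm_sq_toEuclideanLin ((S l).1 i) (WithLp.toLp 2 x)
  have : ∑ a, ∑ b, π l * (((S l).1 i).transpose * (S l).1 i) a b * (x a * x b)
      = π l * ∑ a, ∑ b, (((S l).1 i).transpose * (S l).1 i) a b * (x a * x b) := by
    simp only [Finset.mul_sum, mul_assoc]
  rw [this]
  exact mul_nonneg (hπ0 l) (e ▸ sq_nonneg _)

end StationaryAverages

namespace Model

variable {Ω : Type*} [MeasurableSpace Ω] {N n : ℕ} {m : Fin N → ℕ} {M : Model Ω N n m}
  {μ : Measure Ω} [IsProbabilityMeasure μ]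

theorem abs_mul_apply_le_sqErr (k : ℕ) (ω : Ω) (i : Fin N) (a b : Fin n) :
    |M.err k ω i a * M.err k ω i b| ≤ 2 * M.sqErr k ω := by
  have h1 := abs_apply_le_norm (M.err k ω i) a
  have h2 := abs_apply_le_norm (M.err k ω i) b
  have h3 : ‖M.err k ω i‖ ^ 2 ≤ M.sqErr k ω :=
    Finset.single_le_sum (f := fun i => ‖M.err k ω i‖ ^ 2) (fun _ _ => sq_nonneg _)
      (Finset.mem_univ i)
  rw [abs_mul]
  have h4 := mul_le_mul h1 h2 (abs_nonneg _) (norm_nonneg _)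
  linarith [M.sqErr_nonneg k ω]

theorem abs_inner_sub_le_sqErr (k : ℕ) (ω : Ω) (i j : Fin N) :
    |inner ℝ (M.err k ω i) (M.err k ω i - M.err k ω j)| ≤ 2 * M.sqErr k ω := by
  have hr := norm_le_sqrt_sum_sq (M.err k ω)
  have hs : √(∑ i, ‖M.err k ω i‖ ^ 2) ^ 2 = M.sqErr k ω := Real.sq_sqrt (sum_sq_nonneg _)
  refine (abs_real_inner_le_norm _ _).trans ?_
  have h1 := (norm_sub_le (M.err k ω i) (M.err k ω j)).trans (add_le_add (hr i) (hr j))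
  have h2 := mul_le_mul (hr i) h1 (norm_nonneg _) (Real.sqrt_nonneg _)
  linarith

/-! ### Mean dissipation through mixing. -/

section Ergodic

variable {ι : Type*} [Countable ι] {S : ι → State N n m} {p : ι → ι → ℝ} {π : ι → ℝ}

/-- Mixing of the chain against past-measurable weights dominated by the squared error. -/
theorem integral_mul_state_ge (hA2 : M.A2 μ) (hA3 : M.A3 μ S p π) {κ ε : ℝ} (hκ : 0 ≤ κ)
    (hε0 : 0 ≤ ε) {h : ℕ} (hε : ∀ l, ∑' l', |stepProb p h l l' - π l'| ≤ ε) (k : ℕ)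
    (hV : Integrable (M.sqErr (k + 1)) μ) {φ : State N n m → ℝ} (hφ : Measurable φ)
    (hφκ : ∀ l, |φ (S l)| ≤ κ) {g : Ω → ℝ} (hgm : Measurable[M.past (k + 1)] g)
    (hg : ∀ ω, |g ω| ≤ 2 * M.sqErr (k + 1) ω) :
    Integrable g μ ∧ Integrable (fun ω => φ (M.state (k + h) ω) * g ω) μ ∧
      (∑' l, π l * φ (S l)) * ∫ ω, g ω ∂μ - 2 * κ * ε * ∫ ω, M.sqErr (k + 1) ω ∂μ
        ≤ ∫ ω, φ (M.state (k + h) ω) * g ω ∂μ := by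
  have hc : IsHomogeneousMarkovChain μ M.state S p := hA3.chain
  have hgm' : Measurable g := hgm.mono (M.past_le _) le_rfl
  have hgi : Integrable g μ := (hV.const_mul 2).mono' hgm'.aestronglyMeasurable
    (Eventually.of_forall hg)
  have hφb : ∀ ω, |φ (M.state (k + h) ω)| ≤ κ := fun ω => by
    obtain ⟨l, hl⟩ := hc.mem_states (k + h) ω
    rw [hl]; exact hφκ l
  have hφm : Measurable fun ω => φ (M.state (k + h) ω) := hφ.comp (M.measurable_state _)
  refine ⟨hgi, hgi.bdd_mul hφm.aestronglyMeasurable (Eventually.of_forall hφb), ?_⟩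
  have hA : ∀ k, processBefore M.noises k ≤ ‹MeasurableSpace Ω› := fun k =>
    (M.noisesBefore_le_past k).trans (M.past_le k)
  have hmain := abs_integral_mul_sub_stationary_le M.measurable_state hc hA
    (processBefore_mono M.noises)
    (fun k => indep_of_indep_of_le_left hA2.indep_comap (processBefore_le_comap M.noises k))
    hA3.stationary hφ hφκ hε k (hgm.mono (M.past_le_sup (k + 1)) le_rfl) hgi
  have h1 : ∫ ω, |g ω| ∂μ ≤ 2 * ∫ ω, M.sqErr (k + 1) ω ∂μ := by
    rw [← integral_const_mul]
    exact integral_mono hgi.abs (hV.const_mul 2) hg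
  have h2 := mul_le_mul_of_nonneg_left h1 (mul_nonneg hκ hε0)
  have h3 := (abs_le.1 hmain).1
  simp_rw [mul_comm (φ _)]
  linarith

/-- After a fixed number of steps the expected drift form is uniformly dissipative. -/
theorem exists_mean_dissipation (hA1 : M.A1) (hA2 : M.A2 μ) (hA3 : M.A3 μ S p π)
    (hnonneg : ∀ i j, 0 ≤ stationaryAdj S π i j) (hbal : IsBalanced (stationaryAdj S π))
    (htree : HasSpanningTree (stationaryAdj S π)) (hobs : JointlyObservable S π) {κ : ℝ}
    (hκ : 0 ≤ κ) (hS : ∀ l, StateBound κ (S l)) (hB : ∀ k ω, StateBound κ (M.state k ω)) :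
    ∃ θ > 0, ∃ t : ℕ, ∀ k, θ * ∫ ω, M.sqErr (k + 1) ω ∂μ ≤
      ∫ ω, (regAt (M.state (k + 1 + t) ω) (M.err (k + 1) ω)
        + lapAt (M.state (k + 1 + t) ω) (M.err (k + 1) ω)) ∂μ := by
  have hπ0 := hA3.stationary.nonneg
  have hπs := hA3.stationary.hasSum_one.summable
  obtain ⟨θ, hθ, hdiss⟩ := exists_dissipation hnonneg hbal htree
    (stationaryGram_isHermitian hπ0 hπs hS) (stationaryGram_quadForm_nonneg hπ0 hπs hS) hobs
  -- Up to the extra 1, `c * ε * u` is the total mixing error over all Gram and adjacency entries,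
  -- each costing `2 * κ * ε * u`. The choice of `ε` keeps this total below half of the stationary
  -- dissipation.
  set c : ℝ := N * n * n * (2 * κ) + N * N * (2 * κ) + 1 with hc
  have hc0 : 0 < c := by positivity
  set ε : ℝ := θ / 2 / c with hεd
  have hε0 : 0 < ε := by positivity
  obtain ⟨t, ht⟩ := hA3.ergodic ε hε0
  refine ⟨θ / 2, by positivity, t, fun k => ?_⟩
  have hV := integrable_sqErr hA1 hA2 hκ hB (k + 1)
  set u := ∫ ω, M.sqErr (k + 1) ω ∂μ with hu
  have hu0 : 0 ≤ u := integral_nonneg (M.sqErr_nonneg (k + 1))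
  set z : Ω → State N n m := M.state (k + 1 + t) with hz
  set d : Ω → Fin N → EuclideanSpace ℝ (Fin n) := M.err (k + 1) with hd
  -- The error at time `k + 1` involves the chain up to time `k`, so the state at time `k + 1 + t`
  -- lies `t + 1` transitions ahead.
  have hzk : M.state (k + (t + 1)) = z := by rw [hz]; congr 1; ring
  have hgram : ∀ i a b, Integrable (fun ω => d ω i a * d ω i b) μ ∧
      Integrable (fun ω => (((z ω).1 i).transpose * (z ω).1 i) a b * (d ω i a * d ω i b)) μ ∧
      stationaryGram S π i a b * ∫ ω, d ω i a * d ω i b ∂μ - 2 * κ * ε * u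
        ≤ ∫ ω, (((z ω).1 i).transpose * (z ω).1 i) a b * (d ω i a * d ω i b) ∂μ := by
    intro i a b
    have hφ : Measurable fun z : State N n m => ((z.1 i).transpose * z.1 i) a b := by
      have h : ∀ r c, Measurable fun z : State N n m => z.1 i r c := fun r c =>
        (measurable_matrix_entry r c).comp ((measurable_pi_apply i).comp measurable_fst)
      simp only [Matrix.mul_apply, Matrix.transpose_apply]
      fun_prop
    have hg : Measurable fun d : Fin N → EuclideanSpace ℝ (Fin n) => d i a * d i b := by fun_prop
    have h := integral_mul_state_ge hA2 hA3 hκ hε0.le (ht (t + 1) (Nat.le_succ t)) k hV hφ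
      (fun l => (hS l).gram i a b) (hg.comp (M.measurable_err (k + 1)))
      fun ω => M.abs_mul_apply_le_sqErr (k + 1) ω i a b
    rw [hzk, ← stationaryGram_apply hπ0 hπs hS] at h
    exact h
  have hadj : ∀ i j, Integrable (fun ω => (inner ℝ (d ω i) (d ω i - d ω j) : ℝ)) μ ∧
      Integrable (fun ω => (z ω).2 i j * inner ℝ (d ω i) (d ω i - d ω j)) μ ∧
      stationaryAdj S π i j * ∫ ω, inner ℝ (d ω i) (d ω i - d ω j) ∂μ - 2 * κ * ε * u
        ≤ ∫ ω, (z ω).2 i j * inner ℝ (d ω i) (d ω i - d ω j) ∂μ := by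
    intro i j
    have hφ : Measurable fun z : State N n m => z.2 i j :=
      (measurable_matrix_entry i j).comp measurable_snd
    have hg : Measurable fun d : Fin N → EuclideanSpace ℝ (Fin n) =>
        (inner ℝ (d i) (d i - d j) : ℝ) := by fun_prop
    have h := integral_mul_state_ge hA2 hA3 hκ hε0.le (ht (t + 1) (Nat.le_succ t)) k hV hφ
      (fun l => (hS l).adj i j) (hg.comp (M.measurable_err (k + 1)))
      fun ω => M.abs_inner_sub_le_sqErr (k + 1) ω i j
    rw [hzk, ← stationaryAdj_apply hπ0 hπs hS] at h
    exact h
  have hreg : ∀ ω, regAt (z ω) (d ω)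
      = ∑ i, ∑ a, ∑ b, (((z ω).1 i).transpose * (z ω).1 i) a b * (d ω i a * d ω i b) :=
    fun ω => Finset.sum_congr rfl fun i _ => norm_sq_toEuclideanLin _ _
  have hireg : ∫ ω, regAt (z ω) (d ω) ∂μ = ∑ i, ∑ a, ∑ b,
      ∫ ω, (((z ω).1 i).transpose * (z ω).1 i) a b * (d ω i a * d ω i b) ∂μ := by
    rw [integral_congr_ae (Eventually.of_forall hreg), integral_finsetSum _ fun i _ =>
      integrable_finsetSum _ fun a _ => integrable_finsetSum _ fun b _ => (hgram i a b).2.1]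
    refine Finset.sum_congr rfl fun i _ => ?_
    rw [integral_finsetSum _ fun a _ => integrable_finsetSum _ fun b _ => (hgram i a b).2.1]
    exact Finset.sum_congr rfl fun a _ => integral_finsetSum _ fun b _ => (hgram i a b).2.1
  have hilap : ∫ ω, lapAt (z ω) (d ω) ∂μ = ∑ i, ∑ j,
      ∫ ω, (z ω).2 i j * inner ℝ (d ω i) (d ω i - d ω j) ∂μ := by
    unfold lapAt
    rw [integral_finsetSum _ fun i _ => integrable_finsetSum _ fun j _ => (hadj i j).2.1]
    exact Finset.sum_congr rfl fun i _ => integral_finsetSum _ fun j _ => (hadj i j).2.1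
  have hmean : θ * u ≤ ∑ i, ∑ a, ∑ b, stationaryGram S π i a b * ∫ ω, d ω i a * d ω i b ∂μ
      + ∑ i, ∑ j, stationaryAdj S π i j * ∫ ω, inner ℝ (d ω i) (d ω i - d ω j) ∂μ := by
    have e1 : ∀ i a b, Integrable
        (fun ω => stationaryGram S π i a b * (d ω i a * d ω i b)) μ := fun i a b =>
      (hgram i a b).1.const_mul _
    have e2 : ∀ i j, Integrable
        (fun ω => stationaryAdj S π i j * inner ℝ (d ω i) (d ω i - d ω j)) μ := fun i j =>
      (hadj i j).1.const_mul _
    have i1 : Integrable (fun ω => ∑ i, ∑ a, ∑ b,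
        stationaryGram S π i a b * (d ω i a * d ω i b)) μ :=
      integrable_finsetSum _ fun i _ => integrable_finsetSum _ fun a _ =>
        integrable_finsetSum _ fun b _ => e1 i a b
    have i2 : Integrable (fun ω => ∑ i, ∑ j,
        stationaryAdj S π i j * inner ℝ (d ω i) (d ω i - d ω j)) μ :=
      integrable_finsetSum _ fun i _ => integrable_finsetSum _ fun j _ => e2 i j
    have hm := integral_mono (hV.const_mul θ) (i1.add i2) fun ω => hdiss (d ω)
    rw [integral_const_mul, integral_add' i1 i2, integral_finsetSum _ fun i _ =>
      integrable_finsetSum _ fun a _ => integrable_finsetSum _ fun b _ => e1 i a b,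
      integral_finsetSum _ fun i _ => integrable_finsetSum _ fun j _ => e2 i j] at hm
    refine hm.trans (le_of_eq ?_)
    congr 1
    · refine Finset.sum_congr rfl fun i _ => ?_
      rw [integral_finsetSum _ fun a _ => integrable_finsetSum _ fun b _ => e1 i a b]
      refine Finset.sum_congr rfl fun a _ => ?_
      rw [integral_finsetSum _ fun b _ => e1 i a b]
      exact Finset.sum_congr rfl fun b _ => integral_const_mul _ _
    · refine Finset.sum_congr rfl fun i _ => ?_
      rw [integral_finsetSum _ fun j _ => e2 i j]
      exact Finset.sum_congr rfl fun j _ => integral_const_mul _ _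
  have hs1 := Finset.sum_le_sum fun (i : Fin N) (_ : i ∈ Finset.univ) =>
    Finset.sum_le_sum fun (a : Fin n) (_ : a ∈ Finset.univ) =>
    Finset.sum_le_sum fun (b : Fin n) (_ : b ∈ Finset.univ) => (hgram i a b).2.2
  have hs2 := Finset.sum_le_sum fun (i : Fin N) (_ : i ∈ Finset.univ) =>
    Finset.sum_le_sum fun (j : Fin N) (_ : j ∈ Finset.univ) => (hadj i j).2.2
  simp only [Finset.sum_sub_distrib, Finset.sum_const, Finset.card_univ, Fintype.card_fin,
    nsmul_eq_mul] at hs1 hs2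
  rw [integral_add (integrable_regAt hB hV _) (integrable_lapAt hκ hB hV _), hireg, hilap]
  have hεc : ε * c = θ / 2 := by rw [hεd]; field_simp
  have hexp : N * (n * (n * (2 * κ * ε * u))) + N * (N * (2 * κ * ε * u)) = ε * c * u - ε * u := by
    rw [hc]; ring
  rw [hεc] at hexp
  linarith [mul_nonneg hε0.le hu0]

end Ergodic

/-! ### Convergence in mean square -/

theorem integrable_sum_norm_sq_sub {k s : ℕ} (hVk : Integrable (M.sqErr k) μ)
    (hVs : Integrable (M.sqErr s) μ) :
    Integrable (fun ω => ∑ i, ‖M.err k ω i - M.err s ω i‖ ^ 2) μ := by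
  refine integrable_finsetSum _ fun i _ => ?_
  refine (((integrable_norm_sq_err hVk i).const_mul 2).add
    ((integrable_norm_sq_err hVs i).const_mul 2)).mono'
    (((M.measurable_err_apply' k i).sub (M.measurable_err_apply' s i)).norm.pow_const
      2).aestronglyMeasurable (Eventually.of_forall fun ω => ?_)
  rw [Real.norm_of_nonneg (sq_nonneg _)]
  have h := pow_le_pow_left₀ (norm_nonneg _) (norm_sub_le (M.err k ω i) (M.err s ω i)) 2
  simp only [Pi.add_apply]
  linarith [sq_nonneg (‖M.err k ω i‖ - ‖M.err s ω i‖)]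

theorem sum_norm_sq_sub_triangle {E : Type*} [NormedAddCommGroup E] (x y w : Fin N → E) :
    ∑ i, ‖x i - w i‖ ^ 2 ≤ 2 * ∑ i, ‖x i - y i‖ ^ 2 + 2 * ∑ i, ‖y i - w i‖ ^ 2 := by
  rw [Finset.mul_sum, Finset.mul_sum, ← Finset.sum_add_distrib]
  refine Finset.sum_le_sum fun i _ => ?_
  have h := pow_le_pow_left₀ (norm_nonneg _) (norm_sub_le_norm_sub_add_norm_sub (x i) (y i) (w i)) 2
  linarith [sq_nonneg (‖x i - y i‖ - ‖y i - w i‖)]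

theorem sum_norm_sq_le_add_sub {E : Type*} [NormedAddCommGroup E] (x y : Fin N → E) :
    ∑ i, ‖x i‖ ^ 2 ≤ 2 * ∑ i, ‖y i‖ ^ 2 + 2 * ∑ i, ‖y i - x i‖ ^ 2 := by
  rw [Finset.mul_sum, Finset.mul_sum, ← Finset.sum_add_distrib]
  refine Finset.sum_le_sum fun i _ => ?_
  have h0 : ‖x i‖ ≤ ‖y i‖ + ‖y i - x i‖ := by
    rw [norm_sub_rev]; exact norm_le_norm_add_norm_sub' _ _
  have h := pow_le_pow_left₀ (norm_nonneg _) h0 2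
  linarith [sq_nonneg (‖y i‖ - ‖y i - x i‖)]

/-- Over a fixed number of steps the mean-square displacement is negligible compared with the
current error. -/
theorem exists_window_displacement (hA1 : M.A1) (hA2 : M.A2 μ) {κ : ℝ} (hκ : 0 ≤ κ)
    (hB : ∀ k ω, StateBound κ (M.state k ω)) (hγ : Tendsto M.gainSq atTop (𝓝 0)) (t : ℕ) :
    ∃ ρ : ℕ → ℝ, Tendsto ρ atTop (𝓝 0) ∧ ∀ᶠ s in atTop,
      ∫ ω, ∑ i, ‖M.err (s + t) ω i - M.err s ω i‖ ^ 2 ∂μ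
        ≤ ρ s * (1 + ∫ ω, M.sqErr (s + t) ω ∂μ) := by
  obtain ⟨C, hC, hdisp⟩ := exists_displacement hA1 hA2 hκ hB
  have hV := integrable_sqErr hA1 hA2 hκ hB
  have hu0 : ∀ k, 0 ≤ ∫ ω, M.sqErr k ω ∂μ := fun k => integral_nonneg (M.sqErr_nonneg k)
  have hCγ : Tendsto (fun k => C * M.gainSq k) atTop (𝓝 0) := by simpa using hγ.const_mul C
  -- For small gains the mean error cannot collapse in one step. Bounds relative to an earlier error
  -- thus become bounds relative to a later one, as required to absorb them into the recursion.
  have hgrow : ∀ᶠ k in atTop, 1 + ∫ ω, M.sqErr k ω ∂μ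
      ≤ 4 * (1 + ∫ ω, M.sqErr (k + 1) ω ∂μ) := by
    filter_upwards [hCγ.eventually (gt_mem_nhds (show (0 : ℝ) < 1 / 4 by norm_num))] with k hk
    have h1 : ∫ ω, M.sqErr k ω ∂μ ≤ 2 * ∫ ω, M.sqErr (k + 1) ω ∂μ
        + 2 * ∫ ω, ∑ i, ‖M.err (k + 1) ω i - M.err k ω i‖ ^ 2 ∂μ := by
      rw [← integral_const_mul, ← integral_const_mul,
        ← integral_add ((hV (k + 1)).const_mul 2) ((hdisp k).1.const_mul 2)]
      exact integral_mono (hV k) (((hV (k + 1)).const_mul 2).add ((hdisp k).1.const_mul 2))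
        fun ω => sum_norm_sq_le_add_sub (M.err k ω) (M.err (k + 1) ω)
    have h2 := (hdisp k).2
    have h3 := mul_le_mul_of_nonneg_right hk.le (add_nonneg zero_le_one (hu0 k))
    linarith [hu0 (k + 1)]
  induction t with
  | zero => exact ⟨fun _ => 0, tendsto_const_nhds, Eventually.of_forall fun s => by simp⟩
  | succ t ih =>
    obtain ⟨ρ, hρ, hD⟩ := ih
    refine ⟨fun s => 4 * (2 * |ρ s| + 2 * (C * M.gainSq (s + t))), ?_, ?_⟩
    · have h1 := (hρ.abs.const_mul 2).add
        ((hCγ.comp (tendsto_add_atTop_nat t)).const_mul 2)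
      simpa using h1.const_mul 4
    · filter_upwards [hD, (tendsto_add_atTop_nat t).eventually hgrow] with s hs hg
      have hstep := hdisp (s + t)
      have h1 : ∫ ω, ∑ i, ‖M.err (s + (t + 1)) ω i - M.err s ω i‖ ^ 2 ∂μ
          ≤ 2 * ∫ ω, ∑ i, ‖M.err (s + t + 1) ω i - M.err (s + t) ω i‖ ^ 2 ∂μ
            + 2 * ∫ ω, ∑ i, ‖M.err (s + t) ω i - M.err s ω i‖ ^ 2 ∂μ := by
        have hi := integrable_sum_norm_sq_sub (hV (s + t)) (hV s)
        rw [← integral_const_mul, ← integral_const_mul,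
          ← integral_add (hstep.1.const_mul 2) (hi.const_mul 2)]
        exact integral_mono (integrable_sum_norm_sq_sub (hV (s + (t + 1))) (hV s))
          ((hstep.1.const_mul 2).add (hi.const_mul 2)) fun ω =>
          sum_norm_sq_sub_triangle (M.err (s + t + 1) ω) (M.err (s + t) ω) (M.err s ω)
      have hu := add_nonneg zero_le_one (hu0 (s + t))
      have h2 : ρ s * (1 + ∫ ω, M.sqErr (s + t) ω ∂μ)
          ≤ |ρ s| * (1 + ∫ ω, M.sqErr (s + t) ω ∂μ) :=
        mul_le_mul_of_nonneg_right (le_abs_self _) hu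
      have hcoef : 0 ≤ 2 * |ρ s| + 2 * (C * M.gainSq (s + t)) :=
        add_nonneg (by positivity)
          (mul_nonneg zero_le_two (mul_nonneg hC (M.gainSq_nonneg _)))
      have h3 := mul_le_mul_of_nonneg_left hg hcoef
      have h4 := hstep.2
      change _ ≤ 4 * (2 * |ρ s| + 2 * (C * M.gainSq (s + t)))
        * (1 + ∫ ω, M.sqErr (s + t + 1) ω ∂μ)
      linarith

/-- Mean-square convergence for gains whose second-order part splits into a summable part and a
part negligible with respect to `min (a k) (b k)`. -/
theorem tendsto_integral_sqErr {ι : Type*} [Countable ι] {S : ι → State N n m} {p : ι → ι → ℝ}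
    {π : ι → ℝ} (hG : M.BalancedConditionalDigraphs μ) (hA1 : M.A1) (hA2 : M.A2 μ)
    (hA3 : M.A3 μ S p π) (hnonneg : ∀ i j, 0 ≤ stationaryAdj S π i j)
    (hbal : IsBalanced (stationaryAdj S π)) (htree : HasSpanningTree (stationaryAdj S π))
    (hobs : JointlyObservable S π) {κ : ℝ} (hκ : 0 ≤ κ) (hS : ∀ l, StateBound κ (S l))
    (hB : ∀ k ω, StateBound κ (M.state k ω)) (ha : ∀ k, 0 ≤ M.a k) (hb : ∀ k, 0 ≤ M.b k)
    (hsum : Tendsto (fun K => ∑ k ∈ Finset.range K, min (M.a k) (M.b k)) atTop atTop)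
    (hγ : Tendsto M.gainSq atTop (𝓝 0)) {r q : ℕ → ℝ} (hr : ∀ k, 0 ≤ r k) (hrs : Summable r)
    (hq : q =o[atTop] fun k => min (M.a k) (M.b k)) (hrq : ∀ k, M.gainSq k ≤ r k + q k) :
    Tendsto (fun k => ∫ ω, M.sqErr k ω ∂μ) atTop (𝓝 0) := by
  obtain ⟨C, hC, hstep⟩ := exists_one_step hA1 hA2 hκ hB
  obtain ⟨θ, hθ, t, hdiss⟩ := exists_mean_dissipation hA1 hA2 hA3 hnonneg hbal htree hobs hκ hS hB
  obtain ⟨ρ, hρ, hwin⟩ := exists_window_displacement hA1 hA2 hκ hB hγ t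
  obtain ⟨C', hC', hpert⟩ := exists_quad_perturbation (N := N) (n := n) (m := m) hκ (half_pos hθ)
  have hV := integrable_sqErr hA1 hA2 hκ hB
  have hu0 : ∀ k, 0 ≤ ∫ ω, M.sqErr k ω ∂μ := fun k => integral_nonneg (M.sqErr_nonneg k)
  set d : ℕ → ℝ := fun k => min (M.a k) (M.b k) with hd
  have hd0 : ∀ k, 0 ≤ d k := fun k => le_min (ha k) (hb k)
  have hdlim : Tendsto d atTop (𝓝 0) := by
    have h1 : Tendsto (fun k => √(M.gainSq k)) atTop (𝓝 0) := by
      have := (Real.continuous_sqrt.tendsto 0).comp hγ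
      rwa [Real.sqrt_zero] at this
    refine squeeze_zero hd0 (fun k => Real.le_sqrt_of_sq_le ?_) h1
    have h2 : d k ^ 2 ≤ M.a k ^ 2 := pow_le_pow_left₀ (hd0 k) (min_le_left _ _) 2
    unfold gainSq
    linarith [sq_nonneg (M.b k), sq_nonneg (M.lam k), abs_nonneg (M.lam k)]
  -- Cost of unfreezing the error: `C'` comes from perturbing the form and `θ / 2` from comparing
  -- the frozen mean error with the current one.
  set ρ' : ℕ → ℝ := fun k => 2 * (C' + θ / 2) * |ρ (k - t)| with hρ'
  have hρ'lim : Tendsto ρ' atTop (𝓝 0) := by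
    have h1 := (hρ.comp (tendsto_sub_atTop_nat t)).abs.const_mul (2 * (C' + θ / 2))
    simpa using h1
  have hq' : (fun k => C * q k + ρ' k * d k) =o[atTop] d := by
    refine (hq.const_mul_left C).add ?_
    have h1 : ρ' =o[atTop] fun _ => (1 : ℝ) := (isLittleO_one_iff ℝ).2 hρ'lim
    simpa using h1.mul_isBigO (isBigO_refl d atTop)
  refine tendsto_zero_of_recursion (half_pos hθ) hu0 hd0 hdlim hsum
    (fun k => mul_nonneg hC (hr k)) (hrs.mul_left C) hq' ?_
  have hwin' := (tendsto_sub_atTop_nat t).eventually hwin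
  filter_upwards [hwin', eventually_ge_atTop (t + 1)] with k hwk hk
  obtain ⟨j, rfl⟩ : ∃ j, k = j + 1 + t := ⟨k - t - 1, by omega⟩
  have hsub : j + 1 + t - t = j + 1 := by omega
  rw [hsub] at hwk
  have hone : ∫ ω, (1 + M.sqErr (j + 1 + t) ω) ∂μ = 1 + ∫ ω, M.sqErr (j + 1 + t) ω ∂μ := by
    rw [integral_add (integrable_const 1) (hV _)]; simp
  have h1 := hstep (j + 1 + t) Set.univ MeasurableSet.univ
  have hL0 := hG.setIntegral_lapAt_nonneg hB (hV (j + 1 + t)) MeasurableSet.univ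
  simp only [Measure.restrict_univ] at h1 hL0
  rw [hone] at h1
  have hR0 : 0 ≤ ∫ ω, regAt (M.state (j + 1 + t) ω) (M.err (j + 1 + t) ω) ∂μ :=
    integral_nonneg fun ω => regAt_nonneg _ _
  set D := ∫ ω, ∑ i, ‖M.err (j + 1 + t) ω i - M.err (j + 1) ω i‖ ^ 2 ∂μ with hD
  have hDi := integrable_sum_norm_sq_sub (hV (j + 1 + t)) (hV (j + 1))
  have hi1 : ∀ s, Integrable (fun ω => regAt (M.state (j + 1 + t) ω) (M.err s ω)
      + lapAt (M.state (j + 1 + t) ω) (M.err s ω)) μ := fun s =>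
    (integrable_regAt hB (hV s) _).add (integrable_lapAt hκ hB (hV s) _)
  have hlow : ∫ ω, (regAt (M.state (j + 1 + t) ω) (M.err (j + 1) ω)
        + lapAt (M.state (j + 1 + t) ω) (M.err (j + 1) ω)) ∂μ
        - θ / 2 * ∫ ω, M.sqErr (j + 1) ω ∂μ - C' * D
      ≤ ∫ ω, regAt (M.state (j + 1 + t) ω) (M.err (j + 1 + t) ω) ∂μ
        + ∫ ω, lapAt (M.state (j + 1 + t) ω) (M.err (j + 1 + t) ω) ∂μ := by
    have i1 := (hi1 (j + 1)).sub ((hV (j + 1)).const_mul (θ / 2))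
    have hm := integral_mono (i1.sub (hDi.const_mul C')) (hi1 (j + 1 + t))
      fun ω => hpert _ (hB _ ω) (M.err (j + 1) ω) (M.err (j + 1 + t) ω)
    rwa [integral_sub' i1 (hDi.const_mul C'),
      integral_sub' (hi1 (j + 1)) ((hV (j + 1)).const_mul (θ / 2)), integral_const_mul,
      integral_const_mul, integral_add (integrable_regAt hB (hV _) _)
        (integrable_lapAt hκ hB (hV _) _)
        (f := fun ω => regAt (M.state (j + 1 + t) ω) (M.err (j + 1 + t) ω))] at hm
  have hcomp : ∫ ω, M.sqErr (j + 1 + t) ω ∂μ ≤ 2 * ∫ ω, M.sqErr (j + 1) ω ∂μ + 2 * D := by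
    rw [hD, ← integral_const_mul, ← integral_const_mul,
      ← integral_add ((hV (j + 1)).const_mul 2) (hDi.const_mul 2)]
    refine integral_mono (hV _) (((hV (j + 1)).const_mul 2).add (hDi.const_mul 2)) fun ω => ?_
    have h := sum_norm_sq_le_add_sub (M.err (j + 1 + t) ω) (M.err (j + 1) ω)
    simp_rw [norm_sub_rev (M.err (j + 1) ω _)] at h
    exact h
  have hdj := hdiss j
  have hρj : ρ' (j + 1 + t) = 2 * (C' + θ / 2) * |ρ (j + 1)| := by simp only [hρ', hsub]
  set R := ∫ ω, regAt (M.state (j + 1 + t) ω) (M.err (j + 1 + t) ω) ∂μ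
  set L := ∫ ω, lapAt (M.state (j + 1 + t) ω) (M.err (j + 1 + t) ω) ∂μ
  set u := ∫ ω, M.sqErr (j + 1 + t) ω ∂μ with hu
  have hu0' : 0 ≤ 1 + u := add_nonneg zero_le_one (hu0 _)
  have hD2 : D ≤ |ρ (j + 1)| * (1 + u) :=
    hwk.trans (mul_le_mul_of_nonneg_right (le_abs_self _) hu0')
  -- Half of `θ` was spent on the perturbation of the form. The frozen mean error is at least half
  -- the current one minus the displacement, which halves the rest.
  have hRL : θ / 4 * u - (C' + θ / 2) * (|ρ (j + 1)| * (1 + u)) ≤ R + L := by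
    have e1 := mul_le_mul_of_nonneg_left hcomp (show 0 ≤ θ / 4 by positivity)
    have e2 := mul_le_mul_of_nonneg_left hD2 (show 0 ≤ C' + θ / 2 by positivity)
    linarith
  -- Both means are nonnegative separately, so each gain can be replaced by the smaller one; for `L`
  -- this rests on the conditional balance of the graphs.
  have hmin : d (j + 1 + t) * (R + L) ≤ M.a (j + 1 + t) * R + M.b (j + 1 + t) * L := by
    have e1 := mul_le_mul_of_nonneg_right (min_le_left (M.a (j + 1 + t)) (M.b (j + 1 + t))) hR0
    have e2 := mul_le_mul_of_nonneg_right (min_le_right (M.a (j + 1 + t)) (M.b (j + 1 + t))) hL0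
    simp only [hd]
    linarith
  have hmul := mul_le_mul_of_nonneg_left hRL (hd0 (j + 1 + t))
  have hγ' := mul_le_mul_of_nonneg_right (mul_le_mul_of_nonneg_left (hrq (j + 1 + t)) hC) hu0'
  rw [hρj]
  linarith

end Model

end DecReg

end

/-! ### The gain conditions and almost sure convergence. -/

namespace DecReg.Model

variable {Ω : Type*} [MeasurableSpace Ω] {N n : ℕ} {m : Fin N → ℕ} {M : Model Ω N n m}

/-- As `lam` is nonnegative and nonincreasing, its square is at most `lam 0 * lam k`, so the gain
conditions need not mention it. -/
theorem gainSq_le (hlam : ∀ k, 0 ≤ M.lam k) (hanti : Antitone M.lam) (k : ℕ) :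
    M.gainSq k ≤ (1 + M.lam 0) * (M.a k ^ 2 + M.b k ^ 2 + M.lam k) := by
  have h1 : M.lam k * M.lam k ≤ M.lam 0 * M.lam k :=
    mul_le_mul_of_nonneg_right (hanti (Nat.zero_le k)) (hlam k)
  have h2 := mul_nonneg (hlam 0) (add_nonneg (sq_nonneg (M.a k)) (sq_nonneg (M.b k)))
  rw [gainSq, abs_of_nonneg (hlam k), sq (M.lam k)]
  linarith

theorem C1.summable_gainSq (h : M.C1) : Summable M.gainSq :=
  (h.summable.mul_left (1 + M.lam 0)).of_nonneg_of_le M.gainSq_nonneg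
    (gainSq_le (fun k => (h.nonneg k).2.2) h.antitone_lam)

theorem C2.gainSq_isLittleO (h : M.C2) :
    M.gainSq =o[atTop] fun k => min (M.a k) (M.b k) := by
  refine IsBigO.trans_isLittleO (IsBigO.of_bound (1 + M.lam 0) (Eventually.of_forall fun k => ?_))
    h.littleO
  have h0 : 0 ≤ M.a k ^ 2 + M.b k ^ 2 + M.lam k :=
    add_nonneg (add_nonneg (sq_nonneg _) (sq_nonneg _)) (h.nonneg k).2.2
  rw [Real.norm_of_nonneg (M.gainSq_nonneg k), Real.norm_of_nonneg h0]
  exact gainSq_le (fun k => (h.nonneg k).2.2) h.antitone_lam k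

theorem C2.tendsto_gainSq (h : M.C2) : Tendsto M.gainSq atTop (𝓝 0) := by
  have h1 := (((h.tendsto_a.pow 2).add (h.tendsto_b.pow 2)).add (h.tendsto_lam.pow 2)).add
    h.tendsto_lam.abs
  have h2 : M.gainSq = fun k => M.a k ^ 2 + M.b k ^ 2 + M.lam k ^ 2 + |M.lam k| := rfl
  rw [h2]
  simpa using h1

/-- The filtration of the past sigma-algebras. -/
def pastFiltration (M : Model Ω N n m) : Filtration ℕ ‹MeasurableSpace Ω› :=
  ⟨M.past, M.past_mono, M.past_le⟩

theorem norm_sq_estimate_sub_le (k : ℕ) (ω : Ω) (i : Fin N) :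
    ‖M.estimate k ω i - M.x0‖ ^ 2 ≤ M.sqErr k ω :=
  Finset.single_le_sum (f := fun i => ‖M.err k ω i‖ ^ 2) (fun _ _ => sq_nonneg _)
    (Finset.mem_univ i)

/-- Both dissipation terms of the one-step inequality are nonnegative on every past event and are
discarded; the perturbations left are summable under (C1). -/
theorem ae_tendsto_sqErr {μ : Measure Ω} [IsProbabilityMeasure μ]
    (hG : M.BalancedConditionalDigraphs μ) (hA1 : M.A1) (hA2 : M.A2 μ) {κ : ℝ} (hκ : 0 ≤ κ)
    (hB : ∀ k ω, StateBound κ (M.state k ω)) (hC1 : M.C1)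
    (hlim : Tendsto (fun k => ∫ ω, M.sqErr k ω ∂μ) atTop (𝓝 0)) :
    ∀ᵐ ω ∂μ, Tendsto (fun k => M.sqErr k ω) atTop (𝓝 0) := by
  obtain ⟨C, hC, hstep⟩ := exists_one_step hA1 hA2 hκ hB
  have hV := integrable_sqErr hA1 hA2 hκ hB
  refine ae_tendsto_zero_of_almost_supermartingale (ℱ := M.pastFiltration)
    (g := fun k => C * M.gainSq k) M.sqErr_nonneg
    (fun k => (M.measurable_sqErr k).stronglyMeasurable) hV
    (fun k => mul_nonneg hC (M.gainSq_nonneg k)) (hC1.summable_gainSq.mul_left C)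
    (fun k s hs => ?_) hlim
  have h1 := hstep k s hs
  have h2 := mul_nonneg (hC1.nonneg k).2.1 (hG.setIntegral_lapAt_nonneg hB (hV k) hs)
  have h3 : 0 ≤ M.a k * ∫ ω in s, regAt (M.state k ω) (M.err k ω) ∂μ :=
    mul_nonneg (hC1.nonneg k).1 (integral_nonneg fun ω => regAt_nonneg _ _)
  linarith

end DecReg.Model

theorem corollary2 {Ω : Type*} [MeasurableSpace Ω] (μ : Measure Ω) [IsProbabilityMeasure μ]
    {N n : ℕ} {m : Fin N → ℕ} (M : DecReg.Model Ω N n m)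
    (hG : M.BalancedConditionalDigraphs μ) (hA1 : M.A1) (hA2 : M.A2 μ)
    {ι : Type*} [Countable ι] (S : ι → DecReg.State N n m) (p : ι → ι → ℝ) (π : ι → ℝ)
    (hA3 : M.A3 μ S p π)
    (hnonneg : ∀ i j, 0 ≤ DecReg.stationaryAdj S π i j)
    (hbalanced : DecReg.IsBalanced (DecReg.stationaryAdj S π))
    (htree : DecReg.HasSpanningTree (DecReg.stationaryAdj S π))
    (hobs : DecReg.JointlyObservable S π) :
    (M.C1 → ∀ i, ∀ᵐ ω ∂μ, Tendsto (fun k => M.estimate k ω i) atTop (𝓝 M.x0)) ∧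
    (M.C2 → ∀ i, (∀ k, Integrable (fun ω => ‖M.estimate k ω i - M.x0‖ ^ 2) μ) ∧
      Tendsto (fun k => ∫ ω, ‖M.estimate k ω i - M.x0‖ ^ 2 ∂μ) atTop (𝓝 0)) := by
  obtain ⟨κ, hκ, hS⟩ := hA3.exists_stateBound
  have hB : ∀ k ω, DecReg.StateBound κ (M.state k ω) := fun k ω => by
    obtain ⟨l, hl⟩ := hA3.chain.mem_states k ω
    have h : M.state k ω = S l := hl
    rw [h]
    exact hS l
  have hV := DecReg.Model.integrable_sqErr hA1 hA2 hκ hB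
  refine ⟨fun hC1 i => ?_, fun hC2 i => ?_⟩
  -- All of `gainSq` is taken as the summable part, with zero as the negligible part.
  · have hlim := DecReg.Model.tendsto_integral_sqErr hG hA1 hA2 hA3 hnonneg hbalanced htree hobs
      hκ hS hB (fun k => (hC1.nonneg k).1) (fun k => (hC1.nonneg k).2.1) hC1.sum_min
      hC1.summable_gainSq.tendsto_atTop_zero M.gainSq_nonneg hC1.summable_gainSq
      (isLittleO_zero _ _) fun k => (add_zero (M.gainSq k)).ge
    filter_upwards [DecReg.Model.ae_tendsto_sqErr hG hA1 hA2 hκ hB hC1 hlim] with ω hω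
    have h1 := (Real.continuous_sqrt.tendsto 0).comp hω
    rw [Real.sqrt_zero] at h1
    rw [tendsto_iff_norm_sub_tendsto_zero]
    exact squeeze_zero (fun k => norm_nonneg _)
      (fun k => Real.le_sqrt_of_sq_le (DecReg.Model.norm_sq_estimate_sub_le k ω i)) h1
  -- Here the summable part is zero and all of `gainSq` is negligible with respect to the smaller
  -- gain.
  · have hlim := DecReg.Model.tendsto_integral_sqErr hG hA1 hA2 hA3 hnonneg hbalanced htree hobs
      hκ hS hB (fun k => (hC2.nonneg k).1) (fun k => (hC2.nonneg k).2.1) hC2.sum_min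
      hC2.tendsto_gainSq (fun _ => le_rfl) summable_zero hC2.gainSq_isLittleO
      fun k => (zero_add (M.gainSq k)).ge
    have hint : ∀ k, Integrable (fun ω => ‖M.estimate k ω i - M.x0‖ ^ 2) μ := fun k =>
      DecReg.Model.integrable_norm_sq_err (hV k) i
    refine ⟨hint, squeeze_zero (fun k => integral_nonneg fun ω => sq_nonneg _) (fun k => ?_) hlim⟩
    exact integral_mono (hint k) (hV k) fun ω => DecReg.Model.norm_sq_estimate_sub_le k ω i
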